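/- Let $T>0$, $H_1\in(\tfrac12,\tfrac34]$ and $H_2\in(H_1,1)$. For $H\in(\tfrac12,1)$ let $$(\Gamma_H f)(t)=H(2H-1)\int_0^T\frac{f(s)}{|t-s|^{2-2H}}\,ds,\qquad t\in(0,T),$$ and let $h_T\in L_2(0,T)$ be the solution of $(\Gamma_{H_1}+\Gamma_{H_2})h_T=\mathbf 1_{[0,T]}$ (almost everywhere on $(0,T)$). Put $$\psi(u,s)=\frac{\partial}{\partial u}\int_0^u (u-t)^{\frac12-H_1}t^{\frac12-H_1}(s-t)^{2H_2-2}\,dt,\qquad 0<u<s<T,$$ and, for $0<s<u<T$, $$\varphi(u,s)=\frac{\partial}{\partial u}\int_s^u (u-t)^{\frac12-H_1}t^{\frac12-H_1}(t-s)^{2H_2-2}\,dt,\qquad \tau(u,s)=\frac{\partial}{\partial u}\int_0^s (u-t)^{\frac12-H_1}t^{\frac12-H_1}(s-t)^{2H_2-2}\,dt,$$ $$\rho(u,s)=\varphi(u,s)+\tau(u,s).$$ Let $K(u,s)=K_-(u,s)$ for $0<s<u<T$ and $K(u,s)=K_+(u,s)$ for $0<u<s<T$, where $$K_-(u,s)=u^{H_1-\frac12}(T-u)^{\frac12-H_1}\rho(u,s)+(H_1-\tfrac12)u^{\frac12-H_1}\int_u^T\frac{u^{2H_1-1}\rho(u,s)-t^{2H_1-1}\rho(t,s)}{(t-u)^{H_1+\frac12}}\,dt,$$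 $$\begin{aligned}K_+(u,s)={}&u^{H_1-\frac12}(s-u)^{\frac12-H_1}\psi(u,s)+(H_1-\tfrac12)u^{\frac12-H_1}\int_u^s\frac{u^{2H_1-1}\psi(u,s)-t^{2H_1-1}\psi(t,s)}{(t-u)^{H_1+\frac12}}\,dt\\&-(H_1-\tfrac12)u^{\frac12-H_1}\int_s^T(t-u)^{-\frac12-H_1}t^{2H_1-1}\rho(t,s)\,dt.\end{aligned}$$ Then the derivatives above exist, all integrals above that define $\psi$, $\varphi$, $\tau$, $K_-$ and $K_+$ converge absolutely, and for almost every $u\in(0,T)$ the function $s\mapsto h_T(s)K(u,s)$ is integrable on $(0,T)$ and $$h_T(u)+c(H_1,H_2)\int_0^T h_T(s)K(u,s)\,ds=g_T(u),$$ where, with $\Gamma$ and $B$ the gamma and beta functions, $$c(H_1,H_2)=\frac{\Gamma(2-2H_1)\cos(\pi(1-H_1))\,H_2(2H_2-1)}{\pi H_1(2H_1-1)\,\Gamma(\frac32-H_1)^2},\qquad g_T(u)=\frac{u^{1/2-H_1}(T-u)^{1/2-H_1}}{2H_1\,B(\frac32-H_1,\,H_1+\frac12)}.$$ -/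

import Mathlib

open MeasureTheory

namespace MixedFBM

noncomputable section

/-- The covariance operator of fractional Brownian motion with Hurst index `H` on `[0, T]`:
`(Γ_H f)(t) = H (2H - 1) ∫_0^T f(s) / |t - s|^(2 - 2H) ds`. -/
def Gam (H T : ℝ) (f : ℝ → ℝ) (t : ℝ) : ℝ :=
  H * (2 * H - 1) * ∫ s in (0 : ℝ)..T, f s / |t - s| ^ (2 - 2 * H)

/-- `h` is (a representative of) an `L²(0, T)` solution of `(Γ_{H₁} + Γ_{H₂}) h = 1_{[0,T]}`. -/
structure IsL2Solution (H₁ H₂ T : ℝ) (h : ℝ → ℝ) : Prop where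
  memLp : MemLp h 2 (volume.restrict (Set.Ioo 0 T))
  eq_one : ∀ᵐ t ∂(volume.restrict (Set.Ioo 0 T)), Gam H₁ T h t + Gam H₂ T h t = 1

/-- The integrand `(u - t)^(1/2 - H₁) t^(1/2 - H₁) (s - t)^(2 H₂ - 2)`, for `t < u` and `t < s`. -/
def integrandLt (H₁ H₂ u s t : ℝ) : ℝ :=
  (u - t) ^ (1 / 2 - H₁) * t ^ (1 / 2 - H₁) * (s - t) ^ (2 * H₂ - 2)

/-- The integrand `(u - t)^(1/2 - H₁) t^(1/2 - H₁) (t - s)^(2 H₂ - 2)`, for `s < t < u`. -/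
def integrandGt (H₁ H₂ u s t : ℝ) : ℝ :=
  (u - t) ^ (1 / 2 - H₁) * t ^ (1 / 2 - H₁) * (t - s) ^ (2 * H₂ - 2)

/-- The function whose `u`-derivative is `ψ(u, s)`. -/
def psiPrim (H₁ H₂ s u : ℝ) : ℝ := ∫ t in (0 : ℝ)..u, integrandLt H₁ H₂ u s t

/-- The function whose `u`-derivative is `φ(u, s)`. -/
def phiPrim (H₁ H₂ s u : ℝ) : ℝ := ∫ t in s..u, integrandGt H₁ H₂ u s t

/-- The function whose `u`-derivative is `τ(u, s)`. -/
def tauPrim (H₁ H₂ s u : ℝ) : ℝ := ∫ t in (0 : ℝ)..s, integrandLt H₁ H₂ u s t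

/-- `ψ(u, s)`, used for `0 < u < s < T`. -/
def psi (H₁ H₂ u s : ℝ) : ℝ := deriv (psiPrim H₁ H₂ s) u

/-- `φ(u, s)`, used for `0 < s < u < T`. -/
def phi (H₁ H₂ u s : ℝ) : ℝ := deriv (phiPrim H₁ H₂ s) u

/-- `τ(u, s)`, used for `0 < s < u < T`. -/
def tau (H₁ H₂ u s : ℝ) : ℝ := deriv (tauPrim H₁ H₂ s) u

/-- `ρ(u, s) = φ(u, s) + τ(u, s)`, used for `0 < s < u < T`. -/
def rho (H₁ H₂ u s : ℝ) : ℝ := phi H₁ H₂ u s + tau H₁ H₂ u s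

/-- The integrand of the fractional-derivative integral of `ρ`, for `s < u < t < T`. -/
def weylRho (H₁ H₂ u s t : ℝ) : ℝ :=
  (u ^ (2 * H₁ - 1) * rho H₁ H₂ u s - t ^ (2 * H₁ - 1) * rho H₁ H₂ t s)
    / (t - u) ^ (H₁ + 1 / 2)

/-- The integrand of the fractional-derivative integral of `ψ`, for `u < t < s`. -/
def weylPsi (H₁ H₂ u s t : ℝ) : ℝ :=
  (u ^ (2 * H₁ - 1) * psi H₁ H₂ u s - t ^ (2 * H₁ - 1) * psi H₁ H₂ t s)
    / (t - u) ^ (H₁ + 1 / 2)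

/-- The integrand of the last integral in `K₊`, for `u < s < t < T`. -/
def tailRho (H₁ H₂ u s t : ℝ) : ℝ :=
  (t - u) ^ (-(1 / 2) - H₁) * t ^ (2 * H₁ - 1) * rho H₁ H₂ t s

/-- `K₋(u, s)`, used for `0 < s < u < T`. -/
def Kminus (H₁ H₂ T u s : ℝ) : ℝ :=
  u ^ (H₁ - 1 / 2) * (T - u) ^ (1 / 2 - H₁) * rho H₁ H₂ u s
    + (H₁ - 1 / 2) * u ^ (1 / 2 - H₁) * ∫ t in u..T, weylRho H₁ H₂ u s t

/-- `K₊(u, s)`, used for `0 < u < s < T`. -/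
def Kplus (H₁ H₂ T u s : ℝ) : ℝ :=
  u ^ (H₁ - 1 / 2) * (s - u) ^ (1 / 2 - H₁) * psi H₁ H₂ u s
    + (H₁ - 1 / 2) * u ^ (1 / 2 - H₁) * (∫ t in u..s, weylPsi H₁ H₂ u s t)
    - (H₁ - 1 / 2) * u ^ (1 / 2 - H₁) * ∫ t in s..T, tailRho H₁ H₂ u s t

/-- The kernel `K(u, s)` on `(0, T)²`; its value on the diagonal (a null set) is irrelevant. -/
def K (H₁ H₂ T u s : ℝ) : ℝ :=
  if s < u then Kminus H₁ H₂ T u s else if u < s then Kplus H₁ H₂ T u s else 0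

/-- The constant `c(H₁, H₂)`. -/
def c (H₁ H₂ : ℝ) : ℝ :=
  Real.Gamma (2 - 2 * H₁) * Real.cos (Real.pi * (1 - H₁)) * (H₂ * (2 * H₂ - 1))
    / (Real.pi * (H₁ * (2 * H₁ - 1)) * Real.Gamma (3 / 2 - H₁) ^ 2)

/-- The right-hand side `g_T(u)`. Here `ProbabilityTheory.beta x y = Γ(x) Γ(y) / Γ(x + y)`. -/
def g (H₁ T u : ℝ) : ℝ :=
  u ^ (1 / 2 - H₁) * (T - u) ^ (1 / 2 - H₁)
    / (2 * H₁ * ProbabilityTheory.beta (3 / 2 - H₁) (H₁ + 1 / 2))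

/-- The formulas for `K` are meaningful off the diagonal: the derivatives that define
`ψ`, `φ`, `τ` exist, and every integral that occurs converges absolutely. -/
structure KernelWellDefined (H₁ H₂ T : ℝ) : Prop where
  psi_integrable : ∀ u s : ℝ, 0 < u → u < s → s < T →
    IntervalIntegrable (integrandLt H₁ H₂ u s) volume 0 u
  psi_differentiable : ∀ u s : ℝ, 0 < u → u < s → s < T →
    DifferentiableAt ℝ (psiPrim H₁ H₂ s) u
  phi_integrable : ∀ u s : ℝ, 0 < s → s < u → u < T →
    IntervalIntegrable (integrandGt H₁ H₂ u s) volume s u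
  phi_differentiable : ∀ u s : ℝ, 0 < s → s < u → u < T →
    DifferentiableAt ℝ (phiPrim H₁ H₂ s) u
  tau_integrable : ∀ u s : ℝ, 0 < s → s < u → u < T →
    IntervalIntegrable (integrandLt H₁ H₂ u s) volume 0 s
  tau_differentiable : ∀ u s : ℝ, 0 < s → s < u → u < T →
    DifferentiableAt ℝ (tauPrim H₁ H₂ s) u
  weylRho_integrable : ∀ u s : ℝ, 0 < s → s < u → u < T →
    IntervalIntegrable (weylRho H₁ H₂ u s) volume u T
  weylPsi_integrable : ∀ u s : ℝ, 0 < u → u < s → s < T →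
    IntervalIntegrable (weylPsi H₁ H₂ u s) volume u s
  tailRho_integrable : ∀ u s : ℝ, 0 < u → u < s → s < T →
    IntervalIntegrable (tailRho H₁ H₂ u s) volume s T

end

end MixedFBM

/-!
Put `a = H₁ - 1/2` and `p = 2 - 2 H₂`, so that `a, p > 0` and `2 a + p < 1`. The equation for `h`
says that a combination of the Riesz potentials of `h` with kernels `|z - s| ^ (2 a - 1)` and
`|z - s| ^ (-p)` is `1` on `(0, T)`. The transformed equation arises from it by two Abel transforms:
integrate against `z ^ (-a) (u - z) ^ (-a)` over `(0, u)` and differentiate in `u`; then multiply by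
`v ^ (2 a)`, integrate against `(v - u) ^ (-a)` over `(u, T)` and apply `-d/du`. The derivatives
need not be taken for transforms of `h`: the effect of a transform is stated as an equality of
integrals over all half-lines or all intervals `(u, T)`, and functions with the same integrals agree
almost everywhere (`ae_eq_of_lintegral_Iio_eq`, `ae_eq_of_lintegral_Ioo_eq`).

For the kernel `|z - w| ^ (2 a - 1)` a Möbius substitution gives a factorisation through truncated
powers (`lintegral_factor`), so the first transform yields
`abelKer a v w = const · v ^ (-2 a) |w| ^ a kk a w v`, where `kk a w v = (w - v)₊ ^ (a - 1)` for
`w ≥ 0` (`lintegral_abel_riesz`). The second transform is then a beta integral for `w ∈ (0, T)`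
(`lintegral_abel_kk`), and the first Riesz potential becomes multiplication by `x ^ a`. For
`w ∉ [0, T]` another Möbius substitution gives a kernel of Poisson type, the sweeping of the unit
mass at `w` onto `[0, T]` (`lintegral_balayage`).

The kernel `|z - s| ^ (-p)` is the superposition, with the positive density
`dens a p s w = const · |w - s| ^ (-2 a - p)`, of the kernels `|z - w| ^ (2 a - 1)`
(`lintegral_dens`). Hence its two transforms are known too: the first is `abelKer₂`, the second is
`sweptKer` (`lintegral_abel_abelKer₂`). All these kernels are nonnegative, so the computation takes
place in `[0, ∞]`, where Tonelli's theorem needs no integrability; a solution `h` of variable sign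
enters through its positive part `f` and its negative part `e`, for which the equation reads
`mixedPot f = 1 + mixedPot e` (`ae_mixedPot_eq`, `ae_sweptSum_eq`).

It remains to see that `sweptKer a p T u s = u ^ a K(u, s)` for all `u ≠ s` (`sweptKer_eq_K`). The
functions `ψ` and `ρ` are almost everywhere equal to `abelKer₂` (`ae_psi_eq`, `ae_rho_eq`), and they
are `C¹`, because their primitives are powers times Euler integrals (`psiPrim_eq`, `phiPrim_eq`,
`tauPrim_eq`, `contDiffOn_eulerInt`). The Abel integral
`∫_x^T (t - x) ^ (-a) t ^ (2 a) abelKer₂ a p t s dt` is the integral of `sweptKer` over `(x, T)`,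
with derivative `-sweptKer` since `sweptKer` is continuous off the diagonal
(`hasDerivAt_integral_sweptKer`); the Marchaud form of the same derivative (`hasDerivAt_abel`,
`hasDerivAt_abel_tail`) is `-u ^ a K(u, s)`, and its validity includes the absolute convergence of
the integrals in `K`.
-/

open MeasureTheory

namespace MixedFBM

noncomputable section

open Set ENNReal

/-! ### Truncated powers and beta integrals -/

/-- The truncated power `x₊ ^ e`, as an extended nonnegative real; it vanishes for `x ≤ 0`, whatever
the sign of `e`. -/
def pw (e x : ℝ) : ℝ≥0∞ := if 0 < x then ENNReal.ofReal (x ^ e) else 0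

/-- The power `|x| ^ e` as an extended nonnegative real, with the value `0` at `x = 0`. -/
def ap (e x : ℝ) : ℝ≥0∞ := pw e x + pw e (-x)

lemma pw_of_pos {e x : ℝ} (hx : 0 < x) : pw e x = ENNReal.ofReal (x ^ e) := if_pos hx

lemma pw_of_nonpos {e x : ℝ} (hx : x ≤ 0) : pw e x = 0 := if_neg hx.not_gt

lemma pw_ne_top (e x : ℝ) : pw e x ≠ ∞ := by
  unfold pw; split_ifs <;> simp

lemma pw_pos {e x : ℝ} (hx : 0 < x) : 0 < pw e x := by
  rw [pw_of_pos hx]; simpa using Real.rpow_pos_of_pos hx e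

lemma pw_mul {e e' x : ℝ} : pw e x * pw e' x = pw (e + e') x := by
  rcases lt_or_ge 0 x with hx | hx
  · rw [pw_of_pos hx, pw_of_pos hx, pw_of_pos hx, ← ENNReal.ofReal_mul (by positivity),
      Real.rpow_add hx]
  · simp [pw_of_nonpos hx]

lemma pw_zero {x : ℝ} (hx : 0 < x) : pw 0 x = 1 := by simp [pw_of_pos hx]

@[fun_prop]
lemma measurable_pw (e : ℝ) : Measurable (pw e) :=
  Measurable.ite measurableSet_Ioi (by fun_prop) measurable_const

@[fun_prop]
lemma measurable_ap (e : ℝ) : Measurable (ap e) := by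
  unfold ap; fun_prop

lemma ap_neg (e x : ℝ) : ap e (-x) = ap e x := by simp [ap, add_comm]

lemma ap_sub_comm (e x y : ℝ) : ap e (x - y) = ap e (y - x) := by
  rw [← ap_neg, neg_sub]

lemma ap_of_pos {e x : ℝ} (hx : 0 < x) : ap e x = pw e x := by
  simp [ap, pw_of_nonpos (show -x ≤ 0 by linarith)]

lemma ap_of_neg {e x : ℝ} (hx : x < 0) : ap e x = pw e (-x) := by
  simp [ap, pw_of_nonpos hx.le]

lemma ap_of_ne {e x : ℝ} (hx : x ≠ 0) : ap e x = ENNReal.ofReal (|x| ^ e) := by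
  rcases hx.lt_or_gt with h | h
  · rw [ap_of_neg h, pw_of_pos (by linarith), abs_of_neg h]
  · rw [ap_of_pos h, pw_of_pos h, abs_of_pos h]

lemma ap_ne_top (e x : ℝ) : ap e x ≠ ∞ := by
  simp [ap, pw_ne_top]

lemma ap_pos {e x : ℝ} (hx : x ≠ 0) : 0 < ap e x := by
  rw [ap_of_ne hx]; simpa using Real.rpow_pos_of_pos (abs_pos.2 hx) e

lemma ap_mul {e e' x : ℝ} : ap e x * ap e' x = ap (e + e') x := by
  rcases lt_trichotomy x 0 with h | h | h
  · simp only [ap_of_neg h, pw_mul]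
  · subst h; simp [ap, pw]
  · simp only [ap_of_pos h, pw_mul]

lemma ap_zero {x : ℝ} (hx : x ≠ 0) : ap 0 x = 1 := by simp [ap_of_ne hx]

lemma ap_mul_arg {e x y : ℝ} : ap e (x * y) = ap e x * ap e y := by
  by_cases hx : x = 0
  · simp [hx, ap, pw]
  by_cases hy : y = 0
  · simp [hy, ap, pw]
  rw [ap_of_ne hx, ap_of_ne hy, ap_of_ne (mul_ne_zero hx hy), abs_mul,
    Real.mul_rpow (abs_nonneg _) (abs_nonneg _), ENNReal.ofReal_mul (by positivity)]

lemma ap_inv_arg {e x : ℝ} : ap e x⁻¹ = ap (-e) x := by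
  by_cases hx : x = 0
  · simp [hx, ap, pw]
  rw [ap_of_ne hx, ap_of_ne (inv_ne_zero hx), abs_inv, Real.inv_rpow (abs_nonneg _),
    Real.rpow_neg (abs_nonneg _)]

lemma ap_div_arg {e x y : ℝ} : ap e (x / y) = ap e x * ap (-e) y := by
  rw [div_eq_mul_inv, ap_mul_arg, ap_inv_arg]

lemma ap_one {x : ℝ} (hx : x ≠ 0) : ENNReal.ofReal |x| = ap 1 x := by
  rw [ap_of_ne hx, Real.rpow_one]

/-- Affine change of variables for the Lebesgue integral. -/
lemma lintegral_comp_affine (f : ℝ → ℝ≥0∞) (x : ℝ) {k : ℝ} (hk : k ≠ 0) :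
    ∫⁻ v, f v = ENNReal.ofReal |k| * ∫⁻ y, f (x + k * y) := by
  have himg : (fun y : ℝ => x + k * y) '' univ = univ := by
    rw [image_univ]
    exact (Function.Surjective.range_eq fun v => ⟨(v - x) / k, by field_simp; ring⟩)
  have := lintegral_image_eq_lintegral_abs_deriv_mul (s := univ) (f := fun y : ℝ => x + k * y)
    (f' := fun _ => k) MeasurableSet.univ
    (fun y _ => by simpa using ((hasDerivAt_id y).const_mul k).const_add x)
    (fun y _ y' _ h => by simpa [hk] using h) f
  rw [himg, Measure.restrict_univ, lintegral_const_mul' _ _ ENNReal.ofReal_ne_top] at this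
  exact this

lemma lintegral_beta_unit {α β : ℝ} (hα : -1 < α) (hβ : -1 < β) :
    ∫⁻ b in Ioo (0 : ℝ) 1, pw α b * pw β (1 - b)
      = ENNReal.ofReal (ProbabilityTheory.beta (α + 1) (β + 1)) := by
  have hpos := ProbabilityTheory.beta_pos (α := α + 1) (β := β + 1) (by linarith) (by linarith)
  have h1 := ProbabilityTheory.lintegral_betaPDF_eq_one (α := α + 1) (β := β + 1) (by linarith)
    (by linarith)
  rw [ProbabilityTheory.lintegral_betaPDF] at h1
  calc ∫⁻ b in Ioo (0 : ℝ) 1, pw α b * pw β (1 - b)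
      = ∫⁻ b in Ioo (0 : ℝ) 1, ENNReal.ofReal (ProbabilityTheory.beta (α + 1) (β + 1)) *
          ENNReal.ofReal (1 / ProbabilityTheory.beta (α + 1) (β + 1) * b ^ (α + 1 - 1)
            * (1 - b) ^ (β + 1 - 1)) := by
        refine setLIntegral_congr_fun measurableSet_Ioo fun b hb => ?_
        have h0 : 0 < b := hb.1
        have h2 : 0 < 1 - b := by linarith [hb.2]
        rw [pw_of_pos h0, pw_of_pos h2, ← ENNReal.ofReal_mul hpos.le,
          ← ENNReal.ofReal_mul (by positivity)]
        congr 1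
        simp only [add_sub_cancel_right]
        field_simp
    _ = _ := by
        rw [lintegral_const_mul' _ _ ENNReal.ofReal_ne_top, h1, mul_one]

/-- Euler's beta integral on an arbitrary interval, in terms of truncated powers. -/
lemma lintegral_pw_mul_pw {α β : ℝ} (hα : -1 < α) (hβ : -1 < β) (x y : ℝ) :
    ∫⁻ v, pw α (v - x) * pw β (y - v)
      = ENNReal.ofReal (ProbabilityTheory.beta (α + 1) (β + 1)) * pw (α + β + 1) (y - x) := by
  rcases le_or_gt y x with h | h
  · rw [pw_of_nonpos (show y - x ≤ 0 by linarith), mul_zero]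
    refine (lintegral_congr fun v => ?_).trans lintegral_zero
    rcases le_or_gt v x with h' | h'
    · rw [pw_of_nonpos (by linarith), zero_mul]
    · rw [pw_of_nonpos (show y - v ≤ 0 by linarith), mul_zero]
  · have hk : 0 < y - x := by linarith
    rw [lintegral_comp_affine _ x hk.ne', ← lintegral_beta_unit hα hβ,
      ← lintegral_indicator measurableSet_Ioo, mul_comm _ (pw _ _), abs_of_pos hk]
    rw [← lintegral_const_mul' _ _ (pw_ne_top _ _), ← lintegral_const_mul' _ _ ofReal_ne_top]
    refine lintegral_congr fun b => ?_
    by_cases hb : b ∈ Ioo (0 : ℝ) 1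
    · rw [indicator_of_mem hb]
      have e1 : x + (y - x) * b - x = (y - x) * b := by ring
      have e2 : y - (x + (y - x) * b) = (y - x) * (1 - b) := by ring
      have h2 : 0 < 1 - b := by linarith [hb.2]
      have h3 := hb.1
      rw [e1, e2, ← ap_of_pos (mul_pos hk h3), ← ap_of_pos (mul_pos hk h2), ap_mul_arg, ap_mul_arg,
        ap_of_pos hk, ap_of_pos hk, ap_of_pos h3, ap_of_pos h2, ← pw_mul, ← pw_mul,
        show ENNReal.ofReal (y - x) = pw 1 (y - x) by rw [pw_of_pos hk, Real.rpow_one]]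
      ring
    · rw [indicator_of_notMem hb]
      rcases le_or_gt b 0 with h' | h'
      · rw [pw_of_nonpos (by nlinarith), zero_mul, mul_zero, mul_zero]
      · have : 1 ≤ b := by by_contra hc; exact hb ⟨h', by linarith⟩
        rw [pw_of_nonpos (x := y - _) (by nlinarith), mul_zero, mul_zero, mul_zero]

/-! ### Möbius substitutions and Riesz composition -/

/-- Change of variables in the form used for the Möbius substitutions below: the bijection is given
with its inverse. -/
lemma setLIntegral_subst {s t : Set ℝ} {f f' g : ℝ → ℝ} (hs : MeasurableSet s)
    (hf' : ∀ x ∈ s, HasDerivAt f (f' x) x) (hst : MapsTo f s t) (hts : MapsTo g t s)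
    (hgf : LeftInvOn g f s) (hfg : RightInvOn g f t) (F : ℝ → ℝ≥0∞) :
    ∫⁻ v in t, F v = ∫⁻ x in s, ENNReal.ofReal |f' x| * F (f x) := by
  have hb : BijOn f s t := InvOn.bijOn ⟨hgf, hfg⟩ hst hts
  rw [← hb.image_eq]
  exact lintegral_image_eq_lintegral_abs_deriv_mul hs (fun x hx => (hf' x hx).hasDerivWithinAt)
    hb.injOn F

/-- `(w - v)₊ ^ (a - 1)` for `w ≥ 0`, and `|w - v| ^ (a - 1)` for `w < 0`. Up to the factor
`v ^ (-2 a)` and factors independent of `v`, this is for `v > 0` the value of the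
`v`-derivative of `∫_0^v z ^ (-a) (v - z) ^ (-a) |z - w| ^ (2 a - 1) dz`. -/
def kk (a w v : ℝ) : ℝ≥0∞ := pw (a - 1) (w - v) + if w < 0 then pw (a - 1) (v - w) else 0

lemma measurable_kk (a : ℝ) : Measurable fun q : ℝ × ℝ => kk a q.1 q.2 := by
  unfold kk
  refine Measurable.add (by fun_prop) (Measurable.ite ?_ (by fun_prop) measurable_const)
  exact measurableSet_lt measurable_fst measurable_const

lemma kk_of_nonneg {a w : ℝ} (hw : 0 ≤ w) (v : ℝ) : kk a w v = pw (a - 1) (w - v) := by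
  simp [kk, hw.not_gt]

lemma kk_of_neg {a w : ℝ} (hw : w < 0) (v : ℝ) : kk a w v = ap (a - 1) (w - v) := by
  simp [kk, hw, ap]

/-- The case of `lintegral_factor` in which `w` lies outside `[0, z]`. The substitution
`v = z w b / (w - z + z b)` maps `(0, 1)` onto `(0, z)` and turns the integrand into that of a beta
integral. -/
lemma lintegral_factor_aux {a z w : ℝ} (ha : 0 < a) (ha' : a < 1 / 2) (hz : 0 < z)
    (hw : w < 0 ∨ z < w) :
    ∫⁻ v in Ioo 0 z, ap (-2 * a) v * ap (a - 1) (z - v) * ap (a - 1) (w - v)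
      = ENNReal.ofReal (ProbabilityTheory.beta (1 - 2 * a) a)
        * (ap (-a) z * ap (-a) w * ap (2 * a - 1) (z - w)) := by
  have hw0 : w ≠ 0 := by rintro rfl; rcases hw with h | h <;> linarith
  have hd0 : w - z ≠ 0 := by intro h0; rcases hw with h | h <;> linarith
  -- `w - z` and `w - z + z b` have the same sign for `0 < b < 1`
  have hD : ∀ b ∈ Ioo (0 : ℝ) 1, w - z + z * b ≠ 0 := by
    rintro b ⟨h0, h1⟩ hc
    rcases hw with h | h <;> nlinarith
  have hwv : ∀ v ∈ Ioo 0 z, w - v ≠ 0 := by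
    rintro v ⟨_, h1⟩ hc
    rcases hw with h | h <;> linarith
  have hzv : ∀ b ∈ Ioo (0 : ℝ) 1,
      z - z * w * b / (w - z + z * b) = z * (w - z) * (1 - b) / (w - z + z * b) := by
    intro b hb
    have := hD b hb
    field_simp; ring
  have hww : ∀ b ∈ Ioo (0 : ℝ) 1,
      w - z * w * b / (w - z + z * b) = w * (w - z) / (w - z + z * b) := by
    intro b hb
    have := hD b hb
    field_simp; ring
  have hsign : ∀ b ∈ Ioo (0 : ℝ) 1, 0 < w / (w - z + z * b) ∧ 0 < (w - z) / (w - z + z * b) := by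
    rintro b ⟨h0, h1⟩
    rcases hw with h | h
    · exact ⟨div_pos_of_neg_of_neg h (by nlinarith), div_pos_of_neg_of_neg (by linarith)
        (by nlinarith)⟩
    · exact ⟨div_pos (by linarith) (by nlinarith), div_pos (by linarith) (by nlinarith)⟩
  have hsign' : ∀ v ∈ Ioo 0 z, 0 < w / (w - v) ∧ 0 < (w - z) / (w - v) := by
    rintro v ⟨h0, h1⟩
    rcases hw with h | h
    · exact ⟨div_pos_of_neg_of_neg h (by linarith), div_pos_of_neg_of_neg (by linarith)
        (by linarith)⟩
    · exact ⟨div_pos (by linarith) (by linarith), div_pos (by linarith) (by linarith)⟩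
  rw [setLIntegral_subst (s := Ioo 0 1) (f := fun b => z * w * b / (w - z + z * b))
    (f' := fun b => z * w * (w - z) / ((w - z + z * b) * (w - z + z * b)))
    (g := fun v => (w - z) * v / (z * (w - v))) measurableSet_Ioo]
  · calc _ = ∫⁻ b in Ioo (0 : ℝ) 1, (ap (-a) z * ap (-a) w * ap (2 * a - 1) (z - w))
            * (pw (-2 * a) b * pw (a - 1) (1 - b)) := by
          refine setLIntegral_congr_fun measurableSet_Ioo fun b hb => ?_
          rw [hzv b hb, hww b hb]
          have hb0 : 0 < b := hb.1
          have hb1 : 0 < 1 - b := by linarith [hb.2]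
          have hD0 := hD b hb
          rw [ap_one (by positivity), ap_sub_comm _ z w]
          simp only [ap_div_arg, ap_mul_arg]
          rw [ap_of_pos hb0, ap_of_pos hb1]
          generalize hDD : w - z + z * b = D at *
          generalize w - z = d at *
          calc _ = (ap 1 z * ap (-2 * a) z * ap (a - 1) z) * (ap 1 w * ap (-2 * a) w * ap (a - 1) w)
                * (ap 1 d * ap (a - 1) d * ap (a - 1) d) * (ap (-1) D * ap (-1) D * ap (-(-2 * a)) D
                  * ap (-(a - 1)) D * ap (-(a - 1)) D) * (pw (-2 * a) b * pw (a - 1) (1 - b)) := by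
                ring
            _ = _ := by
                simp only [ap_mul]
                rw [show (-1 + -1 + -(-2 * a) + -(a - 1) + -(a - 1) : ℝ) = 0 by ring, ap_zero hD0,
                  show (1 + -2 * a + (a - 1) : ℝ) = -a by ring,
                  show (1 + (a - 1) + (a - 1) : ℝ) = 2 * a - 1 by ring, mul_one]
      _ = _ := by
          rw [lintegral_const_mul' _ _ (ENNReal.mul_ne_top
            (ENNReal.mul_ne_top (ap_ne_top _ _) (ap_ne_top _ _)) (ap_ne_top _ _)),
            lintegral_beta_unit (by linarith) (by linarith), mul_comm,
            show -2 * a + 1 = 1 - 2 * a by ring, sub_add_cancel]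
  · intro b hb
    have := hD b hb
    have h1 : HasDerivAt (fun b => z * w * b) (z * w) b := by
      simpa using (hasDerivAt_id b).const_mul (z * w)
    have h2 : HasDerivAt (fun b => w - z + z * b) z b := by
      simpa using ((hasDerivAt_id b).const_mul z).const_add (w - z)
    refine (h1.div h2 this).congr_deriv ?_
    field_simp; ring
  · intro b hb
    have h1 := hsign b hb
    have h2 : 0 < 1 - b := by linarith [hb.2]
    have h3 := hb.1
    refine ⟨?_, ?_⟩
    · have := mul_pos (mul_pos hz h3) h1.1
      simp only
      exact lt_of_lt_of_eq this (by ring)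
    · have : 0 < z - z * w * b / (w - z + z * b) := by
        rw [hzv b hb]
        have := mul_pos (mul_pos hz h2) h1.2
        exact lt_of_lt_of_eq this (by ring)
      simp only; linarith
  · intro v hv
    have h1 := hsign' v hv
    have h0 := hwv v hv
    have h3 := hv.1
    have h2 : 0 < z - v := by linarith [hv.2]
    refine ⟨?_, ?_⟩
    · have := mul_pos (div_pos h3 hz) h1.2
      simp only
      exact lt_of_lt_of_eq this (by field_simp)
    · have : 0 < 1 - (w - z) * v / (z * (w - v)) := by
        have := mul_pos (div_pos h2 hz) h1.1
        exact lt_of_lt_of_eq this (by field_simp; ring)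
      simp only; linarith
  · intro b hb
    have := hww b hb
    have h0 := hD b hb
    simp only
    rw [this]
    field_simp
  · intro v hv
    have h0 := hwv v hv
    have : w - z + z * ((w - z) * v / (z * (w - v))) = w * (w - z) / (w - v) := by
      field_simp; ring
    simp only
    rw [this]
    field_simp

/-- The kernel `z ^ (-a) |w| ^ (-a) |z - w| ^ (2 a - 1)` factorises through truncated powers. -/
lemma lintegral_factor {a z w : ℝ} (ha : 0 < a) (ha' : a < 1 / 2) (hz : 0 < z)
    (hw : w ≠ 0) (hzw : w ≠ z) :
    ∫⁻ v, pw (-2 * a) v * pw (a - 1) (z - v) * kk a w v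
      = ENNReal.ofReal (ProbabilityTheory.beta (1 - 2 * a) a)
        * (pw (-a) z * ap (-a) w * ap (2 * a - 1) (z - w)) := by
  have key : ∀ z w : ℝ, 0 < z → (w < 0 ∨ z < w) →
      ∫⁻ v, pw (-2 * a) v * pw (a - 1) (z - v) * kk a w v
      = ENNReal.ofReal (ProbabilityTheory.beta (1 - 2 * a) a)
        * (pw (-a) z * ap (-a) w * ap (2 * a - 1) (z - w)) := by
    intro z w hz hw
    rw [← ap_of_pos (e := -a) hz, ← lintegral_factor_aux ha ha' hz hw,
      ← lintegral_indicator measurableSet_Ioo]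
    refine lintegral_congr fun v => ?_
    by_cases hv : v ∈ Ioo 0 z
    · rw [indicator_of_mem hv, ap_of_pos hv.1, ap_of_pos (show 0 < z - v by linarith [hv.2])]
      congr 1
      rcases hw with h | h
      · rw [kk_of_neg h]
      · rw [kk_of_nonneg (by linarith), ap_of_pos (by linarith [hv.2])]
    · rw [indicator_of_notMem hv]
      rcases le_or_gt v 0 with h' | h'
      · rw [pw_of_nonpos h', zero_mul, zero_mul]
      · have : z ≤ v := by by_contra hc; exact hv ⟨h', by linarith⟩
        rw [pw_of_nonpos (x := z - v) (by linarith), mul_zero, zero_mul]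
  rcases hw.lt_or_gt with h | h
  · exact key z w hz (Or.inl h)
  rcases hzw.lt_or_gt with h' | h'
  · -- for `0 < w < z` the integrand is symmetric in `z` and `w`
    have := key w z h (Or.inr h')
    rw [ap_sub_comm, ap_of_pos hz, ← ap_of_pos h, mul_comm (ap (-a) w)] at this
    rw [← this]
    refine lintegral_congr fun v => ?_
    rw [kk_of_nonneg h.le, kk_of_nonneg hz.le]; ring
  · exact key z w hz (Or.inr h')

/-- For `w` outside `[0, T]`, integrating `kk a w v` against `(v - u)₊ ^ (-a)` gives the integral
over `(u, T)` of a kernel of Poisson type. -/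
lemma lintegral_balayage {a u T w : ℝ} (hu : 0 < u) (huT : u < T)
    (hw : w < 0 ∨ T < w) :
    ∫⁻ v in Iio T, pw (-a) (v - u) * kk a w v
      = ∫⁻ x in Ioo u T, pw (-a) (T - x) * ap a (w - T) * ap (-1) (w - x) := by
  have hwu : w - u ≠ 0 := by intro h0; rcases hw with h | h <;> linarith
  have hwT : w - T ≠ 0 := by intro h0; rcases hw with h | h <;> linarith
  have hD : ∀ x ∈ Ioo u T, w - x ≠ 0 := by
    rintro x ⟨h0, h1⟩ hc
    rcases hw with h | h <;> linarith
  have hsign : ∀ x ∈ Ioo u T, 0 < (w - u) / (w - x) ∧ 0 < (w - T) / (w - x) := by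
    rintro b ⟨h0, h1⟩
    rcases hw with h | h
    · exact ⟨div_pos_of_neg_of_neg (by linarith) (by linarith),
        div_pos_of_neg_of_neg (by linarith) (by linarith)⟩
    · exact ⟨div_pos (by linarith) (by linarith), div_pos (by linarith) (by linarith)⟩
  have hwv : ∀ x ∈ Ioo u T,
      w - (u + (w - u) * (T - x) / (w - x)) = (w - u) * (w - T) / (w - x) := by
    intro x hx
    have := hD x hx
    field_simp; ring
  have hTv : ∀ x ∈ Ioo u T,
      T - (u + (w - u) * (T - x) / (w - x)) = (x - u) * ((w - T) / (w - x)) := by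
    intro x hx
    have := hD x hx
    field_simp; ring
  have hm : MapsTo (fun x => u + (w - u) * (T - x) / (w - x)) (Ioo u T) (Ioo u T) := by
    intro x hx
    have h1 := hsign x hx
    refine ⟨?_, ?_⟩
    · have := mul_pos (show 0 < T - x by linarith [hx.2]) h1.1
      simp only
      have e : (T - x) * ((w - u) / (w - x)) = (w - u) * (T - x) / (w - x) := by ring
      linarith
    · have := mul_pos (show 0 < x - u by linarith [hx.1]) h1.2
      rw [← hTv x hx] at this
      simp only; linarith
  -- the substitution is an involution
  have hinv : LeftInvOn (fun x => u + (w - u) * (T - x) / (w - x))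
      (fun x => u + (w - u) * (T - x) / (w - x)) (Ioo u T) := by
    intro x hx
    have h0 := hD x hx
    simp only
    rw [hwv x hx, hTv x hx]
    field_simp; ring
  calc ∫⁻ v in Iio T, pw (-a) (v - u) * kk a w v
      = ∫⁻ v in Ioo u T, ap (-a) (v - u) * ap (a - 1) (w - v) := by
        rw [← lintegral_indicator measurableSet_Iio, ← lintegral_indicator measurableSet_Ioo]
        refine lintegral_congr fun v => ?_
        by_cases hv : v ∈ Ioo u T
        · rw [indicator_of_mem hv, indicator_of_mem (show v ∈ Iio T from hv.2),
            ap_of_pos (show 0 < v - u by linarith [hv.1])]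
          congr 1
          rcases hw with h | h
          · rw [kk_of_neg h]
          · rw [kk_of_nonneg (by linarith), ap_of_pos (by linarith [hv.2])]
        · rw [indicator_of_notMem hv]
          by_cases hv' : v ∈ Iio T
          · rw [indicator_of_mem hv', pw_of_nonpos, zero_mul]
            by_contra hc
            exact hv ⟨by linarith, hv'⟩
          · rw [indicator_of_notMem hv']
    _ = _ := by
        rw [setLIntegral_subst (s := Ioo u T) (f := fun x => u + (w - u) * (T - x) / (w - x))
          (f' := fun x => -((w - u) * (w - T) / ((w - x) * (w - x))))
          (g := fun x => u + (w - u) * (T - x) / (w - x)) measurableSet_Ioo _ hm hm hinv hinv]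
        · refine setLIntegral_congr_fun measurableSet_Ioo fun x hx => ?_
          have h0 := hD x hx
          rw [hwv x hx, add_sub_cancel_left, abs_neg, ap_one (by positivity)]
          simp only [ap_div_arg, ap_mul_arg]
          rw [ap_of_pos (show 0 < T - x by linarith [hx.2])]
          generalize w - x = D at *
          generalize w - u = y at *
          generalize w - T = d at *
          calc _ = (ap 1 y * ap (-a) y * ap (a - 1) y) * pw (-a) (T - x) * (ap 1 d * ap (a - 1) d)
                * (ap (-1) D * ap (-1) D * ap (-(-a)) D * ap (-(a - 1)) D) := by ring
            _ = _ := by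
                simp only [ap_mul]
                rw [show (1 + -a + (a - 1) : ℝ) = 0 by ring, ap_zero hwu,
                  show (1 + (a - 1) : ℝ) = a by ring,
                  show (-1 + -1 + -(-a) + -(a - 1) : ℝ) = -1 by ring, one_mul]
        · intro x hx
          have h0 := hD x hx
          have h1 : HasDerivAt (fun x => (w - u) * (T - x)) (-(w - u)) x := by
            simpa using ((hasDerivAt_id x).const_sub T).const_mul (w - u)
          have h2 : HasDerivAt (fun x => w - x) (-1) x := by
            simpa using (hasDerivAt_id x).const_sub w
          refine ((h1.div h2 h0).const_add u).congr_deriv ?_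
          field_simp; ring

/-- For `w ∈ (0, T)` the corresponding integral of `kk a w v` is constant in `u < w`. -/
lemma lintegral_abel_kk {a u T w : ℝ} (ha : 0 < a) (ha' : a < 1) (hw : w ∈ Ioo 0 T) :
    ∫⁻ v in Iio T, pw (-a) (v - u) * kk a w v
      = ENNReal.ofReal (ProbabilityTheory.beta (1 - a) a) * pw 0 (w - u) := by
  have := lintegral_pw_mul_pw (α := -a) (β := a - 1) (by linarith) (by linarith) u w
  rw [show -a + 1 = 1 - a by ring, show a - 1 + 1 = a by ring,
    show -a + (a - 1) + 1 = 0 by ring] at this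
  rw [← this, ← lintegral_indicator measurableSet_Iio]
  refine lintegral_congr fun v => ?_
  by_cases hv : v ∈ Iio T
  · rw [indicator_of_mem hv, kk_of_nonneg hw.1.le]
  · rw [indicator_of_notMem hv, pw_of_nonpos (x := w - v), mul_zero]
    have : T ≤ v := not_lt.1 hv
    linarith [hw.2]

/-- The constant in the composition formula for Riesz potentials, as an integral in `[0, ∞]`. -/
def rieszConst (a p : ℝ) : ℝ≥0∞ :=
  ∫⁻ w, ap (2 * a - 1) (1 - w) * ap (-2 * a - p) w

/-- Composition of Riesz potentials; it holds by scaling. -/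
lemma lintegral_riesz {a p z s : ℝ} (hzs : z ≠ s) :
    ∫⁻ w, ap (2 * a - 1) (z - w) * ap (-2 * a - p) (w - s) = rieszConst a p * ap (-p) (z - s) := by
  have hk : z - s ≠ 0 := sub_ne_zero.2 hzs
  rw [lintegral_comp_affine _ s hk, rieszConst, ap_one hk, mul_comm _ (ap (-p) _),
    ← lintegral_const_mul' _ _ (ap_ne_top _ _), ← lintegral_const_mul' _ _ (ap_ne_top _ _)]
  refine lintegral_congr fun y => ?_
  rw [show z - (s + (z - s) * y) = (z - s) * (1 - y) by ring, add_sub_cancel_left, ap_mul_arg,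
    ap_mul_arg]
  generalize z - s = k
  calc _ = (ap 1 k * ap (2 * a - 1) k * ap (-2 * a - p) k)
        * (ap (2 * a - 1) (1 - y) * ap (-2 * a - p) y) := by ring
    _ = _ := by
      simp only [ap_mul]
      rw [show (1 + (2 * a - 1) + (-2 * a - p) : ℝ) = -p by ring]

lemma rieszConst_pos (a p : ℝ) : rieszConst a p ≠ 0 := by
  rw [rieszConst, ← pos_iff_ne_zero]
  rw [lintegral_pos_iff_support (by fun_prop)]
  have hsub : Ioo (0 : ℝ) 1 ⊆ Function.support
      fun w => ap (2 * a - 1) (1 - w) * ap (-2 * a - p) w := by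
    intro w hw
    exact mul_ne_zero (ap_pos (by linarith [hw.2])).ne' (ap_pos hw.1.ne').ne'
  exact lt_of_lt_of_le (by simp) (measure_mono hsub)

/-- Each of the half-lines outside `[0, 1]`, and `[0, 1]` itself, contributes a beta integral. -/
lemma rieszConst_ne_top {a p : ℝ} (ha : 0 < a) (hp : 0 < p) (hap : 2 * a + p < 1) :
    rieszConst a p ≠ ∞ := by
  have h1 : ∫⁻ w in Ioo (0 : ℝ) 1, ap (2 * a - 1) (1 - w) * ap (-2 * a - p) w ≠ ∞ := by
    have := lintegral_beta_unit (α := -2 * a - p) (β := 2 * a - 1) (by linarith) (by linarith)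
    rw [setLIntegral_congr_fun (g := fun b => pw (-2 * a - p) b * pw (2 * a - 1) (1 - b))
      measurableSet_Ioo, this]
    · finiteness
    · intro w hw
      simp only
      rw [ap_of_pos hw.1, ap_of_pos (by linarith [hw.2] : 0 < 1 - w), mul_comm]
  have h2 : ∫⁻ w in Ioi (1 : ℝ), ap (2 * a - 1) (1 - w) * ap (-2 * a - p) w ≠ ∞ := by
    have := lintegral_beta_unit (α := p - 1) (β := 2 * a - 1) (by linarith) (by linarith)
    rw [setLIntegral_subst (s := Ioo 0 1) (f := fun b => b⁻¹) (f' := fun b => -(b ^ 2)⁻¹)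
      (g := fun b => b⁻¹) measurableSet_Ioo]
    · rw [setLIntegral_congr_fun (g := fun b => pw (p - 1) b * pw (2 * a - 1) (1 - b))
        measurableSet_Ioo, this]
      · finiteness
      · intro b hb
        have hb0 := hb.1
        have hb1 : 0 < 1 - b := by linarith [hb.2]
        simp only
        rw [abs_neg, ap_one (by positivity), show 1 - b⁻¹ = -((1 - b) / b) by field_simp; ring,
          ap_neg, ap_div_arg, ap_inv_arg, ap_inv_arg, pow_two, ap_mul_arg, ap_of_pos hb0,
          ap_of_pos hb1, ap_of_pos hb0, ap_of_pos hb0]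
        calc _ = (pw (-1) b * pw (-1) b * pw (-(2 * a - 1)) b * pw (-(-2 * a - p)) b)
              * pw (2 * a - 1) (1 - b) := by ring
          _ = _ := by
            simp only [pw_mul]
            congr 2; ring
    · intro b hb
      simpa using hasDerivAt_inv hb.1.ne'
    · intro b hb
      exact (one_lt_inv₀ hb.1).2 hb.2
    · intro b hb
      have : (0 : ℝ) < b := lt_trans one_pos hb
      exact ⟨inv_pos.2 this, inv_lt_one_of_one_lt₀ hb⟩
    · intro b _; simp
    · intro b _; simp
  have h3 : ∫⁻ w in Iio (0 : ℝ), ap (2 * a - 1) (1 - w) * ap (-2 * a - p) w ≠ ∞ := by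
    have := lintegral_beta_unit (α := p - 1) (β := -2 * a - p) (by linarith) (by linarith)
    rw [setLIntegral_subst (s := Ioo 0 1) (f := fun b => 1 - b⁻¹) (f' := fun b => (b ^ 2)⁻¹)
      (g := fun w => (1 - w)⁻¹) measurableSet_Ioo]
    · rw [setLIntegral_congr_fun (g := fun b => pw (p - 1) b * pw (-2 * a - p) (1 - b))
        measurableSet_Ioo, this]
      · finiteness
      · intro b hb
        have hb0 := hb.1
        have hb1 : 0 < 1 - b := by linarith [hb.2]
        simp only
        rw [ap_one (by positivity), sub_sub_cancel (1 : ℝ) b⁻¹,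
          show 1 - b⁻¹ = -((1 - b) / b) by field_simp; ring, ap_neg, ap_div_arg,
          ap_inv_arg, ap_inv_arg, pow_two, ap_mul_arg, ap_of_pos hb0,
          ap_of_pos hb1, ap_of_pos hb0, ap_of_pos hb0]
        calc _ = (pw (-1) b * pw (-1) b * pw (-(2 * a - 1)) b * pw (-(-2 * a - p)) b)
              * pw (-2 * a - p) (1 - b) := by ring
          _ = _ := by
            simp only [pw_mul]
            congr 2; ring
    · intro b hb
      simpa using (hasDerivAt_inv hb.1.ne').const_sub 1
    · intro b hb
      have := (one_lt_inv₀ hb.1).2 hb.2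
      simp only [mem_Iio]; linarith
    · intro w hw
      have : (1 : ℝ) < 1 - w := by linarith [mem_Iio.1 hw]
      exact ⟨inv_pos.2 (by linarith), inv_lt_one_of_one_lt₀ this⟩
    · intro b _; simp
    · intro b _; simp
  have hcover : (univ : Set ℝ) ⊆ (Iio 0 ∪ Ioo 0 1 ∪ Ioi 1) ∪ {0, 1} := by
    intro x _
    simp only [mem_union, mem_Iio, mem_Ioo, mem_Ioi, mem_insert_iff, mem_singleton_iff]
    rcases lt_trichotomy x 0 with h | h | h <;> rcases lt_trichotomy x 1 with h' | h' | h' <;>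
      simp [*]
  rw [rieszConst, ← setLIntegral_univ]
  refine ne_top_of_le_ne_top ?_ ((lintegral_mono_set hcover).trans (lintegral_union_le _ _ _))
  have h0 : volume ({0, 1} : Set ℝ) = 0 := (Set.toFinite _).measure_zero _
  rw [setLIntegral_measure_zero _ _ h0, add_zero]
  refine ne_top_of_le_ne_top ?_ ((lintegral_union_le _ _ _).trans
    (add_le_add_left (lintegral_union_le _ _ _) _))
  exact ENNReal.add_ne_top.2 ⟨ENNReal.add_ne_top.2 ⟨h3, h1⟩, h2⟩

/-! ### Abel transforms of the kernels -/

@[fun_prop]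
lemma measurable_kk_comp {α : Type*} [MeasurableSpace α] (a : ℝ) {f g : α → ℝ} (hf : Measurable f)
    (hg : Measurable g) : Measurable fun x => kk a (f x) (g x) :=
  (measurable_kk a).comp (hf.prodMk hg)

lemma lintegral_mul_lintegral_swap {μ ν : Measure ℝ} [SFinite μ] [SFinite ν] {A f : ℝ → ℝ≥0∞}
    {k : ℝ → ℝ → ℝ≥0∞} (hA : Measurable A) (hf : Measurable f)
    (hk : Measurable fun q : ℝ × ℝ => k q.1 q.2) :
    ∫⁻ z, A z * ∫⁻ s, f s * k z s ∂ν ∂μ = ∫⁻ s, f s * ∫⁻ z, A z * k z s ∂μ ∂ν := by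
  have hk1 : ∀ z, Measurable fun s => k z s := fun z => hk.comp (measurable_prodMk_left)
  have hk2 : ∀ s, Measurable fun z => k z s := fun s => hk.comp (measurable_prodMk_right)
  have hk3 : Measurable fun q : ℝ × ℝ => A q.1 * (f q.2 * k q.1 q.2) := by
    fun_prop
  calc ∫⁻ z, A z * ∫⁻ s, f s * k z s ∂ν ∂μ = ∫⁻ z, ∫⁻ s, A z * (f s * k z s) ∂ν ∂μ := by
        refine lintegral_congr fun z => ?_
        rw [lintegral_const_mul]
        exact hf.mul (hk1 z)
    _ = ∫⁻ s, ∫⁻ z, A z * (f s * k z s) ∂μ ∂ν :=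
        lintegral_lintegral_swap hk3.aemeasurable
    _ = _ := by
        refine lintegral_congr fun s => ?_
        refine Eq.trans (lintegral_congr fun z => ?_) (lintegral_const_mul (f s) (hA.mul (hk2 s)))
        ring

/-- An identity between weighted integrals of two kernels, valid for almost every value of the
second variable, carries over to the integral operators with these kernels. -/
lemma lintegral_kernel_transfer {μ ν : Measure ℝ} [SFinite μ] [SFinite ν] {A B f : ℝ → ℝ≥0∞}
    {k m : ℝ → ℝ → ℝ≥0∞} (hA : Measurable A) (hB : Measurable B) (hf : Measurable f)
    (hk : Measurable fun q : ℝ × ℝ => k q.1 q.2) (hm : Measurable fun q : ℝ × ℝ => m q.1 q.2)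
    (h : ∀ᵐ s, ∫⁻ z, A z * k z s ∂μ = ∫⁻ v, B v * m v s ∂ν) :
    ∫⁻ z, A z * (∫⁻ s, f s * k z s) ∂μ = ∫⁻ v, B v * (∫⁻ s, f s * m v s) ∂ν := by
  rw [lintegral_mul_lintegral_swap hA hf hk, lintegral_mul_lintegral_swap hB hf hm]
  refine lintegral_congr_ae ?_
  filter_upwards [h] with s hs
  rw [hs]

/-- The constant `B(1 - a, a) / B(1 - 2 a, a) = Γ(1 - a) ^ 2 / Γ(1 - 2 a)`. -/
def abelConst (a : ℝ) : ℝ := ProbabilityTheory.beta (1 - a) a / ProbabilityTheory.beta (1 - 2 * a) a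

lemma abelConst_pos {a : ℝ} (ha : 0 < a) (ha' : a < 1 / 2) : 0 < abelConst a :=
  div_pos (ProbabilityTheory.beta_pos (by linarith) ha)
    (ProbabilityTheory.beta_pos (by linarith) ha)

/-- The derivative in `v` of `∫_0^v z ^ (-a) (v - z) ^ (-a) |z - w| ^ (2 a - 1) dz`. -/
def abelKer (a v w : ℝ) : ℝ≥0∞ :=
  ENNReal.ofReal (abelConst a) * pw (-2 * a) v * ap a w * kk a w v

@[fun_prop]
lemma measurable_abelKer_comp {α : Type*} [MeasurableSpace α] (a : ℝ) {f g : α → ℝ}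
    (hf : Measurable f) (hg : Measurable g) : Measurable fun x => abelKer a (f x) (g x) := by
  unfold abelKer; fun_prop

/-- The first Abel transform of the Riesz kernel of order `2 a`. By `lintegral_factor` it is a
composition of truncated powers; the integral over `z` in that composition is a beta integral. -/
lemma lintegral_abel_riesz {a w : ℝ} (ha : 0 < a) (ha' : a < 1 / 2) (hw : w ≠ 0) (u : ℝ) :
    ∫⁻ z, pw (-a) z * pw (-a) (u - z) * ap (2 * a - 1) (z - w)
      = ∫⁻ v in Iio u, abelKer a v w := by
  set D := ENNReal.ofReal (ProbabilityTheory.beta (1 - 2 * a) a) with hD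
  have hDpos := ProbabilityTheory.beta_pos (α := 1 - 2 * a) (β := a) (by linarith) ha
  have hD0 : D ≠ 0 := by simpa [hD] using hDpos
  have hDt : D ≠ ∞ := ENNReal.ofReal_ne_top
  have hne : ∀ᵐ z : ℝ, z ≠ w := by simp [ae_iff, measure_singleton]
  have h1 : D * ∫⁻ z, pw (-a) z * pw (-a) (u - z) * ap (2 * a - 1) (z - w)
      = ∫⁻ z, pw (-a) (u - z) * ∫⁻ v, (ap a w * pw (-2 * a) v * kk a w v) * pw (a - 1) (z - v) := by
    rw [← lintegral_const_mul' _ _ hDt]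
    refine lintegral_congr_ae ?_
    filter_upwards [hne] with z hz
    rcases le_or_gt z 0 with h | h
    · rw [pw_of_nonpos h, zero_mul, zero_mul, mul_zero, eq_comm]
      refine (congrArg _ (lintegral_congr fun v => ?_)).trans (by rw [lintegral_zero, mul_zero])
      rcases le_or_gt v 0 with h' | h'
      · rw [pw_of_nonpos h', mul_zero, zero_mul, zero_mul]
      · rw [pw_of_nonpos (x := z - v) (by linarith), mul_zero]
    · have := lintegral_factor ha ha' h hw hz.symm
      have e : ∀ v, (ap a w * pw (-2 * a) v * kk a w v) * pw (a - 1) (z - v)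
          = ap a w * (pw (-2 * a) v * pw (a - 1) (z - v) * kk a w v) := fun v => by ring
      simp_rw [e]
      rw [lintegral_const_mul' _ _ (ap_ne_top _ _), this]
      calc _ = D * (pw (-a) z * pw (-a) (u - z) * ap (2 * a - 1) (z - w)) * ap 0 w := by
            rw [ap_zero hw, mul_one]
        _ = D * (pw (-a) z * pw (-a) (u - z) * ap (2 * a - 1) (z - w)) * (ap a w * ap (-a) w) := by
            rw [ap_mul, add_neg_cancel]
        _ = _ := by ring
  have h2 : ∫⁻ z, pw (-a) (u - z) * ∫⁻ v, (ap a w * pw (-2 * a) v * kk a w v) * pw (a - 1) (z - v)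
      = D * ∫⁻ v in Iio u, abelKer a v w := by
    rw [lintegral_mul_lintegral_swap (A := fun z => pw (-a) (u - z))
      (f := fun v => ap a w * pw (-2 * a) v * kk a w v) (k := fun z v => pw (a - 1) (z - v))
      (by fun_prop) (by fun_prop) (by fun_prop),
      ← lintegral_const_mul' _ _ hDt, ← lintegral_indicator measurableSet_Iio]
    refine lintegral_congr fun v => ?_
    have e := lintegral_pw_mul_pw (α := a - 1) (β := -a) (by linarith) (by linarith) v u
    rw [show a - 1 + 1 = a by ring, show -a + 1 = 1 - a by ring,
      show a - 1 + -a + 1 = 0 by ring] at e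
    have e' : ∫⁻ z, pw (-a) (u - z) * pw (a - 1) (z - v)
        = ENNReal.ofReal (ProbabilityTheory.beta a (1 - a)) * pw 0 (u - v) := by
      rw [← e]; exact lintegral_congr fun z => mul_comm _ _
    rw [e']
    by_cases hv : v ∈ Iio u
    · rw [indicator_of_mem hv, pw_zero (show 0 < u - v from sub_pos.2 hv), abelKer, abelConst]
      have : ProbabilityTheory.beta a (1 - a) = ProbabilityTheory.beta (1 - 2 * a) a *
          (ProbabilityTheory.beta (1 - a) a / ProbabilityTheory.beta (1 - 2 * a) a) := by
        rw [mul_div_cancel₀ _ hDpos.ne']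
        simp only [ProbabilityTheory.beta]
        rw [add_comm a, mul_comm (Real.Gamma a)]
      rw [this, ENNReal.ofReal_mul hDpos.le]
      ring
    · rw [indicator_of_notMem hv,
        pw_of_nonpos (x := u - v) (by linarith [not_lt.1 (mem_Iio.not.1 hv)]), mul_zero, mul_zero]
  exact (ENNReal.mul_right_inj hD0 hDt).1 (h1.trans h2)

/-- The density representing `|z - s| ^ (-p)` as a superposition of the kernels
`|z - w| ^ (2 a - 1)`. -/
def dens (a p s w : ℝ) : ℝ≥0∞ := (rieszConst a p)⁻¹ * ap (-2 * a - p) (w - s)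

@[fun_prop]
lemma measurable_dens_comp {α : Type*} [MeasurableSpace α] (a p : ℝ) {f g : α → ℝ}
    (hf : Measurable f) (hg : Measurable g) : Measurable fun x => dens a p (f x) (g x) := by
  unfold dens; fun_prop

lemma lintegral_dens {a p z s : ℝ} (ha : 0 < a) (hp : 0 < p) (hap : 2 * a + p < 1) (hzs : z ≠ s) :
    ∫⁻ w, dens a p s w * ap (2 * a - 1) (z - w) = ap (-p) (z - s) := by
  have h0 := rieszConst_pos a p
  have ht := rieszConst_ne_top ha hp hap
  simp_rw [dens, mul_assoc]
  rw [lintegral_const_mul' _ _ (ENNReal.inv_ne_top.2 h0)]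
  simp_rw [mul_comm (ap (-2 * a - p) _)]
  rw [lintegral_riesz hzs, ← mul_assoc, ENNReal.inv_mul_cancel h0 ht, one_mul]

/-- The derivative in `v` of `∫_0^v z ^ (-a) (v - z) ^ (-a) |z - s| ^ (-p) dz`. -/
def abelKer₂ (a p v s : ℝ) : ℝ≥0∞ := ∫⁻ w, dens a p s w * abelKer a v w

lemma measurable_abelKer₂ (a p : ℝ) : Measurable (Function.uncurry (abelKer₂ a p)) := by
  unfold abelKer₂ Function.uncurry
  refine Measurable.lintegral_prod_right' (f := fun q : (ℝ × ℝ) × ℝ =>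
    dens a p q.1.2 q.2 * abelKer a q.1.1 q.2) ?_
  fun_prop

@[fun_prop]
lemma measurable_abelKer₂_comp {α : Type*} [MeasurableSpace α] (a p : ℝ) {f g : α → ℝ}
    (hf : Measurable f) (hg : Measurable g) : Measurable fun x => abelKer₂ a p (f x) (g x) :=
  (measurable_abelKer₂ a p).comp (hf.prodMk hg)

lemma ae_ne (x : ℝ) : ∀ᵐ z : ℝ, z ≠ x := by simp [ae_iff, measure_singleton]

/-- The first Abel transform of the kernel `|z - s| ^ (-p)`. -/
lemma lintegral_abel_pow {a p : ℝ} (ha : 0 < a) (hp : 0 < p) (hap : 2 * a + p < 1) (u s : ℝ) :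
    ∫⁻ z, pw (-a) z * pw (-a) (u - z) * ap (-p) (z - s) = ∫⁻ v in Iio u, abelKer₂ a p v s := by
  calc _ = ∫⁻ z, pw (-a) z * pw (-a) (u - z) * ∫⁻ w, dens a p s w * ap (2 * a - 1) (z - w) := by
        refine lintegral_congr_ae ?_
        filter_upwards [ae_ne s] with z hz
        rw [lintegral_dens ha hp hap hz]
    _ = ∫⁻ v in Iio u, 1 * ∫⁻ w, dens a p s w * abelKer a v w := by
        refine lintegral_kernel_transfer (by fun_prop) (by fun_prop) (by fun_prop)
          (by fun_prop) (by fun_prop) ?_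
        filter_upwards [ae_ne 0] with w hw
        simp_rw [lintegral_abel_riesz ha (by linarith) hw, one_mul]
    _ = _ := by simp_rw [one_mul]; rfl

/-- The sweeping onto `[0, T]` of the part of `dens` outside `[0, T]`, without the factor
`(T - x) ^ (-a)`. -/
def sweptTail (a p T x s : ℝ) : ℝ≥0∞ :=
  ∫⁻ w in Iio 0 ∪ Ioi T, dens a p s w * ap a w * ap a (w - T) * ap (-1) (w - x)

@[fun_prop]
lemma measurable_sweptTail {α : Type*} [MeasurableSpace α] (a p T : ℝ) {f g : α → ℝ}
    (hf : Measurable f) (hg : Measurable g) : Measurable fun x => sweptTail a p T (f x) (g x) := by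
  unfold sweptTail
  refine Measurable.lintegral_prod_right' (f := fun q : α × ℝ =>
    dens a p (g q.1) q.2 * ap a q.2 * ap a (q.2 - T) * ap (-1) (q.2 - f q.1)) ?_
  fun_prop

/-- The second Abel transform of `abelKer₂`: a multiple of `|x| ^ a dens a p s x`, and the sweeping
onto `[0, T]` of the part of `dens` outside `[0, T]`. Off the diagonal it is `x ^ a K(x, s)`. -/
def sweptKer (a p T x s : ℝ) : ℝ≥0∞ :=
  ENNReal.ofReal (abelConst a) * (ENNReal.ofReal (ProbabilityTheory.beta (1 - a) a)
      * (ap a x * dens a p s x) + pw (-a) (T - x) * sweptTail a p T x s)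

@[fun_prop]
lemma measurable_sweptKer {α : Type*} [MeasurableSpace α] (a p T : ℝ) {f g : α → ℝ}
    (hf : Measurable f) (hg : Measurable g) : Measurable fun x => sweptKer a p T (f x) (g x) := by
  unfold sweptKer
  fun_prop

lemma lintegral_abel_abelKer {a u w T : ℝ} (hu : 0 < u) :
    ∫⁻ v in Iio T, pw (-a) (v - u) * pw (2 * a) v * abelKer a v w
      = ENNReal.ofReal (abelConst a) * ap a w * ∫⁻ v in Iio T, pw (-a) (v - u) * kk a w v := by
  rw [← lintegral_const_mul' _ _ (ENNReal.mul_ne_top ofReal_ne_top (ap_ne_top _ _))]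
  refine lintegral_congr fun v => ?_
  rcases le_or_gt v u with h | h
  · rw [pw_of_nonpos (x := v - u) (by linarith)]; simp
  · calc _ = ENNReal.ofReal (abelConst a) * ap a w * (pw (-a) (v - u) * kk a w v)
        * (pw (2 * a) v * pw (-2 * a) v) := by rw [abelKer]; ring
      _ = _ := by
        rw [pw_mul, show 2 * a + -2 * a = 0 by ring, pw_zero (hu.trans h), mul_one]

lemma lintegral_eq_Ioo_add_compl (T : ℝ) (F : ℝ → ℝ≥0∞) :
    ∫⁻ w, F w = (∫⁻ w in Ioo 0 T, F w) + ∫⁻ w in Iio 0 ∪ Ioi T, F w := by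
  rw [← lintegral_union (measurableSet_Iio.union measurableSet_Ioi), ← setLIntegral_univ]
  · refine (setLIntegral_congr ?_).symm
    filter_upwards [ae_ne 0, ae_ne T] with x h0 h1
    refine propext ⟨fun _ => trivial, fun _ => ?_⟩
    change x ∈ Ioo 0 T ∪ (Iio 0 ∪ Ioi T)
    rcases h0.lt_or_gt with h | h
    · exact Or.inr (Or.inl h)
    rcases h1.lt_or_gt with h' | h'
    · exact Or.inl ⟨h, h'⟩
    · exact Or.inr (Or.inr h')
  · refine Set.disjoint_left.2 ?_
    rintro x ⟨h0, h1⟩ (h | h)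
    · exact lt_asymm h0 h
    · exact lt_asymm h1 h

/-- The second Abel transform of the kernel `abelKer₂`. The part of the density on `(0, T)` gives
the first summand of `sweptKer`, and the part outside `[0, T]` is swept. -/
lemma lintegral_abel_abelKer₂ {a p u T : ℝ} (ha : 0 < a) (ha' : a < 1) (hu : 0 < u) (huT : u < T)
    (s : ℝ) :
    ∫⁻ v in Iio T, pw (-a) (v - u) * pw (2 * a) v * abelKer₂ a p v s
      = ∫⁻ x in Ioo u T, sweptKer a p T x s := by
  simp_rw [abelKer₂]
  rw [lintegral_mul_lintegral_swap (A := fun v => pw (-a) (v - u) * pw (2 * a) v)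
    (f := dens a p s) (k := abelKer a) (by fun_prop) (by unfold dens; fun_prop) (by fun_prop)]
  simp_rw [lintegral_abel_abelKer hu]
  rw [lintegral_eq_Ioo_add_compl T]
  simp_rw [sweptKer, sweptTail]
  rw [lintegral_const_mul' _ _ ofReal_ne_top, lintegral_add_left (by fun_prop), mul_add]
  congr 1
  · rw [lintegral_const_mul' _ _ ofReal_ne_top, ← lintegral_const_mul' _ _ ofReal_ne_top,
      ← lintegral_const_mul' _ _ ofReal_ne_top, ← lintegral_indicator measurableSet_Ioo,
      ← lintegral_indicator measurableSet_Ioo]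
    refine lintegral_congr fun w => ?_
    by_cases hw : w ∈ Ioo 0 T
    · rw [indicator_of_mem hw, lintegral_abel_kk ha ha' hw]
      rcases le_or_gt w u with h | h
      · rw [indicator_of_notMem (fun hc => not_lt.2 h hc.1),
          pw_of_nonpos (x := w - u) (by linarith)]
        simp
      · rw [indicator_of_mem (show w ∈ Ioo u T from ⟨h, hw.2⟩), pw_zero (by linarith)]
        ring
    · rw [indicator_of_notMem hw, indicator_of_notMem (fun hc => hw ⟨hu.trans hc.1, hc.2⟩)]
  · rw [← lintegral_const_mul' _ _ ofReal_ne_top]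
    have e : ∫⁻ x in Ioo u T, ENNReal.ofReal (abelConst a) * (pw (-a) (T - x) *
          ∫⁻ w in Iio 0 ∪ Ioi T, dens a p s w * ap a w * ap a (w - T) * ap (-1) (w - x))
        = ∫⁻ x in Ioo u T, (ENNReal.ofReal (abelConst a) * pw (-a) (T - x)) *
          ∫⁻ w in Iio 0 ∪ Ioi T, (dens a p s w * ap a w * ap a (w - T)) * ap (-1) (w - x) := by
      simp_rw [mul_assoc]
    rw [e, lintegral_mul_lintegral_swap
      (A := fun x => ENNReal.ofReal (abelConst a) * pw (-a) (T - x))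
      (f := fun w => dens a p s w * ap a w * ap a (w - T)) (k := fun x w => ap (-1) (w - x))
      (by fun_prop) (by fun_prop) (by fun_prop)]
    refine setLIntegral_congr_fun (measurableSet_Iio.union measurableSet_Ioi) fun w hw => ?_
    rw [lintegral_balayage hu huT hw]
    have e2 : ∀ x, pw (-a) (T - x) * ap a (w - T) * ap (-1) (w - x)
        = ap a (w - T) * (pw (-a) (T - x) * ap (-1) (w - x)) := fun x => by ring
    have e3 : ∀ x, ENNReal.ofReal (abelConst a) * pw (-a) (T - x) * ap (-1) (w - x)
        = ENNReal.ofReal (abelConst a) * (pw (-a) (T - x) * ap (-1) (w - x)) := fun x => by ring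
    simp_rw [e2, e3]
    rw [lintegral_const_mul' _ _ (ap_ne_top _ _), lintegral_const_mul' _ _ ofReal_ne_top]
    ring

/-! ### Abel transforms of the equation -/

lemma ae_eq_of_lintegral_Iio_eq {F G : ℝ → ℝ≥0∞} (hF : Measurable F) (hG : Measurable G) {T : ℝ}
    (hfin : ∫⁻ v in Iio T, F v ≠ ∞)
    (h : ∀ u ≤ T, ∫⁻ v in Iio u, F v = ∫⁻ v in Iio u, G v) :
    F =ᵐ[volume.restrict (Iio T)] G := by
  rw [← withDensity_eq_iff hF.aemeasurable hG.aemeasurable hfin]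
  have : IsFiniteMeasure ((volume.restrict (Iio T)).withDensity F) :=
    isFiniteMeasure_withDensity hfin
  refine Measure.ext_of_Iic _ _ fun u => ?_
  rw [withDensity_apply _ measurableSet_Iic, withDensity_apply _ measurableSet_Iic,
    Measure.restrict_restrict measurableSet_Iic]
  rcases lt_or_ge u T with hu | hu
  · rw [inter_eq_left.2 (show Iic u ⊆ Iio T from fun x hx => lt_of_le_of_lt hx hu),
      ← setLIntegral_congr Iio_ae_eq_Iic, ← setLIntegral_congr Iio_ae_eq_Iic, h u hu.le]
  · rw [inter_eq_right.2 (show Iio T ⊆ Iic u from fun x hx => hx.le.trans hu), h T le_rfl]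

lemma ae_Ioo_of_forall {P : ℝ → Prop} {T : ℝ} (hT : 0 < T)
    (h : ∀ r ∈ Ioo 0 T, ∀ᵐ x ∂volume.restrict (Ioo r T), P x) :
    ∀ᵐ x ∂volume.restrict (Ioo 0 T), P x := by
  have hcov : Ioo 0 T ⊆ ⋃ n : ℕ, Ioo (T / (n + 2)) T := by
    intro x hx
    obtain ⟨n, hn⟩ := exists_nat_gt (T / x)
    refine mem_iUnion.2 ⟨n, ?_, hx.2⟩
    rw [div_lt_iff₀ (by positivity)]
    have := (div_lt_iff₀ hx.1).1 hn
    nlinarith [hx.1]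
  refine ae_restrict_of_ae_restrict_of_subset hcov ?_
  refine (ae_restrict_iUnion_iff _ _).2 fun n => h _ ⟨by positivity, ?_⟩
  rw [div_lt_iff₀ (by positivity)]
  nlinarith [(Nat.cast_nonneg n : (0 : ℝ) ≤ n)]

lemma ae_eq_of_lintegral_Ioo_eq {F G : ℝ → ℝ≥0∞} (hF : Measurable F) (hG : Measurable G) {T : ℝ}
    (hT : 0 < T) (hfin : ∀ u ∈ Ioo 0 T, ∫⁻ v in Ioo u T, F v ≠ ∞)
    (h : ∀ u ∈ Ioo 0 T, ∫⁻ v in Ioo u T, F v = ∫⁻ v in Ioo u T, G v) :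
    F =ᵐ[volume.restrict (Ioo 0 T)] G := by
  have key : ∀ r ∈ Ioo 0 T, F =ᵐ[volume.restrict (Ioo r T)] G := by
    intro r hr
    rw [← withDensity_eq_iff hF.aemeasurable hG.aemeasurable (hfin r hr)]
    have : IsFiniteMeasure ((volume.restrict (Ioo r T)).withDensity F) :=
      isFiniteMeasure_withDensity (hfin r hr)
    refine Measure.ext_of_Ici _ _ fun u => ?_
    rw [withDensity_apply _ measurableSet_Ici, withDensity_apply _ measurableSet_Ici,
      Measure.restrict_restrict measurableSet_Ici]
    rcases le_or_gt u r with hu | hu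
    · rw [inter_eq_right.2 (show Ioo r T ⊆ Ici u from fun x hx => hu.trans hx.1.le), h r hr]
    rcases lt_or_ge u T with hu' | hu'
    · have e : Ici u ∩ Ioo r T = Ico u T := by
        ext x; constructor
        · rintro ⟨h1, h2⟩; exact ⟨h1, h2.2⟩
        · rintro ⟨h1, h2⟩; exact ⟨h1, lt_of_lt_of_le hu h1, h2⟩
      rw [e, ← setLIntegral_congr Ioo_ae_eq_Ico, ← setLIntegral_congr Ioo_ae_eq_Ico,
        h u ⟨hr.1.trans hu, hu'⟩]
    · have e : Ici u ∩ Ioo r T = ∅ := by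
        ext x; simp only [mem_inter_iff, mem_Ici, mem_Ioo, mem_empty_iff_false, iff_false]
        rintro ⟨h1, _, h2⟩; linarith
      rw [e]; simp
  exact ae_Ioo_of_forall hT key

/-- The integrals of `abelKer` in its first variable are bounded uniformly in the second one. -/
lemma lintegral_abelKer_le {a s : ℝ} (ha : 0 < a) (ha' : a < 1 / 2) (hs : 0 < s) :
    ∫⁻ v, abelKer a v s ≤ ENNReal.ofReal (ProbabilityTheory.beta (1 - a) a) := by
  have h := lintegral_pw_mul_pw (α := -2 * a) (β := a - 1) (by linarith) (by linarith) 0 s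
  rw [show -2 * a + 1 = 1 - 2 * a by ring, show a - 1 + 1 = a by ring,
    show -2 * a + (a - 1) + 1 = -a by ring] at h
  have hD := ProbabilityTheory.beta_pos (α := 1 - 2 * a) (β := a) (by linarith) ha
  calc ∫⁻ v, abelKer a v s
      = ∫⁻ v, (ENNReal.ofReal (abelConst a) * ap a s)
          * (pw (-2 * a) (v - 0) * pw (a - 1) (s - v)) := by
        refine lintegral_congr fun v => ?_
        rw [abelKer, kk_of_nonneg hs.le, sub_zero]; ring
    _ = ENNReal.ofReal (abelConst a) * ENNReal.ofReal (ProbabilityTheory.beta (1 - 2 * a) a)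
          * (pw a s * pw (-a) s) := by
        rw [lintegral_const_mul' _ _ (ENNReal.mul_ne_top ofReal_ne_top (ap_ne_top _ _)), h,
          ap_of_pos hs, sub_zero]
        ring
    _ = _ := by
        rw [pw_mul, add_neg_cancel, pw_zero hs, mul_one,
          ← ENNReal.ofReal_mul (abelConst_pos ha ha').le, abelConst, div_mul_cancel₀ _ hD.ne']
    _ ≤ _ := le_rfl

/-- On an interval of length `T` the kernel `|x| ^ (-p)` is dominated by `|x| ^ (2 a - 1)`. -/
lemma ap_neg_le {a p T x : ℝ} (hap : 2 * a + p < 1) (hx : |x| ≤ T) :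
    ap (-p) x ≤ ENNReal.ofReal (T ^ (1 - 2 * a - p)) * ap (2 * a - 1) x := by
  by_cases h0 : x = 0
  · simp [h0, ap, pw]
  · rw [show -p = (1 - 2 * a - p) + (2 * a - 1) by ring, ← ap_mul]
    refine mul_le_mul_left ?_ _
    rw [ap_of_ne h0]
    exact ENNReal.ofReal_le_ofReal
      (Real.rpow_le_rpow (abs_nonneg _) hx (by linarith))

lemma lintegral_abelKer₂_le {a p T s : ℝ} (ha : 0 < a) (hp : 0 < p) (hap : 2 * a + p < 1)
    (hs : s ∈ Ioo 0 T) :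
    ∫⁻ v in Iio T, abelKer₂ a p v s
      ≤ ENNReal.ofReal (T ^ (1 - 2 * a - p))
        * ENNReal.ofReal (ProbabilityTheory.beta (1 - a) a) := by
  rw [← lintegral_abel_pow ha hp hap]
  calc _ ≤ ∫⁻ z, ENNReal.ofReal (T ^ (1 - 2 * a - p)) *
        (pw (-a) z * pw (-a) (T - z) * ap (2 * a - 1) (z - s)) := by
        refine lintegral_mono fun z => ?_
        rcases le_or_gt z 0 with h | h
        · simp [pw_of_nonpos h]
        rcases le_or_gt T z with h' | h'
        · simp [pw_of_nonpos (show T - z ≤ 0 by linarith)]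
        rw [mul_left_comm]
        refine mul_le_mul_right (ap_neg_le hap ?_) _
        rw [abs_le]; constructor <;> linarith [hs.1, hs.2]
    _ ≤ _ := by
        rw [lintegral_const_mul' _ _ ofReal_ne_top, lintegral_abel_riesz ha (by linarith) hs.1.ne']
        exact mul_le_mul_right ((setLIntegral_le_lintegral _ _).trans
          (lintegral_abelKer_le ha (by linarith) hs.1)) _

lemma lintegral_kernel_ne_top {f : ℝ → ℝ≥0∞} {m : ℝ → ℝ → ℝ≥0∞} {μ : Measure ℝ} [SFinite μ]
    {c : ℝ≥0∞} {I : Set ℝ} (hc : c ≠ ∞)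
    (hf : Measurable f) (hfin : ∫⁻ s, f s ≠ ∞) (hI : ∀ s ∉ I, f s = 0)
    (hm : Measurable fun q : ℝ × ℝ => m q.1 q.2) (hb : ∀ s ∈ I, ∫⁻ v, m v s ∂μ ≤ c) :
    ∫⁻ v, (∫⁻ s, f s * m v s) ∂μ ≠ ∞ := by
  have h := lintegral_mul_lintegral_swap (μ := μ) (ν := volume) (A := fun _ => 1) measurable_const
    hf hm
  simp only [one_mul] at h
  rw [h]
  refine ne_top_of_le_ne_top (ENNReal.mul_ne_top hfin hc) ?_
  rw [← lintegral_mul_const' _ _ hc]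
  refine lintegral_mono fun s => ?_
  by_cases hs : s ∈ I
  · exact mul_le_mul_right (hb s hs) _
  · simp [hI s hs]

/-- The weighted Abel integral of a function that is integrable on `(-∞, T)` is finite almost
everywhere. -/
lemma ae_lintegral_abel_ne_top {a T : ℝ} (ha : 0 < a) (ha' : a < 1) {X : ℝ → ℝ≥0∞}
    (hX : Measurable X) (hfin : ∫⁻ v in Iio T, X v ≠ ∞) :
    ∀ᵐ u ∂volume.restrict (Ioo 0 T),
      ∫⁻ v in Iio T, pw (-a) (v - u) * pw (2 * a) v * X v ≠ ∞ := by
  have hm : Measurable fun q : ℝ × ℝ => pw (-a) (q.2 - q.1) * pw (2 * a) q.2 * X q.2 := by fun_prop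
  have key : ∫⁻ u in Ioo 0 T, ∫⁻ v in Iio T, pw (-a) (v - u) * pw (2 * a) v * X v ≠ ∞ := by
    rw [lintegral_lintegral_swap hm.aemeasurable]
    set c := ENNReal.ofReal (ProbabilityTheory.beta 1 (1 - a)) * ENNReal.ofReal (T ^ (1 + a))
    have hc : c ≠ ∞ := ENNReal.mul_ne_top ofReal_ne_top ofReal_ne_top
    refine ne_top_of_le_ne_top (ENNReal.mul_ne_top hc hfin) ?_
    rw [← lintegral_const_mul' _ _ hc]
    refine setLIntegral_mono' measurableSet_Iio fun v hv => ?_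
    have h1 : ∫⁻ u in Ioo 0 T, pw (-a) (v - u)
        ≤ ENNReal.ofReal (ProbabilityTheory.beta 1 (1 - a)) * pw (1 - a) v := by
      have h := lintegral_pw_mul_pw (α := 0) (β := -a) (by linarith) (by linarith) 0 v
      rw [show (0 : ℝ) + 1 = 1 by ring, show -a + 1 = 1 - a by ring, sub_zero,
        show 0 + -a + 1 = 1 - a by ring] at h
      rw [← h, ← lintegral_indicator measurableSet_Ioo]
      refine lintegral_mono fun u => ?_
      by_cases hu : u ∈ Ioo 0 T
      · rw [indicator_of_mem hu, sub_zero, pw_zero hu.1, one_mul]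
      · rw [indicator_of_notMem hu]; exact zero_le
    calc ∫⁻ u in Ioo 0 T, pw (-a) (v - u) * pw (2 * a) v * X v
        = (∫⁻ u in Ioo 0 T, pw (-a) (v - u)) * (pw (2 * a) v * X v) := by
          rw [← lintegral_mul_const _ (by fun_prop)]
          simp_rw [mul_assoc]
      _ ≤ (ENNReal.ofReal (ProbabilityTheory.beta 1 (1 - a)) * pw (1 - a) v)
            * (pw (2 * a) v * X v) := mul_le_mul_left h1 _
      _ = ENNReal.ofReal (ProbabilityTheory.beta 1 (1 - a)) * (pw (1 - a) v * pw (2 * a) v)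
            * X v := by ring
      _ ≤ c * X v := by
          refine mul_le_mul_left (mul_le_mul_right ?_ _) _
          rw [pw_mul, show 1 - a + 2 * a = 1 + a by ring]
          rcases le_or_gt v 0 with h | h
          · simp [pw_of_nonpos h]
          · rw [pw_of_pos h]
            exact ENNReal.ofReal_le_ofReal
              (Real.rpow_le_rpow h.le (le_of_lt hv) (by linarith))
  have hm' : Measurable fun u => ∫⁻ v in Iio T, pw (-a) (v - u) * pw (2 * a) v * X v :=
    Measurable.lintegral_prod_right' (f := fun q : ℝ × ℝ =>
      pw (-a) (q.2 - q.1) * pw (2 * a) q.2 * X q.2) hm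
  filter_upwards [ae_lt_top hm' key] with u hu using hu.ne

/-- If the weighted Abel integrals of an integrable `X` are the integrals of `S` over `(u, T)`, then
these are finite for every `u`: they are so for almost every `u`, and they decrease in `u`. -/
lemma lintegral_Ioo_ne_top_of_abel {a T : ℝ} (ha : 0 < a) (ha' : a < 1)
    {X S : ℝ → ℝ≥0∞} (hX : Measurable X) (hfin : ∫⁻ v in Iio T, X v ≠ ∞)
    (h : ∀ u ∈ Ioo 0 T, ∫⁻ v in Iio T, pw (-a) (v - u) * pw (2 * a) v * X v
      = ∫⁻ x in Ioo u T, S x) :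
    ∀ u ∈ Ioo 0 T, ∫⁻ x in Ioo u T, S x ≠ ∞ := by
  intro u hu
  have h1 := ae_lintegral_abel_ne_top ha ha' hX hfin
  have h2 : ∃ r ∈ Ioo 0 u, ∫⁻ v in Iio T, pw (-a) (v - r) * pw (2 * a) v * X v ≠ ∞ := by
    have h3 : ∀ᵐ r ∂volume.restrict (Ioo 0 u),
        ∫⁻ v in Iio T, pw (-a) (v - r) * pw (2 * a) v * X v ≠ ∞ :=
      ae_restrict_of_ae_restrict_of_subset (Ioo_subset_Ioo_right hu.2.le) h1
    have h4 : ∀ᵐ r ∂volume.restrict (Ioo 0 u), r ∈ Ioo 0 u := ae_restrict_mem measurableSet_Ioo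
    have : (ae (volume.restrict (Ioo 0 u))).NeBot := by
      rw [ae_neBot, Ne, Measure.restrict_eq_zero]
      simp [hu.1]
    exact ((h4.and h3).exists).imp fun r hr => hr
  obtain ⟨r, hr, hr'⟩ := h2
  rw [h r ⟨hr.1, hr.2.trans hu.2⟩] at hr'
  exact ne_top_of_le_ne_top hr' (lintegral_mono_set (Ioo_subset_Ioo_left hr.2.le))

lemma lintegral_Ioo_sweptKer_ne_top {a p T s : ℝ} (ha : 0 < a) (hp : 0 < p) (hap : 2 * a + p < 1)
    (hs : s ∈ Ioo 0 T) : ∀ u ∈ Ioo 0 T, ∫⁻ x in Ioo u T, sweptKer a p T x s ≠ ∞ := by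
  have hT : 0 < T := hs.1.trans hs.2
  refine lintegral_Ioo_ne_top_of_abel ha (by linarith) (X := fun v => abelKer₂ a p v s)
    (by fun_prop) (ne_top_of_le_ne_top (by finiteness) (lintegral_abelKer₂_le ha hp hap hs)) ?_
  intro u hu
  exact lintegral_abel_abelKer₂ ha (by linarith) hu.1 hu.2 s

lemma beta_comm (x y : ℝ) : ProbabilityTheory.beta x y = ProbabilityTheory.beta y x := by
  simp only [ProbabilityTheory.beta]; rw [add_comm, mul_comm]

/-- The first Abel transform of the constant `1`. -/
lemma lintegral_abel_one {a : ℝ} (ha : 0 < a) (ha' : a < 1 / 2) (u : ℝ) :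
    ∫⁻ z, pw (-a) z * pw (-a) (u - z)
      = ∫⁻ v in Iio u, ENNReal.ofReal (abelConst a) * pw (-2 * a) v := by
  have h1 := lintegral_pw_mul_pw (α := -a) (β := -a) (by linarith) (by linarith) 0 u
  have h2 := lintegral_pw_mul_pw (α := -2 * a) (β := 0) (by linarith) (by linarith) 0 u
  simp only [sub_zero] at h1 h2
  have h3 : ∫⁻ v in Iio u, ENNReal.ofReal (abelConst a) * pw (-2 * a) v
      = ENNReal.ofReal (abelConst a) * ∫⁻ v, pw (-2 * a) v * pw 0 (u - v) := by
    rw [← lintegral_const_mul' _ _ ofReal_ne_top, ← lintegral_indicator measurableSet_Iio]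
    refine lintegral_congr fun v => ?_
    by_cases hv : v ∈ Iio u
    · rw [indicator_of_mem hv, pw_zero (sub_pos.2 hv), mul_one]
    · rw [indicator_of_notMem hv,
        pw_of_nonpos (x := u - v) (by linarith [not_lt.1 (mem_Iio.not.1 hv)]), mul_zero, mul_zero]
  rw [h3, h1, h2, ← mul_assoc, ← ENNReal.ofReal_mul (abelConst_pos ha ha').le]
  congr 2
  · rw [show -a + 1 = 1 - a by ring, show -2 * a + 1 = 1 - 2 * a by ring, zero_add]
    simp only [abelConst, ProbabilityTheory.beta]
    have g1 := Real.Gamma_pos_of_pos (show 0 < 1 - a by linarith)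
    have g2 := Real.Gamma_pos_of_pos ha
    have g3 := Real.Gamma_pos_of_pos (show 0 < 1 - 2 * a by linarith)
    have g4 := Real.Gamma_pos_of_pos (show 0 < 1 - a + (1 - a) by linarith)
    rw [show 1 - a + a = 1 by ring, show 1 - 2 * a + a = 1 - a by ring,
      show 1 - 2 * a + 1 = 1 - a + (1 - a) by ring, Real.Gamma_one]
    generalize Real.Gamma (1 - 2 * a) = x at *
    generalize Real.Gamma (1 - a + (1 - a)) = y at *
    field_simp
  · ring

lemma lintegral_Iio_pw_sub {a u T : ℝ} (ha' : a < 1) :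
    ∫⁻ v in Iio T, pw (-a) (v - u) = ∫⁻ x in Ioo u T, pw (-a) (T - x) := by
  have h1 := lintegral_pw_mul_pw (α := -a) (β := 0) (by linarith) (by linarith) u T
  have h2 := lintegral_pw_mul_pw (α := 0) (β := -a) (by linarith) (by linarith) u T
  rw [beta_comm, add_comm 0 (-a), ← h1] at h2
  rw [← lintegral_indicator measurableSet_Iio, ← lintegral_indicator measurableSet_Ioo]
  refine Eq.trans ?_ (h2.symm.trans ?_)
  · refine lintegral_congr fun v => ?_
    by_cases hv : v ∈ Iio T
    · rw [indicator_of_mem hv, pw_zero (sub_pos.2 hv), mul_one]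
    · rw [indicator_of_notMem hv, pw_of_nonpos (x := T - v)
        (by linarith [not_lt.1 (mem_Iio.not.1 hv)]), mul_zero]
  · refine lintegral_congr fun v => ?_
    by_cases hv : v ∈ Ioo u T
    · rw [indicator_of_mem hv, pw_zero (sub_pos.2 hv.1), one_mul]
    · rw [indicator_of_notMem hv]
      rcases le_or_gt v u with h | h
      · rw [pw_of_nonpos (x := v - u) (by linarith), zero_mul]
      · rw [pw_of_nonpos (x := T - v), mul_zero]
        by_contra hc
        exact hv ⟨h, by linarith⟩

/-- The second Abel transform of the operator with kernel `abelKer` is a multiple of the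
multiplication by `x ^ a`. -/
lemma lintegral_abel_operator {a u T : ℝ} (ha : 0 < a) (ha' : a < 1) (hu : 0 < u)
    {f : ℝ → ℝ≥0∞} (hf : Measurable f) (hf0 : ∀ s ∉ Ioo 0 T, f s = 0) :
    ∫⁻ v in Iio T, pw (-a) (v - u) * pw (2 * a) v * ∫⁻ s, f s * abelKer a v s
      = ∫⁻ x in Ioo u T, ENNReal.ofReal (abelConst a)
        * ENNReal.ofReal (ProbabilityTheory.beta (1 - a) a) * (pw a x * f x) := by
  rw [lintegral_mul_lintegral_swap (A := fun v => pw (-a) (v - u) * pw (2 * a) v)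
    (k := abelKer a) (by fun_prop) hf (by fun_prop)]
  rw [← lintegral_indicator measurableSet_Ioo]
  refine lintegral_congr fun s => ?_
  by_cases hs : s ∈ Ioo 0 T
  · rw [lintegral_abel_abelKer hu, lintegral_abel_kk ha ha' hs, ap_of_pos hs.1]
    rcases le_or_gt s u with h | h
    · rw [indicator_of_notMem (fun hc => not_lt.2 h hc.1), pw_of_nonpos (x := s - u) (by linarith)]
      simp
    · rw [indicator_of_mem (show s ∈ Ioo u T from ⟨h, hs.2⟩), pw_zero (by linarith)]
      ring
  · rw [hf0 s hs, zero_mul, indicator_of_notMem (fun hc => hs ⟨hu.trans hc.1, hc.2⟩)]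

/-- The first Abel transform of the mixed Riesz potential of `f`. -/
def abelSum (a p : ℝ) (C₁ C₂ : ℝ≥0∞) (f : ℝ → ℝ≥0∞) (v : ℝ) : ℝ≥0∞ :=
  C₁ * (∫⁻ s, f s * abelKer a v s) + C₂ * ∫⁻ s, f s * abelKer₂ a p v s

/-- The mixed Riesz potential of `f`, with kernel `C₁ |z - s| ^ (2 a - 1) + C₂ |z - s| ^ (-p)`. -/
def mixedPot (a p : ℝ) (C₁ C₂ : ℝ≥0∞) (f : ℝ → ℝ≥0∞) (z : ℝ) : ℝ≥0∞ :=
  C₁ * (∫⁻ s, f s * ap (2 * a - 1) (z - s)) + C₂ * ∫⁻ s, f s * ap (-p) (z - s)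

/-- The second Abel transform of `abelSum`: up to a constant, `x ^ a` times the left-hand side of
the transformed equation. -/
def sweptSum (a p T : ℝ) (C₁ C₂ : ℝ≥0∞) (f : ℝ → ℝ≥0∞) (x : ℝ) : ℝ≥0∞ :=
  C₁ * (ENNReal.ofReal (abelConst a) * ENNReal.ofReal (ProbabilityTheory.beta (1 - a) a)
    * (pw a x * f x)) + C₂ * ∫⁻ s, f s * sweptKer a p T x s

lemma measurable_lintegral_kernel {f : ℝ → ℝ≥0∞} {m : ℝ → ℝ → ℝ≥0∞} (hf : Measurable f)
    (hm : Measurable fun q : ℝ × ℝ => m q.1 q.2) : Measurable fun v => ∫⁻ s, f s * m v s :=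
  Measurable.lintegral_prod_right' (f := fun q : ℝ × ℝ => f q.2 * m q.1 q.2) (by fun_prop)

lemma measurable_abelSum {a p : ℝ} {C₁ C₂ : ℝ≥0∞} {f : ℝ → ℝ≥0∞} (hf : Measurable f) :
    Measurable (abelSum a p C₁ C₂ f) :=
  ((measurable_lintegral_kernel (m := abelKer a) hf (by fun_prop)).const_mul _).add
    ((measurable_lintegral_kernel (m := abelKer₂ a p) hf (by fun_prop)).const_mul _)

lemma measurable_mixedPot {a p : ℝ} {C₁ C₂ : ℝ≥0∞} {f : ℝ → ℝ≥0∞} (hf : Measurable f) :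
    Measurable (mixedPot a p C₁ C₂ f) :=
  ((measurable_lintegral_kernel (m := fun z s => ap (2 * a - 1) (z - s)) hf
    (by fun_prop)).const_mul _).add
    ((measurable_lintegral_kernel (m := fun z s => ap (-p) (z - s)) hf (by fun_prop)).const_mul _)

lemma measurable_sweptSum {a p T : ℝ} {C₁ C₂ : ℝ≥0∞} {f : ℝ → ℝ≥0∞} (hf : Measurable f) :
    Measurable (sweptSum a p T C₁ C₂ f) :=
  Measurable.add (by fun_prop)
    ((measurable_lintegral_kernel (m := sweptKer a p T) hf
      (measurable_sweptKer a p T measurable_fst measurable_snd)).const_mul _)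

lemma lintegral_abel_mixedPot {a p : ℝ} {C₁ C₂ : ℝ≥0∞} {f : ℝ → ℝ≥0∞} (ha : 0 < a) (hp : 0 < p)
    (hap : 2 * a + p < 1) (hf : Measurable f) (u : ℝ) :
    ∫⁻ z, pw (-a) z * pw (-a) (u - z) * mixedPot a p C₁ C₂ f z
      = ∫⁻ v in Iio u, abelSum a p C₁ C₂ f v := by
  have h1 := lintegral_kernel_transfer (μ := volume) (ν := volume.restrict (Iio u)) (f := f)
    (A := fun z => pw (-a) z * pw (-a) (u - z)) (B := fun _ => 1)
    (k := fun z s => ap (2 * a - 1) (z - s)) (m := abelKer a) (by fun_prop) (by fun_prop) hf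
    (by fun_prop) (by fun_prop) (by
      filter_upwards [ae_ne 0] with s hs
      simp_rw [one_mul]
      exact lintegral_abel_riesz ha (by linarith) hs u)
  have h2 := lintegral_kernel_transfer (μ := volume) (ν := volume.restrict (Iio u)) (f := f)
    (A := fun z => pw (-a) z * pw (-a) (u - z)) (B := fun _ => 1)
    (k := fun z s => ap (-p) (z - s)) (m := abelKer₂ a p) (by fun_prop) (by fun_prop) hf
    (by fun_prop) (by fun_prop) (by
      filter_upwards with s
      simp_rw [one_mul]
      exact lintegral_abel_pow ha hp hap u s)
  simp only [one_mul] at h1 h2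
  have m1 := measurable_lintegral_kernel (m := fun z s => ap (2 * a - 1) (z - s)) hf (by fun_prop)
  have m2 := measurable_lintegral_kernel (m := fun z s => ap (-p) (z - s)) hf (by fun_prop)
  have m3 := measurable_lintegral_kernel (m := abelKer a) hf (by fun_prop)
  have m4 := measurable_lintegral_kernel (m := abelKer₂ a p) hf (by fun_prop)
  simp only [abelSum, mixedPot]
  rw [lintegral_add_left (by fun_prop), lintegral_const_mul _ m3, lintegral_const_mul _ m4, ← h1,
    ← h2, ← lintegral_const_mul _ (by fun_prop), ← lintegral_const_mul _ (by fun_prop),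
    ← lintegral_add_left (by fun_prop)]
  exact lintegral_congr fun z => by ring

lemma lintegral_abel_abelSum {a p u T : ℝ} {C₁ C₂ : ℝ≥0∞} {f : ℝ → ℝ≥0∞} (ha : 0 < a) (ha' : a < 1)
    (hf : Measurable f) (hf0 : ∀ s ∉ Ioo 0 T, f s = 0) (hu : u ∈ Ioo 0 T) :
    ∫⁻ v in Iio T, pw (-a) (v - u) * pw (2 * a) v * abelSum a p C₁ C₂ f v
      = ∫⁻ x in Ioo u T, sweptSum a p T C₁ C₂ f x := by
  have h1 := lintegral_abel_operator ha ha' hu.1 hf hf0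
  have h2 := lintegral_kernel_transfer (μ := volume.restrict (Iio T))
    (ν := volume.restrict (Ioo u T)) (f := f)
    (A := fun v => pw (-a) (v - u) * pw (2 * a) v) (B := fun _ => 1)
    (k := abelKer₂ a p) (m := sweptKer a p T) (by fun_prop) (by fun_prop) hf
    (by fun_prop) (measurable_sweptKer a p T measurable_fst measurable_snd) (by
      filter_upwards with s
      simp_rw [one_mul]
      exact lintegral_abel_abelKer₂ ha ha' hu.1 hu.2 s)
  simp only [one_mul] at h2
  have m1 := measurable_lintegral_kernel (m := sweptKer a p T) hf
    (measurable_sweptKer a p T measurable_fst measurable_snd)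
  have m3 := measurable_lintegral_kernel (m := abelKer a) hf (by fun_prop)
  have m4 := measurable_lintegral_kernel (m := abelKer₂ a p) hf (by fun_prop)
  simp only [abelSum, sweptSum]
  rw [lintegral_add_left (by fun_prop), lintegral_const_mul _ (by fun_prop),
    lintegral_const_mul _ m1, ← h1,
    ← h2, ← lintegral_const_mul _ (by fun_prop), ← lintegral_const_mul _ (by fun_prop),
    ← lintegral_add_left (by fun_prop)]
  exact lintegral_congr fun z => by ring

lemma lintegral_abelSum_ne_top {a p T : ℝ} {C₁ C₂ : ℝ≥0∞} {f : ℝ → ℝ≥0∞} (ha : 0 < a) (hp : 0 < p)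
    (hap : 2 * a + p < 1) (hC₁ : C₁ ≠ ∞) (hC₂ : C₂ ≠ ∞) (hf : Measurable f)
    (hfin : ∫⁻ s, f s ≠ ∞) (hf0 : ∀ s ∉ Ioo 0 T, f s = 0) :
    ∫⁻ v in Iio T, abelSum a p C₁ C₂ f v ≠ ∞ := by
  have m3 := measurable_lintegral_kernel (m := abelKer a) hf (by fun_prop)
  have m4 := measurable_lintegral_kernel (m := abelKer₂ a p) hf (by fun_prop)
  simp only [abelSum]
  rw [lintegral_add_left (by fun_prop), lintegral_const_mul _ m3, lintegral_const_mul _ m4]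
  refine ENNReal.add_ne_top.2 ⟨ENNReal.mul_ne_top hC₁ ?_, ENNReal.mul_ne_top hC₂ ?_⟩
  · exact lintegral_kernel_ne_top ofReal_ne_top hf hfin hf0 (by fun_prop) fun s hs =>
      (setLIntegral_le_lintegral _ _).trans (lintegral_abelKer_le ha (by linarith) hs.1)
  · exact lintegral_kernel_ne_top (ENNReal.mul_ne_top ofReal_ne_top ofReal_ne_top) hf hfin hf0
      (by fun_prop) fun s hs => lintegral_abelKer₂_le ha hp hap hs

/-- The transformed equation, for the positive part `f` and the negative part `e` of a solution. -/
lemma ae_sweptSum_eq {a p T : ℝ} {C₁ C₂ : ℝ≥0∞} {f e : ℝ → ℝ≥0∞} (ha : 0 < a) (hp : 0 < p)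
    (hap : 2 * a + p < 1) (hT : 0 < T) (hC₁ : C₁ ≠ ∞) (hC₂ : C₂ ≠ ∞)
    (hf : Measurable f) (hffin : ∫⁻ s, f s ≠ ∞) (hf0 : ∀ s ∉ Ioo 0 T, f s = 0)
    (he : Measurable e) (he0 : ∀ s ∉ Ioo 0 T, e s = 0)
    (h : ∀ᵐ z ∂volume.restrict (Ioo 0 T), mixedPot a p C₁ C₂ f z = 1 + mixedPot a p C₁ C₂ e z) :
    ∀ᵐ x ∂volume.restrict (Ioo 0 T), sweptSum a p T C₁ C₂ f x
      = ENNReal.ofReal (abelConst a) * pw (-a) (T - x) + sweptSum a p T C₁ C₂ e x := by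
  have ha' : a < 1 / 2 := by linarith
  have h1 : ∀ u ≤ T, ∫⁻ v in Iio u, abelSum a p C₁ C₂ f v
      = ∫⁻ v in Iio u, (ENNReal.ofReal (abelConst a) * pw (-2 * a) v + abelSum a p C₁ C₂ e v) := by
    intro u hu
    rw [lintegral_add_left (by fun_prop), ← lintegral_abel_mixedPot ha hp hap hf,
      ← lintegral_abel_mixedPot ha hp hap he, ← lintegral_abel_one ha ha',
      ← lintegral_add_left (by fun_prop)]
    refine lintegral_congr_ae ?_
    filter_upwards [(ae_restrict_iff' measurableSet_Ioo).1 h] with z hz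
    by_cases hz' : z ∈ Ioo 0 T
    · rw [hz hz']; ring
    · rcases le_or_gt z 0 with h | h
      · simp [pw_of_nonpos h]
      · have : T ≤ z := by by_contra hc; exact hz' ⟨h, by linarith⟩
        simp [pw_of_nonpos (show u - z ≤ 0 by linarith)]
  have h2 := ae_eq_of_lintegral_Iio_eq (measurable_abelSum hf)
    (Measurable.add (by fun_prop) (measurable_abelSum he))
    (lintegral_abelSum_ne_top ha hp hap hC₁ hC₂ hf hffin hf0) h1
  refine ae_eq_of_lintegral_Ioo_eq (measurable_sweptSum hf)
    (Measurable.add (by fun_prop) (measurable_sweptSum he)) hT ?_ ?_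
  · exact lintegral_Ioo_ne_top_of_abel ha (by linarith) (measurable_abelSum hf)
      (lintegral_abelSum_ne_top ha hp hap hC₁ hC₂ hf hffin hf0)
      fun u hu => lintegral_abel_abelSum ha (by linarith) hf hf0 hu
  · intro u hu
    simp only [Pi.add_apply]
    rw [lintegral_add_left (by fun_prop), lintegral_const_mul _ (by fun_prop),
      ← lintegral_abel_abelSum ha (by linarith) hf hf0 hu,
      ← lintegral_abel_abelSum ha (by linarith) he he0 hu, ← lintegral_Iio_pw_sub (by linarith),
      ← lintegral_const_mul _ (by fun_prop), ← lintegral_add_left (by fun_prop)]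
    refine lintegral_congr_ae ?_
    filter_upwards [h2] with v hv
    rw [hv]
    simp only [Pi.add_apply]
    rcases le_or_gt v u with h | h
    · simp [pw_of_nonpos (show v - u ≤ 0 by linarith)]
    · calc pw (-a) (v - u) * pw (2 * a) v *
            (ENNReal.ofReal (abelConst a) * pw (-2 * a) v + abelSum a p C₁ C₂ e v)
          = ENNReal.ofReal (abelConst a) * pw (-a) (v - u) * (pw (2 * a) v * pw (-2 * a) v)
            + pw (-a) (v - u) * pw (2 * a) v * abelSum a p C₁ C₂ e v := by
            ring
        _ = _ := by
          rw [pw_mul, show 2 * a + -2 * a = 0 by ring, pw_zero (hu.1.trans h), mul_one]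

lemma ae_sweptSum_ne_top {a p T : ℝ} {C₁ C₂ : ℝ≥0∞} {f : ℝ → ℝ≥0∞} (ha : 0 < a) (hp : 0 < p)
    (hap : 2 * a + p < 1) (hT : 0 < T) (hC₁ : C₁ ≠ ∞) (hC₂ : C₂ ≠ ∞)
    (hf : Measurable f) (hffin : ∫⁻ s, f s ≠ ∞) (hf0 : ∀ s ∉ Ioo 0 T, f s = 0) :
    ∀ᵐ x ∂volume.restrict (Ioo 0 T), sweptSum a p T C₁ C₂ f x ≠ ∞ := by
  have h := lintegral_Ioo_ne_top_of_abel ha (by linarith) (measurable_abelSum hf)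
      (lintegral_abelSum_ne_top ha hp hap hC₁ hC₂ hf hffin hf0)
      fun u hu => lintegral_abel_abelSum ha (by linarith) hf hf0 hu
  refine ae_Ioo_of_forall hT fun r hr => ?_
  filter_upwards [ae_lt_top (measurable_sweptSum hf) (h r hr)] with x hx using hx.ne

/-- The mixed potential of an integrable function on `(0, T)` is finite almost everywhere there. -/
lemma ae_mixedPot_ne_top {a p T : ℝ} {C₁ C₂ : ℝ≥0∞} {f : ℝ → ℝ≥0∞} (ha : 0 < a) (hp : 0 < p)
    (hap : 2 * a + p < 1) (hC₁ : C₁ ≠ ∞) (hC₂ : C₂ ≠ ∞)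
    (hf : Measurable f) (hffin : ∫⁻ s, f s ≠ ∞) (hf0 : ∀ s ∉ Ioo 0 T, f s = 0) :
    ∀ᵐ z ∂volume.restrict (Ioo 0 T), mixedPot a p C₁ C₂ f z ≠ ∞ := by
  have h1 := lintegral_abelSum_ne_top ha hp hap hC₁ hC₂ hf hffin hf0
  rw [← lintegral_abel_mixedPot ha hp hap hf] at h1
  rw [ae_restrict_iff' measurableSet_Ioo]
  have m := measurable_mixedPot (a := a) (p := p) (C₁ := C₁) (C₂ := C₂) hf
  filter_upwards [ae_lt_top (by fun_prop) h1] with z hz hz' hc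
  rw [hc, ENNReal.mul_top] at hz
  · exact lt_irrefl _ hz
  · exact mul_ne_zero (pw_pos hz'.1).ne' (pw_pos (sub_pos.2 hz'.2)).ne'

/-! ### Smoothness of the primitives of `ψ`, `φ` and `τ` -/

section

/-- Euler's integral `∫_0^1 (1 - x) ^ b x ^ e (1 + m x) ^ q dx`, as a function of `m > -1`. -/
def eulerInt (b e q m : ℝ) : ℝ := ∫ x in (0 : ℝ)..1, (1 - x) ^ b * x ^ e * (1 + m * x) ^ q

lemma intervalIntegrable_beta {b e : ℝ} (hb : -1 < b) (he : -1 < e) :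
    IntervalIntegrable (fun x : ℝ => (1 - x) ^ b * x ^ e) volume 0 1 := by
  rw [intervalIntegrable_iff_integrableOn_Ioo_of_le zero_le_one]
  refine (lintegral_ofReal_ne_top_iff_integrable
    (by fun_prop : Measurable fun x : ℝ => (1 - x) ^ b * x ^ e).aestronglyMeasurable ?_).1 ?_
  · filter_upwards [ae_restrict_mem measurableSet_Ioo] with x hx
    have h1 := hx.1
    have h2 : 0 < 1 - x := by linarith [hx.2]
    simp only [Pi.zero_apply]
    positivity
  · rw [setLIntegral_congr_fun (g := fun x => pw e x * pw b (1 - x)) measurableSet_Ioo,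
      lintegral_beta_unit he hb]
    · exact ofReal_ne_top
    · intro x hx
      have h1 := hx.1
      have h2 : 0 < 1 - x := by linarith [hx.2]
      simp only
      rw [pw_of_pos h1, pw_of_pos h2, ← ENNReal.ofReal_mul (by positivity), mul_comm]

lemma rpow_le_add_rpow {δ N y : ℝ} (r : ℝ) (hδ : 0 < δ) (h1 : δ ≤ y) (h2 : y ≤ N) :
    y ^ r ≤ δ ^ r + N ^ r := by
  have hy : 0 < y := hδ.trans_le h1
  rcases le_or_gt 0 r with h | h
  · have := Real.rpow_le_rpow hy.le h2 h
    have := Real.rpow_pos_of_pos hδ r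
    linarith
  · have := Real.rpow_le_rpow_of_nonpos hδ h1 h.le
    have := Real.rpow_pos_of_pos (hy.trans_le h2) r
    linarith

lemma hasDerivAt_eulerInt {b e : ℝ} (q : ℝ) (hb : -1 < b) (he : -1 < e) {m : ℝ} (hm : -1 < m) :
    HasDerivAt (eulerInt b e q) (q * eulerInt b (e + 1) (q - 1) m) m := by
  set ε := (1 + m) / 2 with hε
  have hε0 : 0 < ε := by rw [hε]; linarith
  set δ := min 1 ε
  set N := 1 + |m| + ε
  have hδ : 0 < δ := lt_min one_pos hε0
  have hlow : ∀ y ∈ Ioo (m - ε) (m + ε), ∀ x ∈ Ioc (0 : ℝ) 1, δ ≤ 1 + y * x ∧ 1 + y * x ≤ N := by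
    rintro y ⟨h1, h2⟩ x ⟨h3, h4⟩
    have hm' := le_abs_self m
    have hm'' := abs_nonneg m
    constructor
    · rcases le_or_gt 0 y with h | h
      · exact (min_le_left _ _).trans (by nlinarith)
      · exact (min_le_right _ _).trans (by nlinarith)
    · have : y * x ≤ |m| + ε := by
        rcases le_or_gt 0 y with h | h <;> nlinarith
      simp only [N]; linarith
  have hmem : m ∈ Ioo (m - ε) (m + ε) := ⟨by linarith, by linarith⟩
  have hbd : ∀ r : ℝ, IntervalIntegrable
      (fun x => (1 - x) ^ b * x ^ e * (δ ^ r + N ^ r)) volume 0 1 := fun r =>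
    (intervalIntegrable_beta hb he).mul_const _
  have hint : IntervalIntegrable (fun x => (1 - x) ^ b * x ^ e * (1 + m * x) ^ q) volume 0 1 := by
    refine (hbd q).mono_fun (by fun_prop : Measurable _).aestronglyMeasurable ?_
    rw [uIoc_of_le zero_le_one]
    filter_upwards [ae_restrict_mem measurableSet_Ioc] with x hx
    have h := hlow m hmem x hx
    have h2 : 0 ≤ (1 - x) ^ b * x ^ e :=
      mul_nonneg (Real.rpow_nonneg (by linarith [hx.2]) _) (Real.rpow_nonneg hx.1.le _)
    have h3 := rpow_le_add_rpow q hδ h.1 h.2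
    have h4 : 0 ≤ (1 + m * x) ^ q := Real.rpow_nonneg (hδ.le.trans h.1) _
    rw [Real.norm_of_nonneg (mul_nonneg h2 h4), Real.norm_of_nonneg (mul_nonneg h2 (h4.trans h3))]
    exact mul_le_mul_of_nonneg_left h3 h2
  have key := intervalIntegral.hasDerivAt_integral_of_dominated_loc_of_deriv_le (μ := volume)
    (F := fun y x => (1 - x) ^ b * x ^ e * (1 + y * x) ^ q) (x₀ := m) (a := 0) (b := 1)
    (F' := fun y x => (1 - x) ^ b * x ^ e * (x * q * (1 + y * x) ^ (q - 1)))
    (bound := fun x => |q| * ((1 - x) ^ b * x ^ e * (δ ^ (q - 1) + N ^ (q - 1))))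
    (s := Ioo (m - ε) (m + ε)) (Ioo_mem_nhds hmem.1 hmem.2)
    (Filter.Eventually.of_forall fun y => (by fun_prop : Measurable _).aestronglyMeasurable)
    hint (by fun_prop : Measurable _).aestronglyMeasurable ?_ ((hbd _).const_mul _) ?_
  · refine key.2.congr_deriv ?_
    rw [eulerInt, ← intervalIntegral.integral_const_mul,
      intervalIntegral.integral_of_le zero_le_one, intervalIntegral.integral_of_le zero_le_one]
    refine setIntegral_congr_fun measurableSet_Ioc fun x hx => ?_
    rw [Real.rpow_add hx.1, Real.rpow_one]
    ring
  · refine Filter.Eventually.of_forall fun x hx y hy => ?_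
    rw [uIoc_of_le zero_le_one] at hx
    have h := hlow y hy x hx
    have h2 : 0 ≤ (1 - x) ^ b * x ^ e :=
      mul_nonneg (Real.rpow_nonneg (by linarith [hx.2]) _) (Real.rpow_nonneg hx.1.le _)
    have h3 := rpow_le_add_rpow (q - 1) hδ h.1 h.2
    have h4 : 0 ≤ (1 + y * x) ^ (q - 1) := Real.rpow_nonneg (hδ.le.trans h.1) _
    rw [Real.norm_eq_abs, abs_mul ((1 - x) ^ b * x ^ e), abs_mul (x * q), abs_mul x q,
      abs_of_nonneg h2, abs_of_nonneg h4, abs_of_pos hx.1]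
    have h5 : x * |q| * (1 + y * x) ^ (q - 1) ≤ |q| * (δ ^ (q - 1) + N ^ (q - 1)) :=
      mul_le_mul (by nlinarith [hx.2, abs_nonneg q]) h3 h4 (abs_nonneg q)
    calc _ ≤ (1 - x) ^ b * x ^ e * (|q| * (δ ^ (q - 1) + N ^ (q - 1))) :=
          mul_le_mul_of_nonneg_left h5 h2
      _ = _ := by ring
  · refine Filter.Eventually.of_forall fun x hx y hy => ?_
    rw [uIoc_of_le zero_le_one] at hx
    have h := hlow y hy x hx
    have h1 : HasDerivAt (fun y : ℝ => 1 + y * x) x y := by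
      simpa using ((hasDerivAt_id y).mul_const x).const_add 1
    exact (h1.rpow_const (Or.inl (hδ.trans_le h.1).ne')).const_mul _

lemma contDiffOn_eulerInt {b : ℝ} (hb : -1 < b) (n : ℕ) :
    ∀ e q : ℝ, -1 < e → ContDiffOn ℝ n (eulerInt b e q) (Ioi (-1)) := by
  induction n with
  | zero =>
    intro e q he
    refine contDiffOn_zero.2 fun m hm => ?_
    exact (hasDerivAt_eulerInt q hb he hm).continuousAt.continuousWithinAt
  | succ n ih =>
    intro e q he
    push_cast
    rw [contDiffOn_succ_iff_deriv_of_isOpen isOpen_Ioi]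
    refine ⟨fun m hm => (hasDerivAt_eulerInt q hb he hm).differentiableAt.differentiableWithinAt,
      by simp, ?_⟩
    refine ((contDiffOn_const (c := q)).mul (ih (e + 1) (q - 1) (by linarith))).congr fun m hm => ?_
    exact (hasDerivAt_eulerInt q hb he hm).deriv

variable {H₁ H₂ a p : ℝ}

lemma integral_scale (F : ℝ → ℝ) (x y : ℝ) :
    ∫ t in x..y, F t = (y - x) * ∫ r in (0 : ℝ)..1, F (x + (y - x) * r) := by
  have := intervalIntegral.smul_integral_comp_add_mul (a := 0) (b := 1) F (y - x) x
  simp only [mul_zero, add_zero, mul_one, add_sub_cancel] at this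
  rw [← this, smul_eq_mul]

lemma psiPrim_eq (h₁ : 1 / 2 - H₁ = -a) (h₂ : 2 * H₂ - 2 = -p) {u s : ℝ} (hu : 0 < u) (hs : u < s) :
    psiPrim H₁ H₂ s u
      = u * (u ^ (-a) * u ^ (-a) * s ^ (-p)) * eulerInt (-a) (-a) (-p) (-u / s) := by
  have hs0 : 0 < s := hu.trans hs
  simp only [psiPrim, integrandLt, h₁, h₂]
  rw [integral_scale, eulerInt, sub_zero, mul_assoc]
  refine congrArg _ ?_
  rw [← intervalIntegral.integral_const_mul]
  refine intervalIntegral.integral_congr fun r hr => ?_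
  rw [uIcc_of_le zero_le_one] at hr
  have h1 : 0 ≤ 1 + -u / s * r := by
    have : u / s * r ≤ 1 := mul_le_one₀ ((div_le_one hs0).2 hs.le) hr.1 hr.2
    rw [neg_div]; linarith
  simp only [zero_add]
  rw [show u - u * r = u * (1 - r) by ring, show s - u * r = s * (1 + -u / s * r) by
    field_simp; ring, Real.mul_rpow hu.le (by linarith [hr.2]), Real.mul_rpow hu.le hr.1,
    Real.mul_rpow hs0.le h1]
  ring

lemma phiPrim_eq (h₁ : 1 / 2 - H₁ = -a) (h₂ : 2 * H₂ - 2 = -p) {u s : ℝ} (hs : 0 < s) (hu : s < u) :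
    phiPrim H₁ H₂ s u = (u - s) * ((u - s) ^ (-a) * (u - s) ^ (-p) * s ^ (-a))
      * eulerInt (-a) (-p) (-a) ((u - s) / s) := by
  have hus : 0 < u - s := by linarith
  simp only [phiPrim, integrandGt, h₁, h₂]
  rw [integral_scale, eulerInt, mul_assoc]
  refine congrArg _ ?_
  rw [← intervalIntegral.integral_const_mul]
  refine intervalIntegral.integral_congr fun r hr => ?_
  rw [uIcc_of_le zero_le_one] at hr
  have h1 : 0 ≤ 1 + (u - s) / s * r := by
    have : 0 ≤ (u - s) / s * r := mul_nonneg (by positivity) hr.1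
    linarith
  rw [show u - (s + (u - s) * r) = (u - s) * (1 - r) by ring,
    show s + (u - s) * r - s = (u - s) * r by ring,
    show s + (u - s) * r = s * (1 + (u - s) / s * r) by field_simp,
    Real.mul_rpow hus.le (by linarith [hr.2]), Real.mul_rpow hus.le hr.1,
    Real.mul_rpow hs.le h1]
  ring

lemma tauPrim_eq (h₁ : 1 / 2 - H₁ = -a) (h₂ : 2 * H₂ - 2 = -p) {u s : ℝ} (hs : 0 < s) (hu : s < u) :
    tauPrim H₁ H₂ s u = s * (u ^ (-a) * s ^ (-a) * s ^ (-p))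
      * eulerInt (-p) (-a) (-a) (-s / u) := by
  have hu0 : 0 < u := hs.trans hu
  simp only [tauPrim, integrandLt, h₁, h₂]
  rw [integral_scale, eulerInt, sub_zero, mul_assoc]
  refine congrArg _ ?_
  rw [← intervalIntegral.integral_const_mul]
  refine intervalIntegral.integral_congr fun r hr => ?_
  rw [uIcc_of_le zero_le_one] at hr
  have h1 : 0 ≤ 1 + -s / u * r := by
    have : s / u * r ≤ 1 := mul_le_one₀ ((div_le_one hu0).2 hu.le) hr.1 hr.2
    rw [neg_div]; linarith
  simp only [zero_add]
  rw [show s - s * r = s * (1 - r) by ring, show u - s * r = u * (1 + -s / u * r) by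
    field_simp; ring, Real.mul_rpow hu0.le h1, Real.mul_rpow hs.le hr.1,
    Real.mul_rpow hs.le (by linarith [hr.2])]
  ring

lemma contDiffOn_psiPrim (h₁ : 1 / 2 - H₁ = -a) (h₂ : 2 * H₂ - 2 = -p) (ha : a < 1) {s : ℝ} :
    ContDiffOn ℝ 2 (psiPrim H₁ H₂ s) (Ioo 0 s) := by
  have hE := contDiffOn_eulerInt (b := -a) (by linarith) 2 (-a) (-p) (by linarith)
  have hc : ContDiffOn ℝ 2 (fun u : ℝ => eulerInt (-a) (-a) (-p) (-u / s)) (Ioo 0 s) := by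
    refine hE.comp (by fun_prop) fun u hu => ?_
    have : u / s < 1 := (div_lt_one (hu.1.trans hu.2)).2 hu.2
    change -1 < -u / s
    rw [neg_div]; linarith
  have hr : ContDiffOn ℝ 2 (fun u : ℝ => u ^ (-a)) (Ioo 0 s) :=
    contDiffOn_id.rpow_const_of_ne fun u hu => hu.1.ne'
  refine ((contDiffOn_id.mul ((hr.mul hr).mul
    (contDiffOn_const (c := s ^ (-p))))).mul hc).congr fun u hu => ?_
  exact psiPrim_eq h₁ h₂ hu.1 hu.2

lemma contDiffOn_phiPrim (h₁ : 1 / 2 - H₁ = -a) (h₂ : 2 * H₂ - 2 = -p) (ha : a < 1) (hp : p < 1)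
    {s : ℝ} (hs : 0 < s) : ContDiffOn ℝ 2 (phiPrim H₁ H₂ s) (Ioi s) := by
  have hE := contDiffOn_eulerInt (b := -a) (by linarith) 2 (-p) (-a) (by linarith)
  have hc : ContDiffOn ℝ 2 (fun u : ℝ => eulerInt (-a) (-p) (-a) ((u - s) / s)) (Ioi s) := by
    refine hE.comp (by fun_prop) fun u hu => ?_
    have : 0 < (u - s) / s := div_pos (sub_pos.2 hu) hs
    change -1 < (u - s) / s
    linarith
  have hr : ∀ e : ℝ, ContDiffOn ℝ 2 (fun u : ℝ => (u - s) ^ e) (Ioi s) := fun e =>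
    (contDiffOn_id.sub (contDiffOn_const (c := s))).rpow_const_of_ne fun u hu => (sub_pos.2 hu).ne'
  refine (((contDiffOn_id.sub (contDiffOn_const (c := s))).mul (((hr (-a)).mul (hr (-p))).mul
    (contDiffOn_const (c := s ^ (-a))))).mul hc).congr fun u hu => ?_
  exact phiPrim_eq h₁ h₂ hs hu

lemma contDiffOn_tauPrim (h₁ : 1 / 2 - H₁ = -a) (h₂ : 2 * H₂ - 2 = -p) (ha : a < 1) (hp : p < 1)
    {s : ℝ} (hs : 0 < s) : ContDiffOn ℝ 2 (tauPrim H₁ H₂ s) (Ioi s) := by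
  have hE := contDiffOn_eulerInt (b := -p) (by linarith) 2 (-a) (-a) (by linarith)
  have hc : ContDiffOn ℝ 2 (fun u : ℝ => eulerInt (-p) (-a) (-a) (-s / u)) (Ioi s) := by
    refine hE.comp (contDiffOn_const.div contDiffOn_id fun u hu => (hs.trans hu).ne') fun u hu => ?_
    have : s / u < 1 := (div_lt_one (hs.trans hu)).2 hu
    change -1 < -s / u
    rw [neg_div]; linarith
  have hr : ContDiffOn ℝ 2 (fun u : ℝ => u ^ (-a)) (Ioi s) :=
    contDiffOn_id.rpow_const_of_ne fun u hu => (hs.trans hu).ne'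
  refine (((contDiffOn_const (c := s)).mul ((hr.mul (contDiffOn_const (c := s ^ (-a)))).mul
    (contDiffOn_const (c := s ^ (-p))))).mul hc).congr fun u hu => ?_
  exact tauPrim_eq h₁ h₂ hs hu

end

/-! ### Derivatives of Abel integrals -/

lemma intervalIntegrable_rpow_neg {a : ℝ} (ha : a < 1) (x y : ℝ) :
    IntervalIntegrable (fun t : ℝ => t ^ (-a)) volume x y :=
  intervalIntegral.intervalIntegrable_rpow' (by linarith)

/-- Integration by parts behind the passage from the derivative of an Abel integral to its Marchaud
form, on the unit interval; the function differentiated is `y ^ (-a) (1 - y) (γ y - γ 0)`. -/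
lemma marchaud_unit {a : ℝ} (ha' : a < 1) {γ γ' : ℝ → ℝ}
    (hγ : ∀ y ∈ Icc (0 : ℝ) 1, HasDerivAt γ (γ' y) y) (hγ' : ContinuousOn γ' (Icc 0 1)) :
    IntervalIntegrable (fun y => (γ 0 - γ y) / y ^ (1 + a)) volume 0 1 ∧
    (∫ y in (0 : ℝ)..1, y ^ (-a) * ((1 - y) * γ' y)) - (1 - a) * (∫ y in (0 : ℝ)..1, y ^ (-a) * γ y)
      = -γ 0 - a * ∫ y in (0 : ℝ)..1, (γ 0 - γ y) / y ^ (1 + a) := by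
  obtain ⟨M, hM⟩ := isCompact_Icc.exists_bound_of_continuousOn hγ'
  have hγc : ContinuousOn γ (Icc 0 1) := fun y hy => (hγ y hy).continuousAt.continuousWithinAt
  have hlip : ∀ y ∈ Icc (0 : ℝ) 1, ‖γ y - γ 0‖ ≤ M * y := by
    intro y hy
    have := (convex_Icc (0 : ℝ) 1).norm_image_sub_le_of_norm_hasDerivWithin_le
      (fun x hx => (hγ x hx).hasDerivWithinAt) hM ⟨le_rfl, zero_le_one⟩ hy
    simpa [Real.norm_of_nonneg hy.1] using this
  have i0 := intervalIntegrable_rpow_neg ha' 0 1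
  have i1 : IntervalIntegrable (fun y => (γ 0 - γ y) / y ^ (1 + a)) volume 0 1 := by
    refine (i0.const_mul M).mono_fun ?_ ?_
    · rw [uIoc_of_le zero_le_one]
      refine ContinuousOn.aestronglyMeasurable ?_ measurableSet_Ioc
      refine ContinuousOn.div (continuousOn_const.sub (hγc.mono Ioc_subset_Icc_self)) ?_ ?_
      · exact continuousOn_id.rpow_const fun y hy => Or.inl hy.1.ne'
      · exact fun y hy => (Real.rpow_pos_of_pos hy.1 _).ne'
    · rw [uIoc_of_le zero_le_one]
      filter_upwards [ae_restrict_mem measurableSet_Ioc] with y hy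
      have h1 := Real.rpow_pos_of_pos hy.1 (1 + a)
      have h2 := Real.rpow_pos_of_pos hy.1 (-a)
      have h3 := hlip y ⟨hy.1.le, hy.2⟩
      rw [norm_div, Real.norm_of_nonneg h1.le, div_le_iff₀ h1, norm_sub_rev, norm_mul,
        Real.norm_of_nonneg h2.le, mul_assoc, ← Real.rpow_add hy.1, show -a + (1 + a) = 1 by ring,
        Real.rpow_one]
      exact h3.trans (mul_le_mul_of_nonneg_right (le_abs_self M) hy.1.le)
  refine ⟨i1, ?_⟩
  have i2 : IntervalIntegrable (fun y => y ^ (-a) * ((1 - y) * γ' y)) volume 0 1 := by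
    refine i0.mul_continuousOn ?_
    rw [uIcc_of_le zero_le_one]
    exact ContinuousOn.mul (by fun_prop) hγ'
  have i3 : IntervalIntegrable (fun y => y ^ (-a) * γ y) volume 0 1 := by
    refine i0.mul_continuousOn ?_
    rwa [uIcc_of_le zero_le_one]
  have hE : ContinuousOn (fun y : ℝ => y ^ (-a) * (1 - y) * (γ y - γ 0)) (Icc 0 1) := by
    intro y hy
    rcases hy.1.eq_or_lt with h | h
    · -- at `0` the increment of `γ` beats the singularity
      subst h
      rw [Metric.continuousWithinAt_iff']
      intro ε hε
      have hlim : Filter.Tendsto (fun y : ℝ => M * y ^ (1 - a)) (nhdsWithin 0 (Icc 0 1))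
          (nhds (M * 0 ^ (1 - a))) := by
        refine Filter.Tendsto.mono_left ?_ nhdsWithin_le_nhds
        exact ((Real.continuousAt_rpow_const 0 (1 - a) (Or.inr (by linarith))).const_mul M)
      rw [Real.zero_rpow (by linarith), mul_zero] at hlim
      filter_upwards [hlim.eventually (gt_mem_nhds hε), self_mem_nhdsWithin] with y hy1 hy2
      rw [dist_eq_norm]
      simp only [sub_self, mul_zero, sub_zero]
      rcases hy2.1.eq_or_lt with h | h
      · subst h; simpa using hε
      · refine lt_of_le_of_lt ?_ hy1
        have h3 := hlip y hy2
        have h2 := Real.rpow_pos_of_pos h (-a)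
        rw [norm_mul, norm_mul, Real.norm_of_nonneg h2.le,
          Real.norm_of_nonneg (by linarith [hy2.2]), show 1 - a = 1 + -a by ring,
          Real.rpow_add h, Real.rpow_one]
        calc y ^ (-a) * (1 - y) * ‖γ y - γ 0‖ ≤ y ^ (-a) * 1 * (M * y) := by
              refine mul_le_mul (mul_le_mul_of_nonneg_left (by linarith) h2.le) h3 (norm_nonneg _)
                (by positivity)
          _ = _ := by ring
    · refine ContinuousAt.continuousWithinAt ?_
      exact ((Real.continuousAt_rpow_const y (-a) (Or.inl h.ne')).mul (by fun_prop)).mul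
        ((hγ y hy).continuousAt.sub continuousAt_const)
  have hF := intervalIntegral.integral_eq_sub_of_hasDerivAt_of_le zero_le_one hE
    (f' := fun y => y ^ (-a) * ((1 - y) * γ' y) - (1 - a) * (y ^ (-a) * γ y)
      + (1 - a) * γ 0 * y ^ (-a) + a * ((γ 0 - γ y) / y ^ (1 + a))) ?_ ?_
  · rw [intervalIntegral.integral_add ((i2.sub (i3.const_mul _)).add (i0.const_mul _))
      (i1.const_mul _), intervalIntegral.integral_add (i2.sub (i3.const_mul _)) (i0.const_mul _),
      intervalIntegral.integral_sub i2 (i3.const_mul _), intervalIntegral.integral_const_mul,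
      intervalIntegral.integral_const_mul, intervalIntegral.integral_const_mul,
      integral_rpow (Or.inl (by linarith))] at hF
    have e : (1 - a) * γ 0 * ((1 ^ (-a + 1) - 0 ^ (-a + 1)) / (-a + 1)) = γ 0 := by
      rw [Real.one_rpow, Real.zero_rpow (by linarith)]
      have : -a + 1 ≠ 0 := by linarith
      field_simp; ring
    rw [e] at hF
    simp only [sub_self, mul_zero, zero_mul] at hF
    linarith
  · intro y hy
    have hy0 := hy.1
    have h1 := Real.hasDerivAt_rpow_const (x := y) (p := -a) (Or.inl hy0.ne')
    have h2 : HasDerivAt (fun y : ℝ => 1 - y) (-1) y := by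
      simpa using (hasDerivAt_id y).const_sub 1
    have h3 := (hγ y ⟨hy.1.le, hy.2.le⟩).sub_const (γ 0)
    refine ((h1.mul h2).mul h3).congr_deriv ?_
    have e1 : y ^ (-a) = y * y ^ (-a - 1) := by
      rw [mul_comm, ← Real.rpow_add_one hy0.ne']; ring_nf
    have e2 : (y ^ (1 + a))⁻¹ = y ^ (-a - 1) := by
      rw [← Real.rpow_neg hy0.le]; ring_nf
    rw [Pi.mul_apply, div_eq_mul_inv, e2, e1]
    ring
  · exact ((i2.sub (i3.const_mul _)).add (i0.const_mul _)).add (i1.const_mul _)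

/-- The derivative of an Abel integral of a `C¹` function, in Marchaud form. -/
lemma hasDerivAt_abel {a : ℝ} (ha : 0 < a) (ha' : a < 1) {G : ℝ → ℝ} {l r u b : ℝ}
    (hG : ContDiffOn ℝ 1 G (Ioo l r)) (hlu : l < u) (hub : u < b) (hbr : b < r) :
    IntervalIntegrable (fun t => (G u - G t) / (t - u) ^ (1 + a)) volume u b ∧
    HasDerivAt (fun x => ∫ t in x..b, (t - x) ^ (-a) * G t)
      (-((b - u) ^ (-a) * G u + a * ∫ t in u..b, (G u - G t) / (t - u) ^ (1 + a))) u := by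
  have hGd : ∀ t ∈ Ioo l r, HasDerivAt G (deriv G t) t := fun t ht =>
    ((hG.differentiableOn one_ne_zero).differentiableAt (isOpen_Ioo.mem_nhds ht)).hasDerivAt
  have hGc : ContinuousOn (deriv G) (Ioo l r) := hG.continuousOn_deriv_of_isOpen isOpen_Ioo le_rfl
  have hbu : 0 < b - u := by linarith
  have hmem : ∀ x ∈ Ioo l b, ∀ y ∈ Icc (0 : ℝ) 1, x + (b - x) * y ∈ Icc x b := by
    intro x hx y hy
    have : 0 < b - x := by linarith [hx.2]
    constructor <;> nlinarith [hy.1, hy.2]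
  have hIcc : ∀ x ∈ Ioo l b, Icc x b ⊆ Ioo l r := fun x hx t ht =>
    ⟨hx.1.trans_le ht.1, ht.2.trans_lt hbr⟩
  have hu : u ∈ Ioo l b := ⟨hlu, hub⟩
  have haff : ∀ x y : ℝ, HasDerivAt (fun y => x + (b - x) * y) (b - x) y := fun x y => by
    simpa using ((hasDerivAt_id y).const_mul (b - x)).const_add x
  have haff' : ∀ x y : ℝ, HasDerivAt (fun x => x + (b - x) * y) (1 - y) x := fun x y => by
    have := (hasDerivAt_id x).add (((hasDerivAt_id x).const_sub b).mul_const y)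
    refine this.congr_deriv ?_
    ring
  have hcomp : ∀ x ∈ Ioo l b, ContinuousOn (fun y => G (x + (b - x) * y)) (Icc 0 1) := by
    intro x hx
    exact hG.continuousOn.comp (by fun_prop) fun y hy => hIcc x hx (hmem x hx y hy)
  have hcomp' : ContinuousOn (fun y => deriv G (u + (b - u) * y)) (Icc 0 1) :=
    hGc.comp (by fun_prop) fun y hy => hIcc u hu (hmem u hu y hy)
  obtain ⟨m1, m2⟩ := marchaud_unit ha' (γ := fun y => G (u + (b - u) * y))
    (γ' := fun y => (b - u) * deriv G (u + (b - u) * y))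
    (fun y hy => ((hGd _ (hIcc u hu (hmem u hu y hy))).comp y
      (haff u y)).congr_deriv (mul_comm _ _))
    (continuousOn_const.mul hcomp')
  simp only [mul_zero, add_zero] at m1 m2
  have hscale : ∀ y ∈ Ioc (0 : ℝ) 1, ((b - u) * y) ^ (1 + a) = (b - u) ^ (1 + a) * y ^ (1 + a) :=
    fun y hy => Real.mul_rpow hbu.le hy.1.le
  constructor
  · have h1 : IntervalIntegrable (fun y => (G u - G (u + (b - u) * y)) / ((b - u) * y) ^ (1 + a))
        volume 0 1 := by
      refine (m1.const_mul ((b - u) ^ (1 + a))⁻¹).congr fun y hy => ?_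
      rw [uIoc_of_le zero_le_one] at hy
      rw [hscale y hy, mul_comm ((b - u) ^ (1 + a)), div_mul_eq_div_div, inv_mul_eq_div]
    have h2 := h1.comp_mul_left (c := (b - u)⁻¹)
    have h3 := h2.comp_sub_right u
    simp only [div_inv_eq_mul, one_mul, zero_mul, zero_add, sub_add_cancel] at h3
    refine h3.congr fun t _ => ?_
    rw [mul_inv_cancel_left₀ hbu.ne', add_sub_cancel]
  -- rescaling to a fixed interval allows differentiation under the integral sign
  have hR : ∀ x ∈ Ioo l b, ∫ t in x..b, (t - x) ^ (-a) * G t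
      = (b - x) ^ (1 - a) * ∫ y in (0 : ℝ)..1, y ^ (-a) * G (x + (b - x) * y) := by
    intro x hx
    have hbx : 0 < b - x := by linarith [hx.2]
    rw [integral_scale, show 1 - a = 1 + -a by ring, Real.rpow_add hbx, Real.rpow_one, mul_assoc]
    refine congrArg _ ?_
    rw [← intervalIntegral.integral_const_mul]
    refine intervalIntegral.integral_congr fun y hy => ?_
    rw [uIcc_of_le zero_le_one] at hy
    rw [add_sub_cancel_left, Real.mul_rpow hbx.le hy.1, mul_assoc]
  set c := (l + u) / 2 with hc
  have hcu : u ∈ Ioo c b := ⟨by rw [hc]; linarith, hub⟩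
  have hcl : Ioo c b ⊆ Ioo l b := Ioo_subset_Ioo_left (by rw [hc]; linarith)
  obtain ⟨M, hM⟩ := isCompact_Icc.exists_bound_of_continuousOn (s := Icc c b) (hGc.mono
    (hIcc c ⟨by rw [hc]; linarith, by rw [hc]; linarith⟩))
  have i0 := intervalIntegrable_rpow_neg ha' 0 1
  have hS := intervalIntegral.hasDerivAt_integral_of_dominated_loc_of_deriv_le (μ := volume)
    (F := fun x y => y ^ (-a) * G (x + (b - x) * y)) (x₀ := u) (a := 0) (b := 1)
    (F' := fun x y => y ^ (-a) * ((1 - y) * deriv G (x + (b - x) * y)))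
    (bound := fun y => y ^ (-a) * M) (s := Ioo c b) (Ioo_mem_nhds hcu.1 hcu.2)
    ?_ ?_ ?_ ?_ (i0.mul_const M) ?_
  · have hpow : HasDerivAt (fun x : ℝ => (b - x) ^ (1 - a)) (-(1 - a) * (b - u) ^ (-a)) u := by
      have h1 : HasDerivAt (fun x : ℝ => b - x) (-1) u := by
        simpa using (hasDerivAt_id u).const_sub b
      refine (h1.rpow_const (p := 1 - a) (Or.inl hbu.ne')).congr_deriv ?_
      rw [show 1 - a - 1 = -a by ring]; ring
    refine ((hpow.mul hS.2).congr_of_eventuallyEq ?_).congr_deriv ?_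
    · filter_upwards [Ioo_mem_nhds hlu hub] with x hx
      exact hR x hx
    · have e1 : ∫ t in u..b, (G u - G t) / (t - u) ^ (1 + a) = (b - u) ^ (-a) *
          ∫ y in (0 : ℝ)..1, (G u - G (u + (b - u) * y)) / y ^ (1 + a) := by
        rw [integral_scale, ← intervalIntegral.integral_const_mul,
          ← intervalIntegral.integral_const_mul, intervalIntegral.integral_of_le zero_le_one,
          intervalIntegral.integral_of_le zero_le_one]
        refine setIntegral_congr_fun measurableSet_Ioc fun y hy => ?_
        rw [add_sub_cancel_left, hscale y hy, Real.rpow_neg hbu.le, Real.rpow_add hbu,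
          Real.rpow_one]
        have := (Real.rpow_pos_of_pos hbu a).ne'
        have := (Real.rpow_pos_of_pos hy.1 (1 + a)).ne'
        field_simp
      have e2 : ∫ y in (0 : ℝ)..1, y ^ (-a) * ((1 - y) * ((b - u) * deriv G (u + (b - u) * y)))
          = (b - u) * ∫ y in (0 : ℝ)..1, y ^ (-a) * ((1 - y) * deriv G (u + (b - u) * y)) := by
        rw [← intervalIntegral.integral_const_mul]
        exact intervalIntegral.integral_congr fun y _ => by ring
      rw [e2] at m2
      rw [e1, show 1 - a = 1 + -a by ring, Real.rpow_add hbu, Real.rpow_one]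
      linear_combination (b - u) ^ (-a) * m2
  · filter_upwards [Ioo_mem_nhds hlu hub] with x hx
    refine (i0.mul_continuousOn ?_).aestronglyMeasurable_restrict_uIoc
    rw [uIcc_of_le zero_le_one]
    exact hcomp x hx
  · refine i0.mul_continuousOn ?_
    rw [uIcc_of_le zero_le_one]
    exact hcomp u hu
  · refine (i0.mul_continuousOn ?_).aestronglyMeasurable_restrict_uIoc
    rw [uIcc_of_le zero_le_one]
    exact ContinuousOn.mul (by fun_prop) hcomp'
  · refine Filter.Eventually.of_forall fun y hy x hx => ?_
    rw [uIoc_of_le zero_le_one] at hy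
    have h1 := hmem x (hcl hx) y ⟨hy.1.le, hy.2⟩
    have h2 := hM _ ⟨hx.1.le.trans h1.1, h1.2⟩
    have h3 := Real.rpow_pos_of_pos hy.1 (-a)
    rw [norm_mul, norm_mul, Real.norm_of_nonneg h3.le, Real.norm_of_nonneg (by linarith [hy.2])]
    refine mul_le_mul_of_nonneg_left ?_ h3.le
    nlinarith [norm_nonneg (deriv G (x + (b - x) * y)), hy.1]
  · refine Filter.Eventually.of_forall fun y hy x hx => ?_
    rw [uIoc_of_le zero_le_one] at hy
    have h1 := hmem x (hcl hx) y ⟨hy.1.le, hy.2⟩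
    exact (((hGd _ (hIcc x (hcl hx) h1)).comp x
      (haff' x y)).congr_deriv (mul_comm _ _)).const_mul _

/-- The derivative of the part of an Abel integral away from the singularity. -/
lemma hasDerivAt_abel_tail {a : ℝ} {G : ℝ → ℝ} {u b T : ℝ} (hub : u < b) (hbT : b ≤ T)
    (hG : IntervalIntegrable G volume b T) :
    IntervalIntegrable (fun t => (t - u) ^ (-1 - a) * G t) volume b T ∧
    HasDerivAt (fun x => ∫ t in b..T, (t - x) ^ (-a) * G t)
      (a * ∫ t in b..T, (t - u) ^ (-1 - a) * G t) u := by
  set c := (u + b) / 2 with hc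
  have hcb : c < b := by rw [hc]; linarith
  have huc : u < c := by rw [hc]; linarith
  have hcont : ∀ x < b, ∀ q : ℝ, ContinuousOn (fun t : ℝ => (t - x) ^ q) (uIcc b T) := by
    intro x hx q
    rw [uIcc_of_le hbT]
    exact (continuousOn_id.sub continuousOn_const).rpow_const fun t ht =>
      Or.inl (show t - x ≠ 0 by linarith [ht.1])
  have hint : ∀ x < b, ∀ q : ℝ, IntervalIntegrable (fun t => (t - x) ^ q * G t) volume b T :=
    fun x hx q => hG.continuousOn_mul (hcont x hx q)
  refine ⟨hint u hub _, ?_⟩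
  set N := T - (u - 1)
  have hS := intervalIntegral.hasDerivAt_integral_of_dominated_loc_of_deriv_le (μ := volume)
    (F := fun x t => (t - x) ^ (-a) * G t) (x₀ := u) (a := b) (b := T)
    (F' := fun x t => a * (t - x) ^ (-1 - a) * G t)
    (bound := fun t => |a| * ((b - c) ^ (-1 - a) + N ^ (-1 - a)) * ‖G t‖) (s := Ioo (u - 1) c)
    (Ioo_mem_nhds (by linarith) huc) ?_ (hint u hub _) ?_ ?_ (hG.norm.const_mul _) ?_
  · refine hS.2.congr_deriv ?_
    rw [← intervalIntegral.integral_const_mul]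
    simp_rw [mul_assoc]
  · filter_upwards [gt_mem_nhds hub] with x hx
    exact (hint x hx _).aestronglyMeasurable_restrict_uIoc
  · simp_rw [mul_assoc]
    exact ((hint u hub _).const_mul a).aestronglyMeasurable_restrict_uIoc
  · refine Filter.Eventually.of_forall fun t ht x hx => ?_
    rw [uIoc_of_le hbT] at ht
    have h1 := rpow_le_add_rpow (δ := b - c) (N := N) (y := t - x) (-1 - a) (by linarith)
      (by linarith [ht.1, hx.2]) (by simp only [N]; linarith [ht.2, hx.1])
    have h2 : 0 ≤ (t - x) ^ (-1 - a) := Real.rpow_nonneg (by linarith [ht.1, hx.2]) _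
    rw [norm_mul, norm_mul, Real.norm_of_nonneg h2, Real.norm_eq_abs]
    gcongr
  · refine Filter.Eventually.of_forall fun t ht x hx => ?_
    rw [uIoc_of_le hbT] at ht
    have h1 : HasDerivAt (fun x : ℝ => t - x) (-1) x := by
      simpa using (hasDerivAt_id x).const_sub t
    have h2 : t - x ≠ 0 := by linarith [ht.1, hx.2]
    refine ((h1.rpow_const (p := -a) (Or.inl h2)).mul_const (G t)).congr_deriv ?_
    rw [show -a - 1 = -1 - a by ring]; ring

/-! ### Identification of `ψ` and `ρ` with the transformed kernel -/

section

/-- Transfer of a finite integral in `[0, ∞]` to an interval integral. -/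
lemma intervalIntegrable_of_lintegral {F : ℝ → ℝ} {Φ : ℝ → ℝ≥0∞} {x y : ℝ} (hxy : x ≤ y)
    (hF : Measurable F)
    (h : ∀ᵐ z ∂volume.restrict (Ioo x y), 0 ≤ F z ∧ ENNReal.ofReal (F z) = Φ z)
    (hfin : ∫⁻ z in Ioo x y, Φ z ≠ ∞) :
    IntervalIntegrable F volume x y ∧ ∫ z in x..y, F z = (∫⁻ z in Ioo x y, Φ z).toReal := by
  have h0 : 0 ≤ᵐ[volume.restrict (Ioo x y)] F := by filter_upwards [h] with z hz using hz.1
  have he : ∫⁻ z in Ioo x y, ENNReal.ofReal (F z) = ∫⁻ z in Ioo x y, Φ z :=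
    lintegral_congr_ae (by filter_upwards [h] with z hz using hz.2)
  rw [intervalIntegrable_iff_integrableOn_Ioo_of_le hxy, intervalIntegral.integral_of_le hxy,
    integral_Ioc_eq_integral_Ioo, integral_eq_lintegral_of_nonneg_ae h0 hF.aestronglyMeasurable, he]
  refine ⟨(lintegral_ofReal_ne_top_iff_integrable hF.aestronglyMeasurable h0).1 ?_, rfl⟩
  rwa [he]

/-- The integrand whose primitives define `ψ`, `φ` and `τ`, with truncated powers. -/
def abelIntegrand (a p u s z : ℝ) : ℝ≥0∞ := pw (-a) z * pw (-a) (u - z) * ap (-p) (z - s)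

variable {H₁ H₂ a p : ℝ}

lemma integrandLt_eq (h₁ : 1 / 2 - H₁ = -a) (h₂ : 2 * H₂ - 2 = -p) {u s z : ℝ} (hz : 0 < z)
    (hzu : z < u) (hzs : z < s) : 0 ≤ integrandLt H₁ H₂ u s z ∧
      ENNReal.ofReal (integrandLt H₁ H₂ u s z) = abelIntegrand a p u s z := by
  have h3 : 0 < u - z := by linarith
  have h4 : 0 < s - z := by linarith
  simp only [integrandLt, h₁, h₂, abelIntegrand]
  refine ⟨by positivity, ?_⟩
  rw [ap_sub_comm, ap_of_pos h4, pw_of_pos hz, pw_of_pos h3, pw_of_pos h4,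
    ENNReal.ofReal_mul (by positivity), ENNReal.ofReal_mul (by positivity),
    mul_comm (ENNReal.ofReal _) (ENNReal.ofReal (z ^ _))]

lemma integrandGt_eq (h₁ : 1 / 2 - H₁ = -a) (h₂ : 2 * H₂ - 2 = -p) {u s z : ℝ} (hz : 0 < z)
    (hzu : z < u) (hzs : s < z) : 0 ≤ integrandGt H₁ H₂ u s z ∧
      ENNReal.ofReal (integrandGt H₁ H₂ u s z) = abelIntegrand a p u s z := by
  have h3 : 0 < u - z := by linarith
  have h4 : 0 < z - s := by linarith
  simp only [integrandGt, h₁, h₂, abelIntegrand]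
  refine ⟨by positivity, ?_⟩
  rw [ap_of_pos h4, pw_of_pos hz, pw_of_pos h3, pw_of_pos h4,
    ENNReal.ofReal_mul (by positivity), ENNReal.ofReal_mul (by positivity),
    mul_comm (ENNReal.ofReal _) (ENNReal.ofReal (z ^ _))]

lemma measurable_integrandLt (u s : ℝ) : Measurable (integrandLt H₁ H₂ u s) := by
  unfold integrandLt; fun_prop

lemma measurable_integrandGt (u s : ℝ) : Measurable (integrandGt H₁ H₂ u s) := by
  unfold integrandGt; fun_prop

lemma abelIntegrand_ne_top (ha : 0 < a) (hp : 0 < p) (hap : 2 * a + p < 1) {T u s : ℝ}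
    (hs : s ∈ Ioo 0 T) (hu : u ≤ T) : ∫⁻ z, abelIntegrand a p u s z ≠ ∞ := by
  simp only [abelIntegrand]
  rw [lintegral_abel_pow ha hp hap]
  exact ne_top_of_le_ne_top (ENNReal.mul_ne_top ofReal_ne_top ofReal_ne_top)
    ((lintegral_mono_set (Iio_subset_Iio hu)).trans (lintegral_abelKer₂_le ha hp hap hs))

section primitives

variable {T s u : ℝ} (h₁ : 1 / 2 - H₁ = -a) (h₂ : 2 * H₂ - 2 = -p) (ha : 0 < a) (hp : 0 < p)
  (hap : 2 * a + p < 1) (hs : s ∈ Ioo 0 T)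
include h₁ h₂ ha hp hap hs

lemma psiPrim_lintegral (hu : u ∈ Ioo 0 s) :
    IntervalIntegrable (integrandLt H₁ H₂ u s) volume 0 u ∧
      psiPrim H₁ H₂ s u = (∫⁻ z in Ioo 0 u, abelIntegrand a p u s z).toReal := by
  refine intervalIntegrable_of_lintegral hu.1.le (measurable_integrandLt u s) ?_ ?_
  · filter_upwards [ae_restrict_mem measurableSet_Ioo] with z hz
    exact integrandLt_eq h₁ h₂ hz.1 hz.2 (hz.2.trans hu.2)
  · exact ne_top_of_le_ne_top (abelIntegrand_ne_top ha hp hap hs (hu.2.trans hs.2).le)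
      (setLIntegral_le_lintegral _ _)

lemma tauPrim_lintegral (hu : u ∈ Ioo s T) :
    IntervalIntegrable (integrandLt H₁ H₂ u s) volume 0 s ∧
      tauPrim H₁ H₂ s u = (∫⁻ z in Ioo 0 s, abelIntegrand a p u s z).toReal := by
  refine intervalIntegrable_of_lintegral hs.1.le (measurable_integrandLt u s) ?_ ?_
  · filter_upwards [ae_restrict_mem measurableSet_Ioo] with z hz
    exact integrandLt_eq h₁ h₂ hz.1 (hz.2.trans hu.1) hz.2
  · exact ne_top_of_le_ne_top (abelIntegrand_ne_top ha hp hap hs hu.2.le)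
      (setLIntegral_le_lintegral _ _)

lemma phiPrim_lintegral (hu : u ∈ Ioo s T) :
    IntervalIntegrable (integrandGt H₁ H₂ u s) volume s u ∧
      phiPrim H₁ H₂ s u = (∫⁻ z in Ioo s u, abelIntegrand a p u s z).toReal := by
  refine intervalIntegrable_of_lintegral hu.1.le (measurable_integrandGt u s) ?_ ?_
  · filter_upwards [ae_restrict_mem measurableSet_Ioo] with z hz
    exact integrandGt_eq h₁ h₂ (hs.1.trans hz.1) hz.2 hz.1
  · exact ne_top_of_le_ne_top (abelIntegrand_ne_top ha hp hap hs hu.2.le)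
      (setLIntegral_le_lintegral _ _)

omit h₁ h₂ in
lemma intervalIntegrable_abelKer₂ :
    IntervalIntegrable (fun v => (abelKer₂ a p v s).toReal) volume 0 T ∧
    (∀ᵐ v ∂volume.restrict (Iio T), abelKer₂ a p v s ≠ ∞) ∧
    ∀ x ∈ Ioo 0 T, ∫ v in (0 : ℝ)..x, (abelKer₂ a p v s).toReal
      = (∫⁻ z, abelIntegrand a p x s z).toReal := by
  have hfin : ∫⁻ v in Iio T, abelKer₂ a p v s ≠ ∞ :=
    ne_top_of_le_ne_top (ENNReal.mul_ne_top ofReal_ne_top ofReal_ne_top)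
      (lintegral_abelKer₂_le ha hp hap hs)
  have hm : Measurable fun v => abelKer₂ a p v s := by fun_prop
  have hlt := ae_lt_top hm hfin
  have hT : 0 < T := hs.1.trans hs.2
  refine ⟨?_, by filter_upwards [hlt] with v hv using hv.ne, fun x hx => ?_⟩
  · rw [intervalIntegrable_iff_integrableOn_Ioo_of_le hT.le]
    exact integrable_toReal_of_lintegral_ne_top hm.aemeasurable
      (ne_top_of_le_ne_top hfin (lintegral_mono_set Ioo_subset_Iio_self))
  · rw [intervalIntegral.integral_of_le hx.1.le, integral_Ioc_eq_integral_Ioo,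
      integral_toReal hm.aemeasurable (ae_restrict_of_ae_restrict_of_subset
        (fun v hv => hv.2.trans hx.2) hlt)]
    simp only [abelIntegrand]
    rw [lintegral_abel_pow ha hp hap]
    congr 1
    rw [← lintegral_indicator measurableSet_Ioo, ← lintegral_indicator measurableSet_Iio]
    refine lintegral_congr fun v => ?_
    rcases le_or_gt v 0 with h | h
    · rw [indicator_of_notMem (fun hc => not_lt.2 h hc.1)]
      refine (indicator_apply_eq_zero.2 fun _ => ?_).symm
      simp [abelKer₂, abelKer, pw_of_nonpos h]
    · by_cases h' : v < x
      · rw [indicator_of_mem (show v ∈ Ioo 0 x from ⟨h, h'⟩),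
          indicator_of_mem (show v ∈ Iio x from h')]
      · rw [indicator_of_notMem (fun hc => h' hc.2),
          indicator_of_notMem (show v ∉ Iio x from h')]

lemma psiPrim_eq_integral (hu : u ∈ Ioo 0 s) :
    psiPrim H₁ H₂ s u = ∫ v in (0 : ℝ)..u, (abelKer₂ a p v s).toReal := by
  rw [(intervalIntegrable_abelKer₂ ha hp hap hs).2.2 u ⟨hu.1, hu.2.trans hs.2⟩,
    (psiPrim_lintegral h₁ h₂ ha hp hap hs hu).2, ← lintegral_indicator measurableSet_Ioo]
  congr 1
  refine lintegral_congr fun z => ?_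
  by_cases hz : z ∈ Ioo 0 u
  · rw [indicator_of_mem hz]
  · rw [indicator_of_notMem hz, abelIntegrand]
    rcases le_or_gt z 0 with h | h
    · simp [pw_of_nonpos h]
    · have : u ≤ z := by by_contra hc; exact hz ⟨h, by linarith⟩
      simp [pw_of_nonpos (show u - z ≤ 0 by linarith)]

lemma tauPrim_add_phiPrim_eq_integral (hu : u ∈ Ioo s T) :
    phiPrim H₁ H₂ s u + tauPrim H₁ H₂ s u = ∫ v in (0 : ℝ)..u, (abelKer₂ a p v s).toReal := by
  have hfin := abelIntegrand_ne_top ha hp hap hs hu.2.le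
  rw [(intervalIntegrable_abelKer₂ ha hp hap hs).2.2 u ⟨hs.1.trans hu.1, hu.2⟩,
    (phiPrim_lintegral h₁ h₂ ha hp hap hs hu).2, (tauPrim_lintegral h₁ h₂ ha hp hap hs hu).2,
    ← ENNReal.toReal_add (ne_top_of_le_ne_top hfin (setLIntegral_le_lintegral _ _))
    (ne_top_of_le_ne_top hfin (setLIntegral_le_lintegral _ _)),
    ← lintegral_union measurableSet_Ioo, ← lintegral_indicator
      (measurableSet_Ioo.union measurableSet_Ioo)]
  · congr 1
    refine lintegral_congr_ae ?_
    filter_upwards [ae_ne s] with z hzs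
    by_cases hz : z ∈ Ioo s u ∪ Ioo 0 s
    · rw [indicator_of_mem hz]
    · rw [indicator_of_notMem hz, abelIntegrand]
      rcases le_or_gt z 0 with h | h
      · simp [pw_of_nonpos h]
      · have : u ≤ z := by
          by_contra hc
          rcases hzs.lt_or_gt with h' | h'
          · exact hz (Or.inr ⟨h, h'⟩)
          · exact hz (Or.inl ⟨h', by linarith⟩)
        simp [pw_of_nonpos (show u - z ≤ 0 by linarith)]
  · refine Set.disjoint_left.2 ?_
    rintro x ⟨h0, h1⟩ ⟨h2, h3⟩
    exact lt_asymm h0 h3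

lemma ae_psi_eq : ∀ᵐ v, v ∈ Ioo 0 s → psi H₁ H₂ v s = (abelKer₂ a p v s).toReal := by
  have hT : 0 < T := hs.1.trans hs.2
  have hi := (intervalIntegrable_abelKer₂ ha hp hap hs).1
  filter_upwards [hi.ae_hasDerivAt_integral] with v hv hvs
  rw [uIcc_of_le hT.le] at hv
  have h := hv ⟨hvs.1.le, (hvs.2.trans hs.2).le⟩ 0 ⟨le_rfl, hT.le⟩
  refine (h.congr_of_eventuallyEq ?_).deriv
  filter_upwards [Ioo_mem_nhds hvs.1 hvs.2] with x hx
  exact psiPrim_eq_integral h₁ h₂ ha hp hap hs hx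

lemma differentiableAt_phiPrim {v : ℝ} (hv : s < v) : DifferentiableAt ℝ (phiPrim H₁ H₂ s) v :=
  ((contDiffOn_phiPrim h₁ h₂ (by linarith) (by linarith) hs.1).differentiableOn
    two_ne_zero).differentiableAt (Ioi_mem_nhds hv)

lemma differentiableAt_tauPrim {v : ℝ} (hv : s < v) : DifferentiableAt ℝ (tauPrim H₁ H₂ s) v :=
  ((contDiffOn_tauPrim h₁ h₂ (by linarith) (by linarith) hs.1).differentiableOn
    two_ne_zero).differentiableAt (Ioi_mem_nhds hv)

lemma ae_rho_eq : ∀ᵐ v, v ∈ Ioo s T → rho H₁ H₂ v s = (abelKer₂ a p v s).toReal := by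
  have hT : 0 < T := hs.1.trans hs.2
  have hi := (intervalIntegrable_abelKer₂ ha hp hap hs).1
  filter_upwards [hi.ae_hasDerivAt_integral] with v hv hvs
  rw [uIcc_of_le hT.le] at hv
  have h := hv ⟨(hs.1.trans hvs.1).le, hvs.2.le⟩ 0 ⟨le_rfl, hT.le⟩
  have h1 := (differentiableAt_phiPrim h₁ h₂ ha hp hap hs hvs.1).hasDerivAt.add
    (differentiableAt_tauPrim h₁ h₂ ha hp hap hs hvs.1).hasDerivAt
  refine h1.unique (h.congr_of_eventuallyEq ?_)
  filter_upwards [Ioo_mem_nhds hvs.1 hvs.2] with x hx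
  exact tauPrim_add_phiPrim_eq_integral h₁ h₂ ha hp hap hs hx

omit hs in
lemma contDiffOn_psi : ContDiffOn ℝ 1 (fun t => t ^ (2 * a) * psi H₁ H₂ t s) (Ioo 0 s) := by
  have h := (contDiffOn_psiPrim (s := s) h₁ h₂ (by linarith)).deriv_of_isOpen (m := 1) isOpen_Ioo
    (by norm_num)
  exact (contDiffOn_id.rpow_const_of_ne fun u hu => hu.1.ne').mul h

lemma contDiffOn_rho : ContDiffOn ℝ 1 (fun t => t ^ (2 * a) * rho H₁ H₂ t s) (Ioi s) := by
  have h3 := (contDiffOn_phiPrim h₁ h₂ (by linarith) (by linarith) hs.1).deriv_of_isOpen (m := 1)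
    isOpen_Ioi (by norm_num)
  have h4 := (contDiffOn_tauPrim h₁ h₂ (by linarith) (by linarith) hs.1).deriv_of_isOpen (m := 1)
    isOpen_Ioi (by norm_num)
  exact (contDiffOn_id.rpow_const_of_ne fun u hu => (hs.1.trans hu).ne').mul (h3.add h4)

omit h₁ h₂ in
lemma intervalIntegrable_weighted :
    IntervalIntegrable (fun v => v ^ (2 * a) * (abelKer₂ a p v s).toReal) volume 0 T :=
  (intervalIntegrable_abelKer₂ ha hp hap hs).1.continuousOn_mul
    (continuousOn_id.rpow_const fun _ _ => Or.inr (by linarith))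

lemma intervalIntegrable_psi {x y : ℝ} (hx : 0 ≤ x) (hxy : x ≤ y) (hy : y ≤ s) :
    IntervalIntegrable (fun t => t ^ (2 * a) * psi H₁ H₂ t s) volume x y := by
  have h := (intervalIntegrable_weighted ha hp hap hs).mono_set (c := x) (d := y) (by
    rw [uIcc_of_le hxy, uIcc_of_le (hs.1.trans hs.2).le]
    exact Icc_subset_Icc hx (hy.trans hs.2.le))
  refine h.congr_ae ?_
  rw [uIoc_of_le hxy, Filter.EventuallyEq, ae_restrict_iff' measurableSet_Ioc]
  filter_upwards [ae_psi_eq h₁ h₂ ha hp hap hs, ae_ne s] with v hv hvs hvm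
  rw [hv ⟨hx.trans_lt hvm.1, lt_of_le_of_ne (hvm.2.trans hy) hvs⟩]

lemma intervalIntegrable_rho {x y : ℝ} (hx : s ≤ x) (hxy : x ≤ y) (hy : y ≤ T) :
    IntervalIntegrable (fun t => t ^ (2 * a) * rho H₁ H₂ t s) volume x y := by
  have h := (intervalIntegrable_weighted ha hp hap hs).mono_set (c := x) (d := y) (by
    rw [uIcc_of_le hxy, uIcc_of_le (hs.1.trans hs.2).le]
    exact Icc_subset_Icc (hs.1.le.trans hx) hy)
  refine h.congr_ae ?_
  rw [uIoc_of_le hxy, Filter.EventuallyEq, ae_restrict_iff' measurableSet_Ioc]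
  filter_upwards [ae_rho_eq h₁ h₂ ha hp hap hs, ae_ne T] with v hv hvs hvm
  rw [hv ⟨hx.trans_lt hvm.1, lt_of_le_of_ne (hvm.2.trans hy) hvs⟩]

end primitives

end

/-! ### The derivative of the second Abel integral -/

section

variable {a p T s u : ℝ}

/-- A Harnack inequality for the sweeping integral, from `|w - y| ≤ |w - x| + |x - y|`. -/
lemma sweptTail_le {x y : ℝ} (hx : x ∈ Ioo 0 T) (hy : y ∈ Ioo 0 T) :
    sweptTail a p T x s ≤ ENNReal.ofReal (1 + |x - y| / min x (T - x)) * sweptTail a p T y s := by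
  have hd : 0 < min x (T - x) := lt_min hx.1 (by linarith [hx.2])
  simp only [sweptTail]
  rw [← lintegral_const_mul' _ _ ofReal_ne_top]
  refine setLIntegral_mono' (measurableSet_Iio.union measurableSet_Ioi) fun w hw => ?_
  have hwx : min x (T - x) ≤ |w - x| := by
    rcases hw with h | h
    · rw [abs_of_neg (by linarith [mem_Iio.1 h, hx.1])]
      exact (min_le_left _ _).trans (by linarith [mem_Iio.1 h])
    · rw [abs_of_pos (by linarith [mem_Ioi.1 h, hx.2])]
      exact (min_le_right _ _).trans (by linarith [mem_Ioi.1 h])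
  have hwx0 : w - x ≠ 0 := abs_pos.1 (hd.trans_le hwx)
  have hwy0 : w - y ≠ 0 := by
    intro hc
    rcases hw with h | h
    · linarith [mem_Iio.1 h, hy.1]
    · linarith [mem_Ioi.1 h, hy.2]
  have key : ap (-1) (w - x) ≤ ENNReal.ofReal (1 + |x - y| / min x (T - x)) * ap (-1) (w - y) := by
    rw [ap_of_ne hwx0, ap_of_ne hwy0, ← ENNReal.ofReal_mul (by positivity), Real.rpow_neg_one,
      Real.rpow_neg_one]
    refine ENNReal.ofReal_le_ofReal ?_
    have h1 := abs_pos.2 hwx0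
    have h2 := abs_pos.2 hwy0
    rw [← div_eq_mul_inv, inv_eq_one_div, div_le_div_iff₀ h1 h2, one_mul]
    have h3 : |w - y| ≤ |w - x| + |x - y| := abs_sub_le w x y
    have h4 : |x - y| ≤ |x - y| / min x (T - x) * |w - x| := by
      rw [div_mul_eq_mul_div, le_div_iff₀ hd]
      exact mul_le_mul_of_nonneg_left hwx (abs_nonneg _)
    linarith
  calc _ ≤ dens a p s w * ap a w * ap a (w - T) *
        (ENNReal.ofReal (1 + |x - y| / min x (T - x)) * ap (-1) (w - y)) :=
        mul_le_mul_right key _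
    _ = _ := by ring

lemma dens_ne_top (w : ℝ) : dens a p s w ≠ ∞ :=
  ENNReal.mul_ne_top (ENNReal.inv_ne_top.2 (rieszConst_pos a p)) (ap_ne_top _ _)

section

variable (ha : 0 < a) (hp : 0 < p) (hap : 2 * a + p < 1) (hs : s ∈ Ioo 0 T)
include ha hp hap hs

/-- The sweeping integral is finite at some point of `(0, T)` because `sweptKer` is integrable,
hence at every point by `sweptTail_le`. -/
lemma sweptTail_ne_top {x : ℝ} (hx : x ∈ Ioo 0 T) : sweptTail a p T x s ≠ ∞ := by
  have hT : 0 < T := hs.1.trans hs.2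
  have hcA := abelConst_pos ha (show a < 1 / 2 by linarith)
  have hm : Measurable fun t => sweptKer a p T t s := by fun_prop
  have hae : ∀ᵐ x ∂volume.restrict (Ioo 0 T), sweptKer a p T x s < ∞ :=
    ae_Ioo_of_forall hT fun r hr => ae_lt_top hm (lintegral_Ioo_sweptKer_ne_top ha hp hap hs r hr)
  have hne : (ae (volume.restrict (Ioo 0 T))).NeBot := by
    rw [ae_neBot, Ne, Measure.restrict_eq_zero]
    simp [hT]
  obtain ⟨y, hy, hyT⟩ := (hae.and (ae_restrict_mem measurableSet_Ioo)).exists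
  have hWy : sweptTail a p T y s ≠ ∞ := by
    intro hc
    have h2 : pw (-a) (T - y) ≠ 0 := (pw_pos (by linarith [hyT.2])).ne'
    have h3 : ENNReal.ofReal (abelConst a) ≠ 0 := by simpa using hcA
    rw [sweptKer, hc, ENNReal.mul_top h2, add_top, ENNReal.mul_top h3] at hy
    exact lt_irrefl _ hy
  exact ne_top_of_le_ne_top (ENNReal.mul_ne_top ofReal_ne_top hWy) (sweptTail_le hx hyT)

/-- The sweeping integral is continuous, since its values at neighbouring points are comparable with
ratio close to `1`. -/
lemma continuousAt_sweptTail (hu : u ∈ Ioo 0 T) :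
    ContinuousAt (fun x => (sweptTail a p T x s).toReal) u := by
  have hWr : ∀ x ∈ Ioo 0 T, ∀ y ∈ Ioo 0 T, (sweptTail a p T x s).toReal
      ≤ (1 + |x - y| / min x (T - x)) * (sweptTail a p T y s).toReal := by
    intro x hx y hy
    have hd : 0 < min x (T - x) := lt_min hx.1 (by linarith [hx.2])
    have := ENNReal.toReal_mono (ENNReal.mul_ne_top ofReal_ne_top
      (sweptTail_ne_top ha hp hap hs hy)) (sweptTail_le hx hy)
    rwa [ENNReal.toReal_mul, ENNReal.toReal_ofReal (by positivity)] at this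
  have hdu : 0 < min u (T - u) := lt_min hu.1 (by linarith [hu.2])
  generalize hC : (sweptTail a p T u s).toReal = C at *
  refine tendsto_of_tendsto_of_tendsto_of_le_of_le'
    (g := fun x => C / (1 + |u - x| / min u (T - u)))
    (h := fun x => (1 + |x - u| / min x (T - x)) * C) ?_ ?_ ?_ ?_
  · have : ContinuousAt (fun x => C / (1 + |u - x| / min u (T - u))) u :=
      ContinuousAt.div (by fun_prop) (by fun_prop) (by positivity)
    have h2 := this.tendsto
    simpa [hC] using h2
  · have : ContinuousAt (fun x => (1 + |x - u| / min x (T - x)) * C) u :=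
      ContinuousAt.mul (ContinuousAt.add (by fun_prop)
        (ContinuousAt.div (by fun_prop) (by fun_prop) hdu.ne')) (by fun_prop)
    have h2 := this.tendsto
    simpa [hC] using h2
  · filter_upwards [Ioo_mem_nhds hu.1 hu.2] with x hx
    rw [div_le_iff₀ (by positivity), mul_comm, ← hC]
    exact hWr u hu x hx
  · filter_upwards [Ioo_mem_nhds hu.1 hu.2] with x hx
    rw [← hC]
    exact hWr x hx u hu

lemma sweptKer_ne_top (hu : u ∈ Ioo 0 T) : sweptKer a p T u s ≠ ∞ :=
  ENNReal.mul_ne_top ofReal_ne_top (ENNReal.add_ne_top.2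
    ⟨ENNReal.mul_ne_top ofReal_ne_top (ENNReal.mul_ne_top (ap_ne_top _ _) (dens_ne_top _)),
      ENNReal.mul_ne_top (pw_ne_top _ _) (sweptTail_ne_top ha hp hap hs hu)⟩)

lemma continuousAt_sweptKer (hu : u ∈ Ioo 0 T) (hus : u ≠ s) :
    ContinuousAt (fun x => (sweptKer a p T x s).toReal) u := by
  have hcA := abelConst_pos ha (show a < 1 / 2 by linarith)
  have hform : ∀ x ∈ Ioo 0 T, x ≠ s → (sweptKer a p T x s).toReal
      = abelConst a * ((ENNReal.ofReal (ProbabilityTheory.beta (1 - a) a)).toReal *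
        (x ^ a * ((rieszConst a p)⁻¹.toReal * |x - s| ^ (-2 * a - p)))
        + (T - x) ^ (-a) * (sweptTail a p T x s).toReal) := by
    intro x hx hxs
    have hTx : 0 < T - x := by linarith [hx.2]
    rw [sweptKer, ENNReal.toReal_mul, ENNReal.toReal_add, ENNReal.toReal_mul, ENNReal.toReal_mul,
      ENNReal.toReal_mul, ENNReal.toReal_ofReal hcA.le, dens, ENNReal.toReal_mul, ap_of_pos hx.1,
      pw_of_pos hx.1, pw_of_pos hTx, ap_of_ne (sub_ne_zero.2 hxs),
      ENNReal.toReal_ofReal (Real.rpow_nonneg hx.1.le _),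
      ENNReal.toReal_ofReal (Real.rpow_nonneg hTx.le _),
      ENNReal.toReal_ofReal (Real.rpow_nonneg (abs_nonneg _) _)]
    · exact ENNReal.mul_ne_top ofReal_ne_top (ENNReal.mul_ne_top (ap_ne_top _ _) (dens_ne_top _))
    · exact ENNReal.mul_ne_top (pw_ne_top _ _) (sweptTail_ne_top ha hp hap hs hx)
  have c1 : ContinuousAt (fun x : ℝ => x ^ a) u :=
    Real.continuousAt_rpow_const _ _ (Or.inl hu.1.ne')
  have c2 : ContinuousAt (fun x : ℝ => |x - s| ^ (-2 * a - p)) u :=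
    ContinuousAt.rpow_const (by fun_prop) (Or.inl (abs_pos.2 (sub_ne_zero.2 hus)).ne')
  have c3 : ContinuousAt (fun x : ℝ => (T - x) ^ (-a)) u :=
    ContinuousAt.rpow_const (by fun_prop) (Or.inl (by linarith [hu.2]))
  have hcont := (continuousAt_const (y := abelConst a)).mul
    (((continuousAt_const (y := (ENNReal.ofReal (ProbabilityTheory.beta (1 - a) a)).toReal)).mul
      (c1.mul ((continuousAt_const (y := (rieszConst a p)⁻¹.toReal)).mul c2))).add
      (c3.mul (continuousAt_sweptTail ha hp hap hs hu)))
  refine hcont.congr ?_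
  filter_upwards [Ioo_mem_nhds hu.1 hu.2, isOpen_ne.mem_nhds hus] with x hx hxs
  exact (hform x hx hxs).symm

lemma intervalIntegrable_sweptKer {x : ℝ} (hx : x ∈ Ioo 0 T) :
    IntervalIntegrable (fun t => (sweptKer a p T t s).toReal) volume x T ∧
      ∫ t in x..T, (sweptKer a p T t s).toReal = (∫⁻ t in Ioo x T, sweptKer a p T t s).toReal := by
  have hfin := lintegral_Ioo_sweptKer_ne_top ha hp hap hs x hx
  have hm : Measurable fun t => sweptKer a p T t s := by fun_prop
  refine intervalIntegrable_of_lintegral hx.2.le hm.ennreal_toReal ?_ hfin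
  filter_upwards [ae_lt_top hm hfin] with t ht
  exact ⟨ENNReal.toReal_nonneg, ENNReal.ofReal_toReal ht.ne⟩

/-- The weighted Abel integral of `abelKer₂` over `(x, T)` is the integral of `sweptKer`. -/
lemma integral_abel_weighted {x : ℝ} (hx : x ∈ Ioo 0 T) :
    IntervalIntegrable (fun t => (t - x) ^ (-a) * (t ^ (2 * a) * (abelKer₂ a p t s).toReal))
      volume x T ∧
    ∫ t in x..T, (t - x) ^ (-a) * (t ^ (2 * a) * (abelKer₂ a p t s).toReal)
      = ∫ t in x..T, (sweptKer a p T t s).toReal := by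
  have hfin := lintegral_Ioo_sweptKer_ne_top ha hp hap hs x hx
  have hk : Measurable fun t => abelKer₂ a p t s := by fun_prop
  have hk' := hk.ennreal_toReal
  have heq : ∫⁻ v in Ioo x T, pw (-a) (v - x) * pw (2 * a) v * abelKer₂ a p v s
      = ∫⁻ t in Ioo x T, sweptKer a p T t s := by
    rw [← lintegral_abel_abelKer₂ ha (by linarith) hx.1 hx.2 s,
      ← lintegral_indicator measurableSet_Ioo, ← lintegral_indicator measurableSet_Iio]
    refine lintegral_congr fun v => ?_
    by_cases hv : v ∈ Ioo x T
    · rw [indicator_of_mem hv, indicator_of_mem (show v ∈ Iio T from hv.2)]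
    · rw [indicator_of_notMem hv, eq_comm]
      refine indicator_apply_eq_zero.2 fun hv' => ?_
      rw [pw_of_nonpos, zero_mul, zero_mul]
      by_contra hc
      exact hv ⟨by linarith, hv'⟩
  have hA := intervalIntegrable_of_lintegral (x := x) (y := T)
    (F := fun t => (t - x) ^ (-a) * (t ^ (2 * a) * (abelKer₂ a p t s).toReal))
    (Φ := fun v => pw (-a) (v - x) * pw (2 * a) v * abelKer₂ a p v s) hx.2.le
    (Measurable.mul (by fun_prop) (Measurable.mul (by fun_prop) hk')) ?_ (by rw [heq]; exact hfin)
  · exact ⟨hA.1, by rw [hA.2, heq, (intervalIntegrable_sweptKer ha hp hap hs hx).2]⟩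
  · filter_upwards [ae_restrict_mem measurableSet_Ioo, ae_restrict_of_ae_restrict_of_subset
      Ioo_subset_Iio_self (intervalIntegrable_abelKer₂ ha hp hap hs).2.1] with t ht ht'
    have h1 : 0 < t - x := by linarith [ht.1]
    have h2 : 0 < t := hx.1.trans ht.1
    have h3 := Real.rpow_pos_of_pos h1 (-a)
    have h4 := Real.rpow_pos_of_pos h2 (2 * a)
    refine ⟨mul_nonneg h3.le (mul_nonneg h4.le ENNReal.toReal_nonneg), ?_⟩
    rw [ENNReal.ofReal_mul h3.le, ENNReal.ofReal_mul h4.le,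
      ENNReal.ofReal_toReal ht', pw_of_pos h1, pw_of_pos h2, mul_assoc]

lemma hasDerivAt_integral_sweptKer (hu : u ∈ Ioo 0 T) (hus : u ≠ s) :
    HasDerivAt (fun x => ∫ t in x..T, (t - x) ^ (-a) * (t ^ (2 * a) * (abelKer₂ a p t s).toReal))
      (-(sweptKer a p T u s).toReal) u := by
  have hm : Measurable fun t => sweptKer a p T t s := by fun_prop
  refine (intervalIntegral.integral_hasDerivAt_left (intervalIntegrable_sweptKer ha hp hap hs hu).1
    hm.ennreal_toReal.stronglyMeasurable.stronglyMeasurableAtFilter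
    (continuousAt_sweptKer ha hp hap hs hu hus)).congr_of_eventuallyEq ?_
  filter_upwards [Ioo_mem_nhds hu.1 hu.2] with x hx
  exact (integral_abel_weighted ha hp hap hs hx).2

end

end

/-! ### Identification of the kernel `K` -/

section

variable {H₁ H₂ a p T s u : ℝ}

section

variable (h₁ : 1 / 2 - H₁ = -a) (h₂ : 2 * H₂ - 2 = -p) (ha : 0 < a) (hp : 0 < p)
  (hap : 2 * a + p < 1) (hs : s ∈ Ioo 0 T)
include h₁ h₂ ha hp hap hs

lemma sweptKer_eq_Kminus (hsu : s < u) (huT : u < T) :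
    IntervalIntegrable (weylRho H₁ H₂ u s) volume u T ∧
      (sweptKer a p T u s).toReal = u ^ a * Kminus H₁ H₂ T u s := by
  have hu : 0 < u := hs.1.trans hsu
  have hweyl : weylRho H₁ H₂ u s = fun t => (u ^ (2 * a) * rho H₁ H₂ u s
      - t ^ (2 * a) * rho H₁ H₂ t s) / (t - u) ^ (1 + a) := by
    funext t
    rw [weylRho, show 2 * H₁ - 1 = 2 * a by linarith, show H₁ + 1 / 2 = 1 + a by linarith]
  obtain ⟨hint, hder⟩ := hasDerivAt_abel (l := s) (r := T + 1) (b := T) ha (by linarith)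
    ((contDiffOn_rho h₁ h₂ ha hp hap hs).mono Ioo_subset_Ioi_self) hsu huT (by linarith)
  rw [← hweyl] at hint
  refine ⟨hint, ?_⟩
  have hder' := hasDerivAt_integral_sweptKer ha hp hap hs ⟨hu, huT⟩ hsu.ne'
  have heq := hder'.unique (hder.congr_of_eventuallyEq (by
    filter_upwards [Ioo_mem_nhds hsu huT] with x hx
    refine intervalIntegral.integral_congr_ae ?_
    filter_upwards [ae_rho_eq h₁ h₂ ha hp hap hs, ae_ne T] with t ht htT htm
    rw [uIoc_of_le hx.2.le] at htm
    rw [ht ⟨hx.1.trans htm.1, lt_of_le_of_ne htm.2 htT⟩]))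
  rw [neg_inj, ← hweyl] at heq
  have e1 : u ^ (2 * a) = u ^ a * u ^ a := by rw [← Real.rpow_add hu]; ring_nf
  have e2 : u ^ a * u ^ (-a) = 1 := by rw [← Real.rpow_add hu, add_neg_cancel, Real.rpow_zero]
  rw [heq, Kminus, h₁, show H₁ - 1 / 2 = a by linarith, e1]
  linear_combination (-a * ∫ t in u..T, weylRho H₁ H₂ u s t) * e2

lemma integral_abel_split {x b : ℝ} (hx : 0 < x) (hxb : x < b) (hbs : b < s) :
    ∫ t in x..T, (t - x) ^ (-a) * (t ^ (2 * a) * (abelKer₂ a p t s).toReal)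
      = (∫ t in x..b, (t - x) ^ (-a) * (t ^ (2 * a) * psi H₁ H₂ t s))
        + (∫ t in b..s, (t - x) ^ (-a) * (t ^ (2 * a) * psi H₁ H₂ t s))
        + ∫ t in s..T, (t - x) ^ (-a) * (t ^ (2 * a) * rho H₁ H₂ t s) := by
  have hi := (integral_abel_weighted ha hp hap hs
    (show x ∈ Ioo 0 T from ⟨hx, (hxb.trans hbs).trans hs.2⟩)).1
  have hsub : ∀ c d, x ≤ c → c ≤ d → d ≤ T → IntervalIntegrable
      (fun t => (t - x) ^ (-a) * (t ^ (2 * a) * (abelKer₂ a p t s).toReal)) volume c d := by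
    intro c d hc hcd hd
    refine hi.mono_set ?_
    rw [uIcc_of_le hcd, uIcc_of_le (hc.trans (hcd.trans hd))]
    exact Icc_subset_Icc hc hd
  have hsT := hs.2.le
  rw [← intervalIntegral.integral_add_adjacent_intervals
      (hsub x s le_rfl (hxb.trans hbs).le hsT) (hsub s T (hxb.trans hbs).le hsT le_rfl),
    ← intervalIntegral.integral_add_adjacent_intervals
      (hsub x b le_rfl hxb.le (hbs.le.trans hsT)) (hsub b s hxb.le hbs.le hsT)]
  congr 1
  · congr 1
    · refine intervalIntegral.integral_congr_ae ?_
      filter_upwards [ae_psi_eq h₁ h₂ ha hp hap hs] with t ht htm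
      rw [uIoc_of_le hxb.le] at htm
      rw [ht ⟨hx.trans htm.1, htm.2.trans_lt hbs⟩]
    · refine intervalIntegral.integral_congr_ae ?_
      filter_upwards [ae_psi_eq h₁ h₂ ha hp hap hs, ae_ne s] with t ht hts htm
      rw [uIoc_of_le hbs.le] at htm
      rw [ht ⟨(hx.trans hxb).trans htm.1, lt_of_le_of_ne htm.2 hts⟩]
  · refine intervalIntegral.integral_congr_ae ?_
    filter_upwards [ae_rho_eq h₁ h₂ ha hp hap hs, ae_ne T] with t ht htT htm
    rw [uIoc_of_le hsT] at htm
    rw [ht ⟨htm.1, lt_of_le_of_ne htm.2 htT⟩]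

omit h₁ h₂ hp hap hs in
lemma integral_sub_rpow {b : ℝ} (hub : u < b) (hbs : b ≤ s) :
    IntervalIntegrable (fun t => (t - u) ^ (-1 - a)) volume b s ∧
    ∫ t in b..s, (t - u) ^ (-1 - a) = ((b - u) ^ (-a) - (s - u) ^ (-a)) / a := by
  have h0 : (0 : ℝ) ∉ uIcc (b - u) (s - u) := by
    rw [uIcc_of_le (by linarith)]
    exact fun h => by linarith [h.1]
  constructor
  · have := (intervalIntegral.intervalIntegrable_rpow (μ := volume) (r := -1 - a)
      (Or.inr h0)).comp_sub_right u
    simpa using this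
  · rw [intervalIntegral.integral_comp_sub_right (fun t => t ^ (-1 - a)),
      integral_rpow (Or.inr ⟨by linarith, h0⟩), show -1 - a + 1 = -a by ring, div_neg, ← neg_div,
      neg_sub]

lemma sweptKer_eq_Kplus (hu : 0 < u) (hus : u < s) :
    IntervalIntegrable (weylPsi H₁ H₂ u s) volume u s ∧
    IntervalIntegrable (tailRho H₁ H₂ u s) volume s T ∧
      (sweptKer a p T u s).toReal = u ^ a * Kplus H₁ H₂ T u s := by
  -- `ψ` may be singular at `s`, so the Marchaud form is used on `(u, b)` only, for some `b < s`; on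
  -- `(b, s)` and on `(s, T)` the kernel `(t - x) ^ (-a)` is smooth in `x` near `u`
  set b := (u + s) / 2 with hb
  have hub : u < b := by rw [hb]; linarith
  have hbs : b < s := by rw [hb]; linarith
  have huT : u < T := hus.trans hs.2
  have hweyl : weylPsi H₁ H₂ u s = fun t => (u ^ (2 * a) * psi H₁ H₂ u s
      - t ^ (2 * a) * psi H₁ H₂ t s) / (t - u) ^ (1 + a) := by
    funext t
    rw [weylPsi, show 2 * H₁ - 1 = 2 * a by linarith, show H₁ + 1 / 2 = 1 + a by linarith]
  have htail : tailRho H₁ H₂ u s = fun t => (t - u) ^ (-1 - a) *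
      (t ^ (2 * a) * rho H₁ H₂ t s) := by
    funext t
    rw [tailRho, show 2 * H₁ - 1 = 2 * a by linarith, show -(1 / 2) - H₁ = -1 - a by linarith,
      mul_assoc]
  obtain ⟨hint₁, hder₁⟩ := hasDerivAt_abel ha (by linarith)
    (contDiffOn_psi h₁ h₂ ha hp hap (s := s)) hu hub hbs
  obtain ⟨hint₂, hder₂⟩ := hasDerivAt_abel_tail (a := a) hub hbs.le
    (intervalIntegrable_psi h₁ h₂ ha hp hap hs (hu.trans hub).le hbs.le le_rfl)
  obtain ⟨hint₃, hder₃⟩ := hasDerivAt_abel_tail (a := a) hus hs.2.le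
    (intervalIntegrable_rho h₁ h₂ ha hp hap hs le_rfl hs.2.le le_rfl)
  obtain ⟨hint₄, hval₄⟩ := integral_sub_rpow ha hub hbs.le
  rw [← htail] at hint₃
  rw [← hweyl] at hint₁
  have hptw : ∀ t ∈ Ioc b s, u ^ (2 * a) * psi H₁ H₂ u s * (t - u) ^ (-1 - a)
      - (t - u) ^ (-1 - a) * (t ^ (2 * a) * psi H₁ H₂ t s) = weylPsi H₁ H₂ u s t := by
    intro t ht
    have : 0 < t - u := by linarith [ht.1]
    rw [hweyl, show -1 - a = -(1 + a) by ring, Real.rpow_neg this.le]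
    ring
  have hint₅ : IntervalIntegrable (weylPsi H₁ H₂ u s) volume b s := by
    refine ((hint₄.const_mul (u ^ (2 * a) * psi H₁ H₂ u s)).sub hint₂).congr ?_
    rw [uIoc_of_le hbs.le]
    exact fun t ht => hptw t ht
  have hval₅ : ∫ t in b..s, weylPsi H₁ H₂ u s t
      = u ^ (2 * a) * psi H₁ H₂ u s * (((b - u) ^ (-a) - (s - u) ^ (-a)) / a)
        - ∫ t in b..s, (t - u) ^ (-1 - a) * (t ^ (2 * a) * psi H₁ H₂ t s) := by
    rw [← hval₄, ← intervalIntegral.integral_const_mul,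
      ← intervalIntegral.integral_sub (hint₄.const_mul _) hint₂]
    refine intervalIntegral.integral_congr_ae (Filter.Eventually.of_forall fun t ht => ?_)
    rw [uIoc_of_le hbs.le] at ht
    exact (hptw t ht).symm
  refine ⟨hint₁.trans hint₅, hint₃, ?_⟩
  have hder' := hasDerivAt_integral_sweptKer ha hp hap hs ⟨hu, huT⟩ hus.ne
  have heq := hder'.unique (((hder₁.add hder₂).add hder₃).congr_of_eventuallyEq (by
    filter_upwards [Ioo_mem_nhds hu hub] with x hx
    exact integral_abel_split h₁ h₂ ha hp hap hs hx.1 hx.2 hbs))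
  rw [← htail, ← hweyl] at heq
  have e1 : u ^ (2 * a) = u ^ a * u ^ a := by rw [← Real.rpow_add hu]; ring_nf
  have e2 : u ^ a * u ^ (-a) = 1 := by rw [← Real.rpow_add hu, add_neg_cancel, Real.rpow_zero]
  have e3 := intervalIntegral.integral_add_adjacent_intervals hint₁ hint₅
  have e4 : a * (((b - u) ^ (-a) - (s - u) ^ (-a)) / a) = (b - u) ^ (-a) - (s - u) ^ (-a) :=
    mul_div_cancel₀ _ ha.ne'
  rw [Kplus, h₁, show H₁ - 1 / 2 = a by linarith, ← e3, hval₅]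
  rw [e1] at heq ⊢
  linear_combination -heq - (u ^ a * u ^ a * psi H₁ H₂ u s) * e4
    - (a * ((∫ t in u..b, weylPsi H₁ H₂ u s t)
        + (u ^ a * u ^ a * psi H₁ H₂ u s * (((b - u) ^ (-a) - (s - u) ^ (-a)) / a)
          - ∫ t in b..s, (t - u) ^ (-1 - a) * (t ^ (2 * a) * psi H₁ H₂ t s))
        - ∫ t in s..T, tailRho H₁ H₂ u s t)) * e2

lemma sweptKer_eq_K (hu : u ∈ Ioo 0 T) (hus : u ≠ s) :
    (sweptKer a p T u s).toReal = u ^ a * K H₁ H₂ T u s := by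
  rcases hus.lt_or_gt with h | h
  · rw [K, if_neg h.not_gt, if_pos h]
    exact (sweptKer_eq_Kplus h₁ h₂ ha hp hap hs hu.1 h).2.2
  · rw [K, if_pos h]
    exact (sweptKer_eq_Kminus h₁ h₂ ha hp hap hs h hu.2).2

end

lemma kernelWellDefined (h₁ : 1 / 2 - H₁ = -a) (h₂ : 2 * H₂ - 2 = -p) (ha : 0 < a) (hp : 0 < p)
    (hap : 2 * a + p < 1) : KernelWellDefined H₁ H₂ T where
  psi_integrable _ _ hu hus hs :=
    (psiPrim_lintegral h₁ h₂ ha hp hap ⟨hu.trans hus, hs⟩ ⟨hu, hus⟩).1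
  psi_differentiable _ _ hu hus hs :=
    ((contDiffOn_psiPrim h₁ h₂ (by linarith)).differentiableOn two_ne_zero).differentiableAt
      (Ioo_mem_nhds hu hus)
  phi_integrable _ _ hs hsu hu :=
    (phiPrim_lintegral h₁ h₂ ha hp hap ⟨hs, hsu.trans hu⟩ ⟨hsu, hu⟩).1
  phi_differentiable _ _ hs hsu hu :=
    differentiableAt_phiPrim h₁ h₂ ha hp hap ⟨hs, hsu.trans hu⟩ hsu
  tau_integrable _ _ hs hsu hu :=
    (tauPrim_lintegral h₁ h₂ ha hp hap ⟨hs, hsu.trans hu⟩ ⟨hsu, hu⟩).1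
  tau_differentiable _ _ hs hsu hu :=
    differentiableAt_tauPrim h₁ h₂ ha hp hap ⟨hs, hsu.trans hu⟩ hsu
  weylRho_integrable _ _ hs hsu hu :=
    (sweptKer_eq_Kminus h₁ h₂ ha hp hap ⟨hs, hsu.trans hu⟩ hsu hu).1
  weylPsi_integrable _ _ hu hus hs :=
    (sweptKer_eq_Kplus h₁ h₂ ha hp hap ⟨hu.trans hus, hs⟩ hu hus).1
  tailRho_integrable _ _ hu hus hs :=
    (sweptKer_eq_Kplus h₁ h₂ ha hp hap ⟨hu.trans hus, hs⟩ hu hus).2.1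

end

/-! ### The transformed equation for a solution of variable sign -/

/-- The positive part of `h` on `(0, T)`, extended by `0`, with values in `[0, ∞]`. -/
def posPartOn (T : ℝ) (h : ℝ → ℝ) : ℝ → ℝ≥0∞ := (Ioo 0 T).indicator fun s => ENNReal.ofReal (h s)

lemma measurable_posPartOn {T : ℝ} {h : ℝ → ℝ} (hh : Measurable h) : Measurable (posPartOn T h) :=
  Measurable.indicator (by fun_prop) measurableSet_Ioo

lemma lintegral_posPartOn_mul (T : ℝ) (h : ℝ → ℝ) (k : ℝ → ℝ≥0∞) :
    ∫⁻ s, posPartOn T h s * k s = ∫⁻ s in Ioo 0 T, ENNReal.ofReal (h s) * k s := by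
  rw [← lintegral_indicator measurableSet_Ioo]
  refine lintegral_congr fun s => ?_
  by_cases hs : s ∈ Ioo 0 T
  · simp only [posPartOn, indicator_of_mem hs]
  · simp only [posPartOn, indicator_of_notMem hs, zero_mul]

/-- An integral of `h` against a nonnegative kernel, in terms of the positive and negative parts of
a measurable representative `h'` of `h`. -/
lemma integral_mul_kernel {T : ℝ} (hT : 0 < T) {h h' κ : ℝ → ℝ} {k : ℝ → ℝ≥0∞}
    (hh' : Measurable h') (hae : h =ᵐ[volume.restrict (Ioo 0 T)] h') (hk : Measurable k)
    (hκ : ∀ᵐ s ∂volume.restrict (Ioo 0 T), k s ≠ ∞ ∧ (k s).toReal = κ s)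
    (h1 : ∫⁻ s, posPartOn T h' s * k s ≠ ∞) (h2 : ∫⁻ s, posPartOn T (-h') s * k s ≠ ∞) :
    IntervalIntegrable (fun s => h s * κ s) volume 0 T ∧
      ∫ s in (0 : ℝ)..T, h s * κ s = (∫⁻ s, posPartOn T h' s * k s).toReal
        - (∫⁻ s, posPartOn T (-h') s * k s).toReal := by
  rw [lintegral_posPartOn_mul] at h1 h2 ⊢
  rw [lintegral_posPartOn_mul]
  have key : ∀ g : ℝ → ℝ, Measurable g → (∫⁻ s in Ioo 0 T, ENNReal.ofReal (g s) * k s ≠ ∞) →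
      IntervalIntegrable (fun s => max (g s) 0 * (k s).toReal) volume 0 T ∧
        ∫ s in (0 : ℝ)..T, max (g s) 0 * (k s).toReal
          = (∫⁻ s in Ioo 0 T, ENNReal.ofReal (g s) * k s).toReal := by
    intro g hg hfin
    refine intervalIntegrable_of_lintegral hT.le
      ((hg.max measurable_const).mul hk.ennreal_toReal) ?_ hfin
    filter_upwards [hκ] with s hs
    refine ⟨mul_nonneg (le_max_right _ _) ENNReal.toReal_nonneg, ?_⟩
    rw [ENNReal.ofReal_mul (le_max_right _ _), ENNReal.ofReal_toReal hs.1]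
    simp
  obtain ⟨i1, v1⟩ := key h' hh' h1
  obtain ⟨i2, v2⟩ := key (-h') hh'.neg h2
  have hcongr : ∀ᵐ s ∂volume.restrict (Ioc 0 T),
      max (h' s) 0 * (k s).toReal - max ((-h') s) 0 * (k s).toReal = h s * κ s := by
    rw [← Measure.restrict_congr_set Ioo_ae_eq_Ioc]
    filter_upwards [hκ, hae] with s hs hs'
    rw [← sub_mul, hs.2, hs', Pi.neg_apply]
    congr 1
    rcases le_total 0 (h' s) with h | h
    · simp [h]
    · simp [h]
  rw [← v1, ← v2, ← intervalIntegral.integral_sub i1 i2]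
  constructor
  · refine (i1.sub i2).congr_ae ?_
    rwa [uIoc_of_le hT.le]
  · refine (intervalIntegral.integral_congr_ae ?_).symm
    rw [uIoc_of_le hT.le]
    exact (ae_restrict_iff' measurableSet_Ioc).1 hcongr

lemma toReal_posPartOn_sub {T : ℝ} {h : ℝ → ℝ} {x : ℝ} (hx : x ∈ Ioo 0 T) :
    (posPartOn T h x).toReal - (posPartOn T (-h) x).toReal = h x := by
  simp only [posPartOn, indicator_of_mem hx, Pi.neg_apply, ENNReal.toReal_ofReal']
  rcases le_total 0 (h x) with h | h
  · simp [h]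
  · simp [h]

lemma lintegral_posPartOn_ne_top {T : ℝ} {h : ℝ → ℝ}
    (hi : Integrable h (volume.restrict (Ioo 0 T))) : ∫⁻ s, posPartOn T h s ≠ ∞ := by
  have := lintegral_posPartOn_mul T h 1
  simp only [Pi.one_apply, mul_one] at this
  rw [this]
  refine ((lintegral_mono fun s => ?_).trans_lt hi.hasFiniteIntegral).ne
  exact Real.ofReal_le_enorm _

/-- The equation `(Γ_{H₁} + Γ_{H₂}) h = 1` in terms of the positive and negative parts of `h`. -/
lemma ae_mixedPot_eq {a p T H₁ H₂ : ℝ} {h h' : ℝ → ℝ} (h₁ : 1 / 2 - H₁ = -a)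
    (h₂ : 2 * H₂ - 2 = -p) (ha : 0 < a) (hp : 0 < p) (hap : 2 * a + p < 1) (hT : 0 < T)
    (hc₁ : 0 < H₁ * (2 * H₁ - 1)) (hc₂ : 0 < H₂ * (2 * H₂ - 1))
    (hh' : Measurable h') (hae : h =ᵐ[volume.restrict (Ioo 0 T)] h')
    (hi : Integrable h' (volume.restrict (Ioo 0 T)))
    (heq : ∀ᵐ t ∂volume.restrict (Ioo 0 T), Gam H₁ T h t + Gam H₂ T h t = 1) :
    ∀ᵐ z ∂volume.restrict (Ioo 0 T),
      mixedPot a p (ENNReal.ofReal (H₁ * (2 * H₁ - 1))) (ENNReal.ofReal (H₂ * (2 * H₂ - 1)))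
        (posPartOn T h') z
      = 1 + mixedPot a p (ENNReal.ofReal (H₁ * (2 * H₁ - 1))) (ENNReal.ofReal (H₂ * (2 * H₂ - 1)))
        (posPartOn T (-h')) z := by
  have h0 : ∀ g : ℝ → ℝ, ∀ s ∉ Ioo 0 T, posPartOn T g s = 0 := fun g s hs =>
    indicator_of_notMem hs _
  have t1 := ae_mixedPot_ne_top ha hp hap ofReal_ne_top ofReal_ne_top
    (C₁ := ENNReal.ofReal (H₁ * (2 * H₁ - 1))) (C₂ := ENNReal.ofReal (H₂ * (2 * H₂ - 1)))
    (measurable_posPartOn hh') (lintegral_posPartOn_ne_top hi) (h0 _)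
  have t2 := ae_mixedPot_ne_top ha hp hap ofReal_ne_top ofReal_ne_top
    (C₁ := ENNReal.ofReal (H₁ * (2 * H₁ - 1))) (C₂ := ENNReal.ofReal (H₂ * (2 * H₂ - 1)))
    (measurable_posPartOn hh'.neg) (lintegral_posPartOn_ne_top hi.neg) (h0 _)
  filter_upwards [t1, t2, heq] with z hz1 hz2 hz
  have hC1 : ENNReal.ofReal (H₁ * (2 * H₁ - 1)) ≠ 0 := by simpa using hc₁
  have hC2 : ENNReal.ofReal (H₂ * (2 * H₂ - 1)) ≠ 0 := by simpa using hc₂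
  have split : ∀ g : ℝ → ℝ≥0∞, mixedPot a p (ENNReal.ofReal (H₁ * (2 * H₁ - 1)))
        (ENNReal.ofReal (H₂ * (2 * H₂ - 1))) g z ≠ ∞ →
      (∫⁻ s, g s * ap (2 * a - 1) (z - s)) ≠ ∞ ∧ (∫⁻ s, g s * ap (-p) (z - s)) ≠ ∞ ∧
      (mixedPot a p (ENNReal.ofReal (H₁ * (2 * H₁ - 1)))
        (ENNReal.ofReal (H₂ * (2 * H₂ - 1))) g z).toReal
        = H₁ * (2 * H₁ - 1) * (∫⁻ s, g s * ap (2 * a - 1) (z - s)).toReal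
          + H₂ * (2 * H₂ - 1) * (∫⁻ s, g s * ap (-p) (z - s)).toReal := by
    intro g hg
    rw [mixedPot, ENNReal.add_ne_top] at hg
    refine ⟨(ENNReal.lt_top_of_mul_ne_top_right hg.1 hC1).ne,
      (ENNReal.lt_top_of_mul_ne_top_right hg.2 hC2).ne, ?_⟩
    rw [mixedPot, ENNReal.toReal_add hg.1 hg.2, ENNReal.toReal_mul, ENNReal.toReal_mul,
      ENNReal.toReal_ofReal hc₁.le, ENNReal.toReal_ofReal hc₂.le]
  obtain ⟨f1, f2, f3⟩ := split _ hz1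
  obtain ⟨e1, e2, e3⟩ := split _ hz2
  have gam : ∀ q : ℝ, ∀ H : ℝ, 2 - 2 * H = -q → ∫⁻ s, posPartOn T h' s * ap q (z - s) ≠ ∞ →
      ∫⁻ s, posPartOn T (-h') s * ap q (z - s) ≠ ∞ →
      Gam H T h z = H * (2 * H - 1) * ((∫⁻ s, posPartOn T h' s * ap q (z - s)).toReal
        - (∫⁻ s, posPartOn T (-h') s * ap q (z - s)).toReal) := by
    intro q H hq k1 k2
    rw [Gam, ← (integral_mul_kernel hT hh' hae (κ := fun s => |z - s| ^ q)
      (k := fun s => ap q (z - s)) (by fun_prop) ?_ k1 k2).2]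
    · congr 1
      refine intervalIntegral.integral_congr fun s _ => ?_
      change h s / |z - s| ^ (2 - 2 * H) = h s * |z - s| ^ q
      rw [hq, Real.rpow_neg (abs_nonneg _), div_inv_eq_mul]
    · filter_upwards [ae_restrict_of_ae (ae_ne z)] with s hs
      refine ⟨ap_ne_top _ _, ?_⟩
      rw [ap_of_ne (sub_ne_zero.2 hs.symm), ENNReal.toReal_ofReal (by positivity)]
  rw [gam (2 * a - 1) H₁ (by linarith) f1 e1, gam (-p) H₂ (by linarith) f2 e2] at hz
  refine (ENNReal.toReal_eq_toReal_iff' hz1 (ENNReal.add_ne_top.2 ⟨one_ne_top, hz2⟩)).1 ?_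
  rw [ENNReal.toReal_add one_ne_top hz2, f3, e3, ENNReal.toReal_one]
  linarith

/-- Euler's reflection formula gives `B(1 - a, a) = π / sin (π a)`, and `sin (π a)` is
`cos (π (1 - H₁))`. -/
lemma c_mul_const {H₁ H₂ a : ℝ} (h₁ : 1 / 2 - H₁ = -a) (ha : 0 < a) (ha' : a < 1 / 2) :
    c H₁ H₂ * (H₁ * (2 * H₁ - 1) * (abelConst a * ProbabilityTheory.beta (1 - a) a))
      = H₂ * (2 * H₂ - 1) := by
  have g1 := (Real.Gamma_pos_of_pos (show 0 < 1 - a by linarith)).ne'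
  have g2 := (Real.Gamma_pos_of_pos (show 0 < 1 - 2 * a by linarith)).ne'
  have g3 := (Real.Gamma_pos_of_pos ha).ne'
  have hH : H₁ = 1 / 2 + a := by linarith
  have hr := Real.Gamma_mul_Gamma_one_sub a
  have hsin : 0 < Real.sin (Real.pi * a) :=
    Real.sin_pos_of_pos_of_lt_pi (by positivity) (by nlinarith [Real.pi_pos])
  have hcos : Real.cos (Real.pi * (1 - H₁)) = Real.sin (Real.pi * a) := by
    rw [hH, ← Real.cos_pi_div_two_sub]; congr 1; ring
  have hH1 : H₁ ≠ 0 := by rw [hH]; positivity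
  have hH2 : 2 * H₁ - 1 ≠ 0 := by rw [hH]; intro hc; linarith
  have hA : abelConst a = Real.Gamma (1 - a) ^ 2 / Real.Gamma (1 - 2 * a) := by
    rw [abelConst, ProbabilityTheory.beta, ProbabilityTheory.beta, sub_add_cancel,
      show 1 - 2 * a + a = 1 - a by ring, Real.Gamma_one]
    field_simp
  have hB : ProbabilityTheory.beta (1 - a) a = Real.pi / Real.sin (Real.pi * a) := by
    rw [ProbabilityTheory.beta, sub_add_cancel, Real.Gamma_one, div_one, mul_comm, hr]
  rw [c, hcos, hA, hB, show 2 - 2 * H₁ = 1 - 2 * a by linarith,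
    show 3 / 2 - H₁ = 1 - a by linarith]
  have := Real.pi_pos.ne'
  have := hsin.ne'
  generalize Real.sin (Real.pi * a) = S at *
  field_simp

lemma g_mul_const {H₁ T a u : ℝ} (h₁ : 1 / 2 - H₁ = -a) (ha : 0 < a) (ha' : a < 1 / 2)
    (hu : 0 < u) :
    g H₁ T u * (H₁ * (2 * H₁ - 1) * ProbabilityTheory.beta (1 - a) a) * u ^ a = (T - u) ^ (-a) := by
  have hb : ProbabilityTheory.beta (3 / 2 - H₁) (H₁ + 1 / 2)
      = a * ProbabilityTheory.beta (1 - a) a := by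
    rw [show 3 / 2 - H₁ = 1 - a by linarith, show H₁ + 1 / 2 = a + 1 by linarith,
      ProbabilityTheory.beta, ProbabilityTheory.beta, Real.Gamma_add_one ha.ne',
      show 1 - a + (a + 1) = 1 + 1 by ring, sub_add_cancel, Real.Gamma_add_one one_ne_zero,
      Real.Gamma_one]
    ring
  have hB := (ProbabilityTheory.beta_pos (show 0 < 1 - a by linarith) ha).ne'
  have hH1 : H₁ ≠ 0 := by intro hc; linarith
  have e2 : u ^ (-a) * u ^ a = 1 := by rw [← Real.rpow_add hu, neg_add_cancel, Real.rpow_zero]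
  rw [g, hb, h₁, show 2 * H₁ - 1 = 2 * a by linarith]
  have := ha.ne'
  rw [div_mul_eq_mul_div, div_mul_eq_mul_div, div_eq_iff (by positivity)]
  linear_combination (2 * H₁ * a * ProbabilityTheory.beta (1 - a) a * (T - u) ^ (-a)) * e2

lemma ae_transformed_eq {a p T H₁ H₂ : ℝ} {h : ℝ → ℝ} (h₁ : 1 / 2 - H₁ = -a)
    (h₂ : 2 * H₂ - 2 = -p) (ha : 0 < a) (hp : 0 < p) (hap : 2 * a + p < 1) (hT : 0 < T)
    (hc₁ : 0 < H₁ * (2 * H₁ - 1)) (hc₂ : 0 < H₂ * (2 * H₂ - 1)) (hsol : IsL2Solution H₁ H₂ T h) :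
    ∀ᵐ u ∂volume.restrict (Ioo 0 T), IntervalIntegrable (fun s => h s * K H₁ H₂ T u s) volume 0 T ∧
      h u + c H₁ H₂ * (∫ s in (0 : ℝ)..T, h s * K H₁ H₂ T u s) = g H₁ T u := by
  have ha' : a < 1 / 2 := by linarith
  obtain ⟨h', hh', hae⟩ : ∃ h', Measurable h' ∧ h =ᵐ[volume.restrict (Ioo 0 T)] h' :=
    hsol.memLp.1.aemeasurable
  have hi : Integrable h' (volume.restrict (Ioo 0 T)) :=
    (hsol.memLp.integrable one_le_two).congr hae
  have h0 : ∀ g : ℝ → ℝ, ∀ s ∉ Ioo 0 T, posPartOn T g s = 0 := fun g s hs =>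
    indicator_of_notMem hs _
  have hmain := ae_sweptSum_eq ha hp hap hT ofReal_ne_top ofReal_ne_top
    (measurable_posPartOn hh') (lintegral_posPartOn_ne_top hi) (h0 _)
    (measurable_posPartOn hh'.neg) (h0 _)
    (ae_mixedPot_eq h₁ h₂ ha hp hap hT hc₁ hc₂ hh' hae hi hsol.eq_one)
  have t1 := ae_sweptSum_ne_top ha hp hap hT ofReal_ne_top ofReal_ne_top
    (C₁ := ENNReal.ofReal (H₁ * (2 * H₁ - 1))) (C₂ := ENNReal.ofReal (H₂ * (2 * H₂ - 1)))
    (measurable_posPartOn hh') (lintegral_posPartOn_ne_top hi) (h0 _)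
  have t2 := ae_sweptSum_ne_top ha hp hap hT ofReal_ne_top ofReal_ne_top
    (C₁ := ENNReal.ofReal (H₁ * (2 * H₁ - 1))) (C₂ := ENNReal.ofReal (H₂ * (2 * H₂ - 1)))
    (measurable_posPartOn hh'.neg) (lintegral_posPartOn_ne_top hi.neg) (h0 _)
  filter_upwards [hmain, t1, t2, hae, ae_restrict_mem measurableSet_Ioo] with u hu hu1 hu2 huh huT
  have hC2 : ENNReal.ofReal (H₂ * (2 * H₂ - 1)) ≠ 0 := by simpa using hc₂
  have hA := abelConst_pos ha ha'
  have hB := ProbabilityTheory.beta_pos (show 0 < 1 - a by linarith) ha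
  have hua := Real.rpow_pos_of_pos huT.1 a
  have split : ∀ g : ℝ → ℝ≥0∞, sweptSum a p T (ENNReal.ofReal (H₁ * (2 * H₁ - 1)))
        (ENNReal.ofReal (H₂ * (2 * H₂ - 1))) g u ≠ ∞ →
      (∫⁻ s, g s * sweptKer a p T u s) ≠ ∞ ∧
      (sweptSum a p T (ENNReal.ofReal (H₁ * (2 * H₁ - 1)))
        (ENNReal.ofReal (H₂ * (2 * H₂ - 1))) g u).toReal
        = H₁ * (2 * H₁ - 1) * (abelConst a * ProbabilityTheory.beta (1 - a) a)
            * (u ^ a * (g u).toReal)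
          + H₂ * (2 * H₂ - 1) * (∫⁻ s, g s * sweptKer a p T u s).toReal := by
    intro g hg
    rw [sweptSum, ENNReal.add_ne_top] at hg
    refine ⟨(ENNReal.lt_top_of_mul_ne_top_right hg.2 hC2).ne, ?_⟩
    rw [sweptSum, ENNReal.toReal_add hg.1 hg.2]
    simp only [ENNReal.toReal_mul]
    rw [ENNReal.toReal_ofReal hc₁.le, ENNReal.toReal_ofReal hc₂.le, ENNReal.toReal_ofReal hA.le,
      ENNReal.toReal_ofReal hB.le, pw_of_pos huT.1, ENNReal.toReal_ofReal hua.le]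
    ring
  obtain ⟨f1, f3⟩ := split _ hu1
  obtain ⟨e1, e3⟩ := split _ hu2
  obtain ⟨i1, i2⟩ := integral_mul_kernel hT hh' hae (k := fun s => sweptKer a p T u s)
    (κ := fun s => u ^ a * K H₁ H₂ T u s) (by fun_prop) (by
      filter_upwards [ae_restrict_of_ae (ae_ne u), ae_restrict_mem measurableSet_Ioo] with s hsu hs
      exact ⟨sweptKer_ne_top ha hp hap hs huT, sweptKer_eq_K h₁ h₂ ha hp hap hs huT hsu.symm⟩) f1 e1
  have hfun : (fun s => h s * (u ^ a * K H₁ H₂ T u s))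
      = fun s => u ^ a * (h s * K H₁ H₂ T u s) := by funext s; ring
  rw [hfun] at i1 i2
  rw [intervalIntegral.integral_const_mul] at i2
  refine ⟨?_, ?_⟩
  · have := i1.const_mul (u ^ a)⁻¹
    simpa [← mul_assoc, inv_mul_cancel₀ hua.ne'] using this
  · have hTu : 0 < T - u := by linarith [huT.2]
    have hr := congrArg ENNReal.toReal hu
    rw [ENNReal.toReal_add (ENNReal.mul_ne_top ofReal_ne_top (pw_ne_top _ _)) hu2, f3, e3,
      ENNReal.toReal_mul, ENNReal.toReal_ofReal hA.le, pw_of_pos hTu,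
      ENNReal.toReal_ofReal (Real.rpow_nonneg hTu.le _)] at hr
    have hd := toReal_posPartOn_sub (h := h') huT
    rw [← huh] at hd
    have hcm := c_mul_const (H₂ := H₂) h₁ ha ha'
    have hgm := g_mul_const (T := T) h₁ ha ha' huT.1
    have hne :
        H₁ * (2 * H₁ - 1) * (abelConst a * ProbabilityTheory.beta (1 - a) a) * u ^ a ≠ 0 := by
      positivity
    refine mul_right_cancel₀ hne ?_
    linear_combination hr + (u ^ a * ∫ s in (0 : ℝ)..T, h s * K H₁ H₂ T u s) * hcm
      - abelConst a * hgm
      - (H₁ * (2 * H₁ - 1) * (abelConst a * ProbabilityTheory.beta (1 - a) a) * u ^ a) * hd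
      + H₂ * (2 * H₂ - 1) * i2

end

end MixedFBM

theorem theorem3p1 (H₁ H₂ T : ℝ) (hH₁ : H₁ ∈ Set.Ioc (1 / 2 : ℝ) (3 / 4))
    (hH₂ : H₂ ∈ Set.Ioo H₁ 1) (hT : 0 < T) :
    MixedFBM.KernelWellDefined H₁ H₂ T ∧
    ∀ h : ℝ → ℝ, MixedFBM.IsL2Solution H₁ H₂ T h →
      ∀ᵐ u ∂(volume.restrict (Set.Ioo 0 T)),
        IntervalIntegrable (fun s => h s * MixedFBM.K H₁ H₂ T u s) volume 0 T ∧
        h u + MixedFBM.c H₁ H₂ * (∫ s in (0 : ℝ)..T, h s * MixedFBM.K H₁ H₂ T u s)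
          = MixedFBM.g H₁ T u := by
  have h₁ : 1 / 2 - H₁ = -(H₁ - 1 / 2) := by ring
  have h₂ : 2 * H₂ - 2 = -(2 - 2 * H₂) := by ring
  have ha : 0 < H₁ - 1 / 2 := by linarith [hH₁.1]
  have hp : 0 < 2 - 2 * H₂ := by linarith [hH₂.2]
  have hap : 2 * (H₁ - 1 / 2) + (2 - 2 * H₂) < 1 := by linarith [hH₂.1]
  exact ⟨MixedFBM.kernelWellDefined h₁ h₂ ha hp hap, fun h hh =>
    MixedFBM.ae_transformed_eq h₁ h₂ ha hp hap hT
      (mul_pos (by linarith [hH₁.1]) (by linarith [hH₁.1]))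
      (mul_pos (by linarith [hH₁.1, hH₂.1]) (by linarith [hH₁.1, hH₂.1])) hh⟩
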